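/- Let $\alpha,\beta,\nu\in\mathbb R$ with $\alpha\beta\neq 0$ and $|\nu|\neq 1$, and consider, for complex-valued $u=u(t,x)$ and real-valued $v=v(t,x)$, the Cauchy problem $$i\partial_t u+\partial_x^2u=\alpha uv,\qquad \partial_t v+\nu\mathcal H\partial_x^2 v=\beta\,\partial_x(|u|^2),\qquad u(0)=\phi,\quad v(0)=\psi,$$ where $x\in\mathbb R$ and $\mathcal H$ is the Hilbert transform (symbol $-i\,\mathrm{sgn}\,\xi$). Its integral form is $$u(t)=e^{it\partial_x^2}\phi-i\alpha\int_0^t e^{i(t-t')\partial_x^2}\big(u(t')v(t')\big)\,dt',\tag{1}$$ $$v(t)=e^{-\nu t\mathcal H\partial_x^2}\psi+\beta\int_0^t e^{-\nu (t-t')\mathcal H\partial_x^2}\partial_x\big(|u(t')|^2\big)\,dt'.\tag{2}$$ Notation. Fourier transforms have kernel $e^{-2\pi i(t\tau+x\xi)}$, and $\langle y\rangle=\sqrt{1+y^2}$. $H^s=H^s(\mathbb R)$ has the norm $\|\langle\xi\rangle^s\widehat f\|_{L^2}$; the first component of the data is complex-valued and the second is real-valued. For $b,b'>1/2$, $X^{s,b}$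 and $Y^{s',b'}$ are the completions of the Schwartz class $\mathcal S(\mathbb R^2)$ under $$\|f\|_{X^{s,b}}=\big\|\langle\xi\rangle^s\langle\tau+2\pi\xi^2\rangle^b\widehat f(\tau,\xi)\big\|_{L^2_{\tau,\xi}},\qquad \|g\|_{Y^{s',b'}}=\big\|\langle\xi\rangle^{s'}\langle\tau+2\pi\nu|\xi|\xi\rangle^{b'}\widehat g(\tau,\xi)\big\|_{L^2_{\tau,\xi}};$$ they embed into $C^0(\mathbb R;H^s)$ and $C^0(\mathbb R;H^{s'})$. $X^{s,b}_T$ and $Y^{s',b'}_T$ are the spaces of restrictions to $[-T,T]$ of their elements (the quotients by the elements that vanish on $[-T,T]$). The nonlinear terms in (1)-(2) are understood through the space-time Fourier transform: $\widehat{uv}=\widehat u*\widehat v$ and $\widehat{|u|^2}=\widehat u*\widehat{\bar u}$, with convolution integrals that converge absolutely almost everywhere; and if $F$ has space-time Fourier transform $\widehat F$ and $G(t)$ is one of the two linear groups, with symbol $G(t,\xi)$, then $\int_0^tG(t-t')F(t')\,dt'$ is the distribution whose spatial Fourier transform is $\int_{\mathbb R}\big(\int_0^tG(t-t',\xi)e^{2\pi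 it'\tau}dt'\big)\widehat F(\tau,\xi)\,d\tau$, where the integral in $\tau$ converges absolutely for almost every $\xi$. **Theorem 1.1.** Let $|\nu|\ne1$ and let $s,s'\in\mathbb R$ satisfy $$-\tfrac12\le s'\le 2s-\tfrac12,\qquad s-1<s'<s+\tfrac12 .$$ Then the Cauchy problem is locally well-posed in $H^s(\mathbb R)\times H^{s'}(\mathbb R)$ in the following sense. For every $R>0$ there exist $T=T(R)>0$ and $b,b'>1/2$ such that, for all $(\phi,\psi)\in H^s\times H^{s'}$ with $\|\phi\|_{H^s}+\|\psi\|_{H^{s'}}<R$, there is a unique $(u,v)\in X^{s,b}_T\times Y^{s',b'}_T$ satisfying (1)-(2) for all $t\in[-T,T]$. Moreover $v(t)$ is real-valued for $t\in[-T,T]$, $$(u,v)\in C^0([-T,T];H^s(\mathbb R))\times C^0([-T,T];H^{s'}(\mathbb R)),$$ and the flow map $$S:B_R\to C^0([-T,T];H^s(\mathbb R))\times C^0([-T,T];H^{s'}(\mathbb R)),\qquad(\phi,\psi)\mapsto(u,v),$$ is Lipschitz continuous, where $B_R$ is the open ball of radius $R$ centred at the origin of $H^s(\mathbb R)\times H^{s'}(\mathbb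 R)$. -/

import Mathlib

open MeasureTheory Filter Topology Set TemperedDistribution
open scoped SchwartzMap FourierTransform ENNReal NNReal ComplexConjugate

namespace SBO

noncomputable section

/-! Conventions. The Fourier transform is the one with kernel `exp (-2πi x ξ)`, so that `∂ₓ` has
the symbol `2πiξ`. Space-time frequencies are pairs `z = (τ, ξ)`, with `τ` dual to time and `ξ`
dual to space. -/

/-- The bracket `⟨x⟩ = √(1 + |x|²)`. -/
def bracket (x : ℝ) : ℝ := √(1 + x ^ 2)

/-! ### Sobolev spaces and real-valued distributions on the line -/

/-- The norm `‖f‖_{H^s} = ‖⟨ξ⟩^s f̂‖_{L²}` of a tempered distribution, namely the `L²` norm of its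
Bessel potential of order `s`. It is `∞` exactly when `f` is not in `H^s`. -/
def sobolevNorm (s : ℝ) (f : 𝓢'(ℝ, ℂ)) : ℝ≥0∞ :=
  ⨅ (g : Lp ℂ 2 (volume : Measure ℝ)) (_ : besselPotential ℝ ℂ s f = (g : 𝓢'(ℝ, ℂ))), ‖g‖ₑ

/-- A distribution is real-valued if it takes real values on real test functions. -/
def IsRealValued (f : 𝓢'(ℝ, ℂ)) : Prop :=
  ∀ χ : 𝓢(ℝ, ℂ), (∀ x, (χ x).im = 0) → (f χ).im = 0

/-- `w ∈ C⁰([-T, T]; H^s)`. -/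
def ContinuousInSobolev (s T : ℝ) (w : ℝ → 𝓢'(ℝ, ℂ)) : Prop :=
  ∀ t₀ ∈ Icc (-T) T, MemSobolev s 2 (w t₀) ∧
    Tendsto (fun t ↦ sobolevNorm s (w t - w t₀)) (𝓝[Icc (-T) T] t₀) (𝓝 0)

/-- The distance in `C⁰([-T, T]; H^s)`. -/
def supSobolevDist (s T : ℝ) (w₁ w₂ : ℝ → 𝓢'(ℝ, ℂ)) : ℝ≥0∞ :=
  ⨆ t ∈ Icc (-T) T, sobolevNorm s (w₁ t - w₂ t)

/-- `(φ, ψ)` lies in the open ball of radius `R` of `H^s × H^{s'}`. The elements of `H^s` are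
complex-valued and those of `H^{s'}` are real-valued. -/
def InBall (s s' R : ℝ) (φ ψ : 𝓢'(ℝ, ℂ)) : Prop :=
  MemSobolev s 2 φ ∧ MemSobolev s' 2 ψ ∧ IsRealValued ψ ∧
    sobolevNorm s φ + sobolevNorm s' ψ < ENNReal.ofReal R

/-- The Fourier transform of the tempered distribution `f` is the function `h`. -/
def HasFourier (f : 𝓢'(ℝ, ℂ)) (h : ℝ → ℂ) : Prop :=
  ∀ χ : 𝓢(ℝ, ℂ), Integrable (fun ξ ↦ χ ξ * h ξ) ∧ 𝓕 f χ = ∫ ξ, χ ξ * h ξ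

/-! ### The linear groups -/

/-- The symbol of `∂ₓ`. -/
def derivSymbol (ξ : ℝ) : ℂ := 2 * Real.pi * Complex.I * ξ

/-- The symbol of the Hilbert transform `ℋ`. -/
def hilbertSymbol (ξ : ℝ) : ℂ := -Complex.I * Real.sign ξ

/-- The symbol of the Schrödinger group `exp (i t ∂ₓ²)`. -/
def schrodingerGroup (t ξ : ℝ) : ℂ := Complex.exp (Complex.I * t * derivSymbol ξ ^ 2)

/-- The symbol of the Benjamin-Ono group `exp (-ν t ℋ ∂ₓ²)`. -/
def benjaminOnoGroup (ν t ξ : ℝ) : ℂ :=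
  Complex.exp (-(ν * t * hilbertSymbol ξ * derivSymbol ξ ^ 2))

/-- The Schrödinger group is `exp (-2πi t p(ξ))` with this `p`. -/
def schrodingerPhase (ξ : ℝ) : ℝ := 2 * Real.pi * ξ ^ 2

/-- The Benjamin-Ono group is `exp (-2πi t p(ξ))` with this `p`. -/
def benjaminOnoPhase (ν ξ : ℝ) : ℝ := 2 * Real.pi * ν * |ξ| * ξ

theorem schrodingerGroup_eq (t ξ : ℝ) : schrodingerGroup t ξ =
    Complex.exp (-(2 * Real.pi * Complex.I * t * schrodingerPhase ξ)) := by
  unfold schrodingerGroup schrodingerPhase derivSymbol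
  congr 1
  push_cast
  linear_combination (4 * Real.pi ^ 2 * ξ ^ 2 * t * Complex.I : ℂ) * Complex.I_sq

theorem benjaminOnoGroup_eq (ν t ξ : ℝ) : benjaminOnoGroup ν t ξ =
    Complex.exp (-(2 * Real.pi * Complex.I * t * benjaminOnoPhase ν ξ)) := by
  unfold benjaminOnoGroup benjaminOnoPhase derivSymbol hilbertSymbol
  have h : (ξ.sign : ℂ) * ξ = ((|ξ| : ℝ) : ℂ) := by
    rw [← Complex.ofReal_mul]; congr 1
    rcases lt_trichotomy ξ 0 with h | h | h
    · simp [Real.sign_of_neg h, abs_of_neg h]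
    · simp [h]
    · simp [Real.sign_of_pos h, abs_of_pos h]
  congr 1
  push_cast
  rw [← h]
  linear_combination (4 * Real.pi ^ 2 * ξ ^ 2 * t * ν * ξ.sign * Complex.I : ℂ) * Complex.I_sq

/-- `w = G(t) φ`, where `G(t)` is the Fourier multiplier with symbol `G t`. -/
def IsLinearEvolution (G : ℝ → ℝ → ℂ) (t : ℝ) (φ w : 𝓢'(ℝ, ℂ)) : Prop :=
  ∃ h : ℝ → ℂ, HasFourier φ h ∧ HasFourier w (fun ξ ↦ G t ξ * h ξ)

/-! ### Bourgain spaces -/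

/-- `u`, with space-time Fourier transform `g`, belongs to the Bourgain space of the dispersion
`p` with exponents `s` and `b`, that is, `⟨ξ⟩^s ⟨τ + p(ξ)⟩^b g ∈ L²`. For `b > 1/2` this is the
completion of the Schwartz class under this norm, and it embeds into `C⁰(ℝ; H^s)`; an element is
identified here with its time slices `u t`, recovered from `g` by Fourier inversion in time. -/
def IsBourgain (p : ℝ → ℝ) (s b : ℝ) (u : ℝ → 𝓢'(ℝ, ℂ)) (g : ℝ × ℝ → ℂ) : Prop :=
  MemLp (fun z : ℝ × ℝ ↦ ((bracket z.2 ^ s * bracket (z.1 + p z.2) ^ b : ℝ) : ℂ) * g z) 2 ∧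
  (∀ᵐ ξ : ℝ, Integrable fun τ ↦ g (τ, ξ)) ∧
  ∀ t : ℝ, HasFourier (u t)
    (fun ξ ↦ ∫ τ : ℝ, Complex.exp (2 * Real.pi * Complex.I * t * τ) * g (τ, ξ))

/-! ### Products and Duhamel terms

The nonlinear terms are read on the Fourier side, where they make sense even when the product of
two time slices is not defined. -/

/-- The Fourier transform of a product converges absolutely almost everywhere. -/
def ProductConverges (g h : ℝ × ℝ → ℂ) : Prop :=
  ∀ᵐ z : ℝ × ℝ, Integrable fun z₁ : ℝ × ℝ ↦ g (z - z₁) * h z₁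

/-- The Fourier transform `g ∗ h` of the product of two functions with Fourier transforms `g` and
`h`. -/
def productFourier (g h : ℝ × ℝ → ℂ) (z : ℝ × ℝ) : ℂ := ∫ z₁ : ℝ × ℝ, g (z - z₁) * h z₁

/-- The Fourier transform of the complex conjugate. -/
def conjFourier (g : ℝ × ℝ → ℂ) (z : ℝ × ℝ) : ℂ := conj (g (-z))

/-- `∫₀ᵗ G(t - t') exp (2πi t' τ) dt'`. -/
def duhamelKernel (G : ℝ → ℝ → ℂ) (t τ ξ : ℝ) : ℂ :=
  ∫ r in (0 : ℝ)..t, G (t - r) ξ * Complex.exp (2 * Real.pi * Complex.I * r * τ)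

/-- When `f(t')` has a spatial Fourier transform given by an absolutely convergent inversion in
time, the Duhamel term has the Fourier transform `∫₀ᵗ G(t - t', ξ) (f(t'))^(ξ) dt'`. -/
theorem duhamel_formula (G : ℝ → ℝ → ℂ) (hG : ∀ ξ, Continuous fun t ↦ G t ξ) (t ξ : ℝ)
    (F : ℝ × ℝ → ℂ) (hF : Integrable fun τ ↦ F (τ, ξ)) :
    ∫ τ : ℝ, duhamelKernel G t τ ξ * F (τ, ξ) = ∫ r in (0 : ℝ)..t, G (t - r) ξ *
      ∫ τ : ℝ, Complex.exp (2 * Real.pi * Complex.I * r * τ) * F (τ, ξ) := by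
  simp only [duhamelKernel, ← intervalIntegral.integral_mul_const, ← integral_const_mul]
  have := intervalIntegral_integral_swap (μ := volume) (a := 0) (b := t) (f := fun r (τ : ℝ) ↦
    G (t - r) ξ * Complex.exp (2 * Real.pi * Complex.I * r * τ) * F (τ, ξ)) ?_
  · rw [← this]; simp only [mul_assoc]
  · have hc : Continuous (fun z : ℝ × ℝ ↦
        G (t - z.1) ξ * Complex.exp (2 * Real.pi * Complex.I * z.1 * z.2)) := by
      have := hG ξ
      fun_prop
    have hi : Integrable (fun z : ℝ × ℝ ↦ (1:ℂ) * F (z.2, ξ)) (((volume : Measure ℝ).restrict (uIoc 0 t)).prod (volume : Measure ℝ)) := by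
      apply Integrable.mul_prod (f := fun _ ↦ (1:ℂ)) _ hF
      rw [integrable_const_iff]; right; exact ⟨by simp [uIoc, Real.volume_Ioc]⟩
    have hb : ∃ C, ∀ r ∈ uIcc 0 t, ‖G (t - r) ξ‖ ≤ C :=
      isCompact_uIcc.exists_bound_of_continuousOn (by have := hG ξ; fun_prop)
    obtain ⟨C, hC⟩ := hb
    simp only [one_mul] at hi
    refine (hi.bdd_mul (c := C) (hc.aestronglyMeasurable) ?_)
    have : ∀ᵐ z : ℝ × ℝ ∂((volume.restrict (uIoc 0 t)).prod (volume : Measure ℝ)), z.1 ∈ uIoc 0 t :=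
      Measure.quasiMeasurePreserving_fst.ae (ae_restrict_mem measurableSet_uIoc)
    filter_upwards [this] with z hz
    rw [norm_mul, show (2 * Real.pi * Complex.I * z.1 * z.2 : ℂ) =
      ((2 * Real.pi * z.1 * z.2 : ℝ) : ℂ) * Complex.I by push_cast; ring,
      Complex.norm_exp_ofReal_mul_I, mul_one]
    exact hC _ (uIoc_subset_uIcc hz)

/-- `w = ∫₀ᵗ G(t - t') f(t') dt'`, where `f` has the space-time Fourier transform `F`. Here
`f(t')` is written as the superposition over `τ` of its time frequencies `exp (2πi t' τ) F(τ, ξ)`,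
and the time integral is taken for each of them. -/
def IsDuhamel (G : ℝ → ℝ → ℂ) (F : ℝ × ℝ → ℂ) (t : ℝ) (w : 𝓢'(ℝ, ℂ)) : Prop :=
  (∀ᵐ ξ : ℝ, Integrable fun τ ↦ duhamelKernel G t τ ξ * F (τ, ξ)) ∧
  HasFourier w (fun ξ ↦ ∫ τ : ℝ, duhamelKernel G t τ ξ * F (τ, ξ))

/-- `u(t) = exp (i t ∂ₓ²) φ - i α ∫₀ᵗ exp (i (t - t') ∂ₓ²) (u v)(t') dt'` for `t ∈ [-T, T]`, where
`u` and `v` have the space-time Fourier transforms `g` and `h`. -/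
def SchrodingerEquation (α T : ℝ) (φ : 𝓢'(ℝ, ℂ)) (u : ℝ → 𝓢'(ℝ, ℂ)) (g h : ℝ × ℝ → ℂ) : Prop :=
  ProductConverges g h ∧
  ∀ t ∈ Icc (-T) T, ∃ w₀ w₁ : 𝓢'(ℝ, ℂ),
    IsLinearEvolution schrodingerGroup t φ w₀ ∧
    IsDuhamel schrodingerGroup (productFourier g h) t w₁ ∧
    u t = w₀ - (Complex.I * α) • w₁

/-- `v(t) = exp (-ν t ℋ ∂ₓ²) ψ + β ∫₀ᵗ exp (-ν (t - t') ℋ ∂ₓ²) ∂ₓ(|u(t')|²) dt'` for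
`t ∈ [-T, T]`, where `u` has the space-time Fourier transform `g`. -/
def BenjaminOnoEquation (β ν T : ℝ) (ψ : 𝓢'(ℝ, ℂ)) (v : ℝ → 𝓢'(ℝ, ℂ)) (g : ℝ × ℝ → ℂ) : Prop :=
  ProductConverges g (conjFourier g) ∧
  ∀ t ∈ Icc (-T) T, ∃ w₀ w₁ : 𝓢'(ℝ, ℂ),
    IsLinearEvolution (benjaminOnoGroup ν) t ψ w₀ ∧
    IsDuhamel (benjaminOnoGroup ν)
      (fun z ↦ derivSymbol z.2 * productFourier g (conjFourier g) z) t w₁ ∧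
    v t = w₀ + (β : ℂ) • w₁

/-- `(u, v) ∈ X^{s,b} × Y^{s',b'}` satisfies the integral equations with data `(φ, ψ)` for all
`t ∈ [-T, T]`. As an element of `X_T^{s,b} × Y_T^{s',b'}` it is the restriction of `(u, v)` to
`[-T, T]`. -/
def IsSolution (α β ν s s' b b' T : ℝ) (φ ψ : 𝓢'(ℝ, ℂ)) (u v : ℝ → 𝓢'(ℝ, ℂ)) : Prop :=
  ∃ g h : ℝ × ℝ → ℂ,
    IsBourgain schrodingerPhase s b u g ∧
    IsBourgain (benjaminOnoPhase ν) s' b' v h ∧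
    SchrodingerEquation α T φ u g h ∧
    BenjaminOnoEquation β ν T ψ v g

end

end SBO

open SBO

/-! # Local well-posedness of the Schrödinger-Benjamin-Ono system

The proof is Bourgain's Fourier restriction method, carried out on the Fourier side: an element of a
Bourgain space is a function `g` of the frequencies `(τ, ξ)`, and its spatial Fourier transform at
time `t` is `slice g t`.

*Bilinear estimates.* By duality, the estimates `X^{s,b} × Y^{s',b'} → X^{s,-a}` of `u v` and
`X^{s,b} × X^{s,b} → Y^{s',-a'}` of `∂ₓ(|u|²)` say that two trilinear forms on `L²` are bounded. The
modulations of the three factors differ by the function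
`resonance ν ξ ξ₁ = 2π (ξ - ξ₁) (ξ + ξ₁ - ν |ξ - ξ₁|)`. Because `|ν| ≠ 1`, either it is at least of
the size of `(ξ - ξ₁)²`, so that the largest modulation pays for derivatives, or the frequencies
`ξ` and `ξ₁` both dominate `ξ - ξ₁` and the phase `ξ₁ - ν |ξ - ξ₁|` is not stationary
(`exists_resonance_dichotomy`). Accordingly the multipliers are bounded by sums of a few kernels,
each of which involves two modulations only; such a kernel is treated by the Cauchy-Schwarz
inequality, with the third frequency fixed, and one-dimensional integrals of brackets of quadratic
polynomials (`isTriBounded_inputs_one`, `isTriBounded_inputs_deriv`, `isTriBounded_output_first`,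
`isTriBounded_output_second`). For a suitable choice of exponents one has `a + b < 1` and
`a' + b' < 1` with `b, b' > 1/2` (`exists_schrodingerBenjaminOno`).

*Existence.* The Duhamel integral, multiplied by `χ(t / δ)` for a cutoff `χ`, acts in the variable
`τ + p(ξ)` through an explicit kernel (`truncKernel`), and maps the modulation exponent `-a` to `b`
with the norm `O(δ ^ (1 - a - b))` (`exists_bourgainNorm_duhamelOp_le`). So for small `δ` the
truncated equations are solved by a contraction in a ball of `X^{s,b} × Y^{s',b'}`
(`DispersiveSystem.Small.exists_truncatedSolution`), which is Lipschitz in the data. As `b, b' > 1/2`,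
the time slices depend continuously on time and are bounded by the Bourgain norms.

*Uniqueness.* Solutions in the restriction spaces have arbitrary extensions outside of `[-T, T]`.
The Duhamel integral of a product up to time `t` depends only on the time slices of the factors
between `0` and `t` (`ProductBound.duhamelSlice_eq_zero`). Hence, on a short interval, the
truncated Duhamel operators turn an extension of the difference of two solutions into another
extension of half the norm, and the difference vanishes
(`DispersiveSystem.Small.slice_eq_zero`). Translation in time then covers `[-T, T]` by short
intervals (`DispersiveSystem.slice_unique`).

*Real-valuedness.* The Benjamin-Ono phase is odd and the Fourier transform of `∂ₓ(|u|²)` is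
Hermitian, hence so is the right-hand side of the second equation. -/


namespace SBO

noncomputable section

/-! ### The bracket and one-dimensional integrals -/

theorem one_le_bracket (x : ℝ) : 1 ≤ bracket x :=
  Real.one_le_sqrt.2 (by nlinarith [sq_nonneg x])

theorem bracket_pos (x : ℝ) : 0 < bracket x := one_pos.trans_le (one_le_bracket x)

theorem abs_le_bracket (x : ℝ) : |x| ≤ bracket x :=
  Real.abs_le_sqrt (by linarith)

theorem bracket_neg (x : ℝ) : bracket (-x) = bracket x := by simp [bracket]

theorem bracket_sub_comm (x y : ℝ) : bracket (x - y) = bracket (y - x) := by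
  rw [← bracket_neg, neg_sub]

theorem bracket_le_one_add_abs (x : ℝ) : bracket x ≤ 1 + |x| :=
  Real.sqrt_le_iff.2 ⟨by positivity, by nlinarith [sq_abs x, abs_nonneg x]⟩

theorem bracket_mono {x y : ℝ} (h : |x| ≤ |y|) : bracket x ≤ bracket y :=
  Real.sqrt_le_sqrt (by have := sq_le_sq.2 h; linarith)

theorem bracket_le_mul {C x y : ℝ} (hC : 1 ≤ C) (h : |x| ≤ C * |y|) :
    bracket x ≤ C * bracket y := by
  refine Real.sqrt_le_iff.2 ⟨by have := bracket_pos y; positivity, ?_⟩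
  rw [mul_pow, bracket, Real.sq_sqrt (by positivity), ← sq_abs x, ← sq_abs y]
  have := pow_le_pow_left₀ (abs_nonneg x) h 2
  nlinarith

theorem bracket_add_le (x y : ℝ) : bracket (x + y) ≤ bracket x + bracket y := by
  refine Real.sqrt_le_iff.2 ⟨by have := bracket_pos y; have := bracket_pos x; positivity, ?_⟩
  have hx : bracket x ^ 2 = 1 + x ^ 2 := Real.sq_sqrt (by positivity)
  have hy : bracket y ^ 2 = 1 + y ^ 2 := Real.sq_sqrt (by positivity)
  have hxy : x * y ≤ bracket x * bracket y :=
    (le_abs_self _).trans ((abs_mul x y).le.trans (mul_le_mul (abs_le_bracket x)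
      (abs_le_bracket y) (abs_nonneg y) (bracket_pos x).le))
  nlinarith

theorem bracket_le_two_mul_abs {x : ℝ} (h : 1 ≤ |x|) : bracket x ≤ 2 * |x| :=
  (bracket_le_one_add_abs x).trans (by linarith)

theorem continuous_bracket : Continuous bracket := by unfold bracket; fun_prop

/-- The weight `⟨x⟩ ^ κ` as an extended nonnegative number. -/
def bw (κ x : ℝ) : ℝ≥0∞ := ENNReal.ofReal (bracket x ^ κ)

theorem bracket_rpow_pos (κ x : ℝ) : 0 < bracket x ^ κ := Real.rpow_pos_of_pos (bracket_pos x) κ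

theorem bw_ne_zero (κ x : ℝ) : bw κ x ≠ 0 := by
  simpa [bw] using bracket_rpow_pos κ x

theorem bw_ne_top (κ x : ℝ) : bw κ x ≠ ∞ := ENNReal.ofReal_ne_top

theorem bw_add (κ l x : ℝ) : bw (κ + l) x = bw κ x * bw l x := by
  rw [bw, bw, bw, ← ENNReal.ofReal_mul (bracket_rpow_pos κ x).le, Real.rpow_add (bracket_pos x)]

theorem bw_zero (x : ℝ) : bw 0 x = 1 := by simp [bw]

theorem bw_neg_mul (κ x : ℝ) : bw (-κ) x * bw κ x = 1 := by
  rw [← bw_add, neg_add_cancel, bw_zero]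

theorem bw_mul_neg (κ x : ℝ) : bw κ x * bw (-κ) x = 1 := by
  rw [← bw_add, add_neg_cancel, bw_zero]

theorem bw_exp_mono {κ l : ℝ} (h : κ ≤ l) (x : ℝ) : bw κ x ≤ bw l x :=
  ENNReal.ofReal_le_ofReal (Real.rpow_le_rpow_of_exponent_le (one_le_bracket x) h)

theorem bw_le_one {κ : ℝ} (h : κ ≤ 0) (x : ℝ) : bw κ x ≤ 1 := (bw_exp_mono h x).trans (bw_zero x).le

theorem bw_sq (κ x : ℝ) : bw κ x ^ 2 = bw (2 * κ) x := by rw [two_mul, bw_add, sq]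

theorem bw_neg_arg (κ x : ℝ) : bw κ (-x) = bw κ x := by rw [bw, bracket_neg, bw]

theorem bw_sub_comm (κ x y : ℝ) : bw κ (x - y) = bw κ (y - x) := by
  rw [bw, bracket_sub_comm, bw]

theorem bw_anti {κ x y : ℝ} (hκ : κ ≤ 0) (h : |x| ≤ |y|) : bw κ y ≤ bw κ x :=
  ENNReal.ofReal_le_ofReal (Real.rpow_le_rpow_of_nonpos (bracket_pos x) (bracket_mono h) hκ)

theorem continuous_bracket_rpow (κ : ℝ) : Continuous fun x ↦ bracket x ^ κ :=
  continuous_bracket.rpow_const fun x ↦ Or.inl (bracket_pos x).ne'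

theorem measurable_bw (κ : ℝ) : Measurable (bw κ) :=
  (continuous_bracket_rpow κ).measurable.ennreal_ofReal

@[fun_prop]
theorem Measurable.bw_comp {α : Type*} [MeasurableSpace α] (κ : ℝ) {f : α → ℝ}
    (hf : Measurable f) : Measurable fun x ↦ bw κ (f x) := (measurable_bw κ).comp hf

theorem lintegral_bw_lt_top {κ : ℝ} (hκ : 1 < κ) : ∫⁻ x, bw (-κ) x < ∞ := by
  have h := integrable_rpow_neg_one_add_norm_sq (E := ℝ) (μ := volume) (r := κ) (by simpa using hκ)
  have h2 := h.lintegral_lt_top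
  convert h2 using 3 with x
  rw [bw, bracket, Real.sqrt_eq_rpow, ← Real.rpow_mul (by positivity), Real.norm_eq_abs, sq_abs]
  ring_nf

theorem lintegral_bw_ne_top {κ : ℝ} (hκ : 1 < κ) : ∫⁻ x, bw (-κ) x ≠ ∞ :=
  (lintegral_bw_lt_top hκ).ne

/-- Two brackets of exponents `κ ≤ l` centred at different points: the integral of the product
decays in the distance of the centres like the bracket of exponent `κ`. -/
theorem exists_lintegral_bw_mul_bw_le {κ l : ℝ} (hκ : 0 ≤ κ) (hκl : κ ≤ l) (hl : 1 < l) :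
    ∃ C : ℝ≥0, ∀ A B : ℝ, ∫⁻ x, bw (-κ) (x + A) * bw (-l) (x + B) ≤ C * bw (-κ) (A - B) := by
  have hI := lintegral_bw_ne_top hl
  have key : ∀ A B x : ℝ, bw κ (A - B) * (bw (-κ) (x + A) * bw (-l) (x + B)) ≤
      ENNReal.ofReal (2 ^ κ) * (bw (-l) (x + A) + 2 * bw (-l) (x + B)) := by
    intro A B x
    have h2 : bw κ (A - B) ≤ ENNReal.ofReal (2 ^ κ) * (bw κ (x + A) + bw κ (x + B)) := by
      have : bracket (A - B) ≤ 2 * max (bracket (x + A)) (bracket (x + B)) := by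
        calc bracket (A - B) = bracket ((x + A) + -(x + B)) := by ring_nf
          _ ≤ _ := bracket_add_le _ _
          _ ≤ _ := by
            rw [bracket_neg, two_mul]; exact add_le_add (le_max_left _ _) (le_max_right _ _)
      have h3 : bracket (A - B) ^ κ ≤ 2 ^ κ * (bracket (x + A) ^ κ + bracket (x + B) ^ κ) := by
        refine (Real.rpow_le_rpow (bracket_pos _).le this hκ).trans ?_
        rw [Real.mul_rpow (by norm_num) (le_max_of_le_left (bracket_pos _).le)]
        gcongr
        rcases max_choice (bracket (x + A)) (bracket (x + B)) with h | h <;> rw [h]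
        · linarith [bracket_rpow_pos κ (x + B)]
        · linarith [bracket_rpow_pos κ (x + A)]
      simp only [bw]
      rw [← ENNReal.ofReal_add (bracket_rpow_pos _ _).le (bracket_rpow_pos _ _).le,
        ← ENNReal.ofReal_mul (by positivity)]
      exact ENNReal.ofReal_le_ofReal h3
    have h4 : bw (-κ) (x + A) * bw (κ - l) (x + B) ≤ bw (-l) (x + A) + bw (-l) (x + B) := by
      rcases le_total |x + A| |x + B| with h | h
      · refine le_trans ?_ le_self_add
        calc _ ≤ bw (-κ) (x + A) * bw (κ - l) (x + A) := by
              gcongr; exact bw_anti (by linarith) h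
          _ = _ := by rw [← bw_add]; congr 1; ring
      · refine le_trans ?_ le_add_self
        calc _ ≤ bw (-κ) (x + B) * bw (κ - l) (x + B) := by
              gcongr; exact bw_anti (by linarith) h
          _ = _ := by rw [← bw_add]; congr 1; ring
    calc _ ≤ ENNReal.ofReal (2 ^ κ) * (bw κ (x + A) + bw κ (x + B)) *
          (bw (-κ) (x + A) * bw (-l) (x + B)) := by gcongr
      _ = ENNReal.ofReal (2 ^ κ) * (bw κ (x + A) * bw (-κ) (x + A) * bw (-l) (x + B) +
          bw (-κ) (x + A) * (bw κ (x + B) * bw (-l) (x + B))) := by ring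
      _ ≤ _ := by
        rw [bw_mul_neg, one_mul, ← bw_add, ← sub_eq_add_neg]
        refine mul_le_mul_right ?_ _
        calc _ ≤ bw (-l) (x + B) + (bw (-l) (x + A) + bw (-l) (x + B)) := add_le_add le_rfl h4
          _ = _ := by ring
  refine ⟨(ENNReal.ofReal (2 ^ κ) * (3 * ∫⁻ x, bw (-l) x)).toNNReal, fun A B ↦ ?_⟩
  rw [ENNReal.coe_toNNReal (by finiteness)]
  have h1 : bw κ (A - B) * ∫⁻ x, bw (-κ) (x + A) * bw (-l) (x + B) ≤
      ENNReal.ofReal (2 ^ κ) * (3 * ∫⁻ x, bw (-l) x) := by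
    rw [← lintegral_const_mul _ (by fun_prop)]
    refine (lintegral_mono (key A B)).trans ?_
    rw [lintegral_const_mul _ (by fun_prop), lintegral_add_left (by fun_prop),
      lintegral_const_mul _ (by fun_prop), lintegral_add_right_eq_self (fun x ↦ bw (-l) x),
      lintegral_add_right_eq_self (fun x ↦ bw (-l) x)]
    gcongr
    exact le_of_eq (by ring)
  calc ∫⁻ x, bw (-κ) (x + A) * bw (-l) (x + B)
      = bw (-κ) (A - B) * (bw κ (A - B) * ∫⁻ x, bw (-κ) (x + A) * bw (-l) (x + B)) := by
        rw [← mul_assoc, bw_neg_mul, one_mul]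
    _ ≤ _ := by rw [mul_comm]; gcongr

theorem lintegral_comp_mul_add_le {φ : ℝ → ℝ≥0∞} (hφ : Measurable φ) {k : ℝ} (hk : k ≠ 0) (c : ℝ) :
    ENNReal.ofReal |k| * ∫⁻ x, φ (c + k * x) = ∫⁻ x, φ x := by
  have h := lintegral_image_eq_lintegral_abs_deriv_mul (s := univ) (f := fun x ↦ c + k * x)
    (f' := fun _ ↦ k) MeasurableSet.univ
    (fun x _ ↦ ((((hasDerivAt_id x).const_mul k).const_add c).congr_deriv
      (mul_one k)).hasDerivWithinAt)
    (fun x _ y _ h ↦ by simpa [hk] using h) φ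
  have him : (fun x ↦ c + k * x) '' univ = univ := by
    rw [image_univ]
    exact (Function.RightInverse.surjective (g := fun y ↦ (y - c) / k)
      (fun y ↦ by field_simp; ring)).range_eq
  rw [him] at h
  simp only [Measure.restrict_univ] at h
  rw [h, lintegral_const_mul]
  fun_prop

/-- The integral of `⟨Q⟩ ^ (-κ)` over the line is bounded uniformly over all quadratic polynomials
`Q` with a given leading coefficient. -/
theorem exists_lintegral_bw_quadratic_le {A κ : ℝ} (hA : A ≠ 0) (hκ : 1 / 2 < κ) :
    ∃ C : ℝ≥0, ∀ B c : ℝ, ∫⁻ x, bw (-κ) (A * x ^ 2 + B * x + c) ≤ C := by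
  have hI : ∫⁻ x, bw (-κ) (A * x ^ 2) ≠ ∞ := by
    -- `⟨A x²⟩ ≳ ⟨x⟩²`
    set m : ℝ := max 1 (2 / |A|) with hm
    have hm1 : 1 ≤ m := le_max_left _ _
    have hA' : 0 < |A| := abs_pos.2 hA
    have hb : ∀ x, bw (-κ) (A * x ^ 2) ≤ ENNReal.ofReal ((2 * m) ^ κ) * bw (-(2 * κ)) x := by
      intro x
      have h1 : bracket x ^ 2 ≤ 2 * m * bracket (A * x ^ 2) := by
        have e : bracket x ^ 2 = 1 + x ^ 2 := Real.sq_sqrt (by positivity)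
        have e2 := abs_le_bracket (A * x ^ 2)
        have e3 := one_le_bracket (A * x ^ 2)
        rw [abs_mul, abs_of_nonneg (sq_nonneg x)] at e2
        have e4 : x ^ 2 ≤ m * bracket (A * x ^ 2) := by
          have : 2 ≤ m * |A| := by
            have := le_max_right 1 (2 / |A|)
            rw [div_le_iff₀ hA'] at this; exact this
          nlinarith [sq_nonneg x, mul_le_mul_of_nonneg_left e2 (by linarith : 0 ≤ m)]
        rw [e]; nlinarith
      simp only [bw]
      rw [← ENNReal.ofReal_mul (by positivity)]
      apply ENNReal.ofReal_le_ofReal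
      rw [Real.rpow_neg (bracket_pos _).le, Real.rpow_neg (bracket_pos _).le,
        Real.rpow_mul (bracket_pos _).le, Real.rpow_two,
        ← div_eq_mul_inv, le_div_iff₀ (by have := bracket_pos x; positivity),
          inv_mul_le_iff₀ (bracket_rpow_pos _ _),
        mul_comm, ← Real.mul_rpow (by positivity) (bracket_pos _).le]
      exact Real.rpow_le_rpow (by positivity) h1 (by linarith)
    refine ((lintegral_mono hb).trans_lt ?_).ne
    rw [lintegral_const_mul _ (by fun_prop)]
    exact ENNReal.mul_lt_top (by finiteness) (lintegral_bw_lt_top (by linarith))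
  refine ⟨(2 * ∫⁻ x, bw (-κ) (A * x ^ 2)).toNNReal, fun B c ↦ ?_⟩
  rw [ENNReal.coe_toNNReal (by finiteness)]
  set e : ℝ := c / A - (B / (2 * A)) ^ 2 with he
  set r : ℝ := √(max (-e) 0) with hr
  have hr0 : 0 ≤ r := Real.sqrt_nonneg _
  have hr2 : r ^ 2 = max (-e) 0 := Real.sq_sqrt (le_max_right _ _)
  have hq : ∀ x : ℝ, A * (x - B / (2 * A)) ^ 2 + B * (x - B / (2 * A)) + c = A * (x ^ 2 + e) := by
    intro x; rw [he]; field_simp; ring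
  -- `|y² + e| ≥ (|y| - r)²`, where `±r` are the real roots, or `0`
  have hlow : ∀ y : ℝ, (|y| - r) ^ 2 ≤ |y ^ 2 + e| := by
    intro y
    rcases le_total 0 e with h | h
    · have : r ^ 2 = 0 := by rw [hr2]; exact max_eq_right (by linarith)
      have : r = 0 := by simpa using this
      rw [this, sub_zero, sq_abs]
      exact le_trans (by linarith) (le_abs_self _)
    · have h2 : e = -r ^ 2 := by rw [hr2, max_eq_left (by linarith)]; ring
      rw [h2, ← sq_abs y, ← sub_eq_add_neg, sq_sub_sq, abs_mul, ← sq_abs (|y| - r), sq]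
      refine mul_le_mul_of_nonneg_right ?_ (abs_nonneg _)
      rw [abs_of_nonneg (by positivity : 0 ≤ |y| + r)]
      exact abs_le.2 ⟨by linarith [abs_nonneg y], by linarith⟩
  have hpt : ∀ y : ℝ, bw (-κ) (A * (y ^ 2 + e)) ≤
      bw (-κ) (A * (y - r) ^ 2) + bw (-κ) (A * (y + r) ^ 2) := by
    intro y
    have h1 : bw (-κ) (A * (y ^ 2 + e)) ≤ bw (-κ) (A * (|y| - r) ^ 2) := by
      apply bw_anti (by linarith)
      rw [abs_mul, abs_mul, abs_of_nonneg (sq_nonneg (|y| - r))]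
      gcongr; exact hlow y
    refine h1.trans ?_
    rcases abs_choice y with h | h <;> rw [h]
    · exact le_self_add
    · refine le_trans (le_of_eq ?_) le_add_self
      ring_nf
  calc ∫⁻ x, bw (-κ) (A * x ^ 2 + B * x + c)
      = ∫⁻ x, bw (-κ) (A * (x - B / (2 * A)) ^ 2 + B * (x - B / (2 * A)) + c) :=
        (lintegral_sub_right_eq_self (fun x ↦ bw (-κ) (A * x ^ 2 + B * x + c)) _).symm
    _ = ∫⁻ x, bw (-κ) (A * (x ^ 2 + e)) := by simp only [hq]
    _ ≤ ∫⁻ y, (bw (-κ) (A * (y - r) ^ 2) + bw (-κ) (A * (y + r) ^ 2)) := lintegral_mono hpt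
    _ = _ := by
      rw [lintegral_add_left (by fun_prop),
        lintegral_sub_right_eq_self (fun y ↦ bw (-κ) (A * y ^ 2)),
        lintegral_add_right_eq_self (fun y ↦ bw (-κ) (A * y ^ 2)), two_mul]

/-- The change of variables by a quadratic polynomial, which is injective on either side of its
vertex. -/
theorem lintegral_deriv_mul_comp_quadratic_le {A : ℝ} (hA : A ≠ 0) (B c : ℝ)
    (φ : ℝ → ℝ≥0∞) :
    ∫⁻ x, ENNReal.ofReal |2 * A * x + B| * φ (A * x ^ 2 + B * x + c) ≤ 2 * ∫⁻ x, φ x := by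
  set x₀ : ℝ := -B / (2 * A) with hx0
  have hB : B = -(2 * A * x₀) := by rw [hx0]; field_simp
  have hd : ∀ s : Set ℝ, ∀ x ∈ s, HasDerivWithinAt (fun x ↦ A * x ^ 2 + B * x + c)
      (2 * A * x + B) s x := by
    intro s x _
    have := (((hasDerivAt_pow 2 x).const_mul A).add ((hasDerivAt_id x).const_mul B)).add_const c
    refine this.hasDerivWithinAt.congr_deriv ?_
    simp; ring
  have hinj : ∀ s : Set ℝ, (∀ x ∈ s, ∀ y ∈ s, x + y - 2 * x₀ = 0 → x = y) →
      InjOn (fun x ↦ A * x ^ 2 + B * x + c) s := by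
    intro s hs x hx y hy hxy
    have h1 : A * ((x - y) * (x + y - 2 * x₀)) = 0 := by
      simp only at hxy; rw [hB] at hxy; linear_combination hxy
    rcases mul_eq_zero.1 ((mul_eq_zero.1 h1).resolve_left hA) with h | h
    · linarith
    · exact hs x hx y hy h
  have h1 := lintegral_image_eq_lintegral_abs_deriv_mul (measurableSet_Iic (a := x₀)) (hd _)
    (hinj (Iic x₀) (fun x hx y hy h ↦ by rw [mem_Iic] at hx hy; linarith)) φ
  have h2 := lintegral_image_eq_lintegral_abs_deriv_mul (measurableSet_Ioi (a := x₀)) (hd _)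
    (hinj (Ioi x₀) (fun x hx y hy h ↦ by rw [mem_Ioi] at hx hy; linarith)) φ
  rw [← lintegral_add_compl _ (measurableSet_Iic (a := x₀)), compl_Iic, ← h1, ← h2, two_mul]
  gcongr <;> exact Measure.restrict_le_self

/-- The phase that the two dispersions generate is a quadratic polynomial on either side of `y`. -/
theorem quadratic_phase_of_le {ν e x y : ℝ} (h : y ≤ x) :
    e + 2 * Real.pi * x ^ 2 + 2 * Real.pi * ν * |x - y| * (x - y) =
      2 * Real.pi * (1 + ν) * x ^ 2 + -(4 * Real.pi * ν * y) * x + (e + 2 * Real.pi * ν * y ^ 2) :=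
        by
  rw [abs_of_nonneg (by linarith)]; ring

theorem quadratic_phase_of_ge {ν e x y : ℝ} (h : x ≤ y) :
    e + 2 * Real.pi * x ^ 2 + 2 * Real.pi * ν * |x - y| * (x - y) =
      2 * Real.pi * (1 - ν) * x ^ 2 + (4 * Real.pi * ν * y) * x + (e - 2 * Real.pi * ν * y ^ 2) :=
        by
  rw [abs_of_nonpos (by linarith)]; ring

theorem leading_coeffs_ne_zero {ν : ℝ} (hν : |ν| ≠ 1) :
    2 * Real.pi * (1 + ν) ≠ 0 ∧ 2 * Real.pi * (1 - ν) ≠ 0 := by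
  have := Real.pi_pos.ne'
  refine ⟨mul_ne_zero (by positivity) fun h ↦ hν ?_, mul_ne_zero (by positivity) fun h ↦ hν ?_⟩
  · rw [show ν = -1 by linarith]; simp
  · rw [show ν = 1 by linarith]; simp

theorem exists_lintegral_bw_phase_le {ν κ : ℝ} (hν : |ν| ≠ 1) (hκ : 1 / 2 < κ) :
    ∃ C : ℝ≥0, ∀ e y : ℝ,
      ∫⁻ x, bw (-κ) (e + 2 * Real.pi * x ^ 2 + 2 * Real.pi * ν * |x - y| * (x - y)) ≤ C := by
  obtain ⟨C₁, h₁⟩ := exists_lintegral_bw_quadratic_le (leading_coeffs_ne_zero hν).1 hκ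
  obtain ⟨C₂, h₂⟩ := exists_lintegral_bw_quadratic_le (leading_coeffs_ne_zero hν).2 hκ
  refine ⟨C₁ + C₂, fun e y ↦ ?_⟩
  push_cast
  refine le_trans ?_ (add_le_add (h₁ (-(4 * Real.pi * ν * y)) (e + 2 * Real.pi * ν * y ^ 2))
    (h₂ (4 * Real.pi * ν * y) (e - 2 * Real.pi * ν * y ^ 2)))
  rw [← lintegral_add_left (by fun_prop)]
  refine lintegral_mono fun x ↦ ?_
  rcases le_total y x with h | h
  · rw [quadratic_phase_of_le h]; exact le_self_add
  · rw [quadratic_phase_of_ge h]; exact le_add_self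

/-- The weight `x + ν |x - y|` is, up to a constant, the derivative of the phase. -/
theorem exists_lintegral_deriv_mul_bw_phase_le {ν κ : ℝ} (hν : |ν| ≠ 1) (hκ : 1 < κ) :
    ∃ C : ℝ≥0, ∀ e y : ℝ, ∫⁻ x, ENNReal.ofReal (abs (x + ν * |x - y|)) *
      bw (-κ) (e + 2 * Real.pi * x ^ 2 + 2 * Real.pi * ν * |x - y| * (x - y)) ≤ C := by
  refine ⟨(4 * ∫⁻ x, bw (-κ) x).toNNReal, fun e y ↦ ?_⟩
  rw [ENNReal.coe_toNNReal (by have := lintegral_bw_ne_top hκ; finiteness)]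
  have h₁ := lintegral_deriv_mul_comp_quadratic_le (leading_coeffs_ne_zero hν).1
    (-(4 * Real.pi * ν * y)) (e + 2 * Real.pi * ν * y ^ 2) (bw (-κ))
  have h₂ := lintegral_deriv_mul_comp_quadratic_le (leading_coeffs_ne_zero hν).2
    (4 * Real.pi * ν * y) (e - 2 * Real.pi * ν * y ^ 2) (bw (-κ))
  refine le_trans ?_ ((add_le_add h₁ h₂).trans (le_of_eq (by ring)))
  rw [← lintegral_add_left (by fun_prop)]
  have hpi : ∀ t : ℝ, |t| ≤ |4 * Real.pi * t| := by
    intro t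
    rw [abs_mul, abs_of_pos (by positivity : 0 < 4 * Real.pi)]
    nlinarith [abs_nonneg t, Real.pi_gt_three]
  refine lintegral_mono fun x ↦ ?_
  rcases le_total y x with h | h
  · rw [quadratic_phase_of_le h, abs_of_nonneg (by linarith : 0 ≤ x - y)]
    refine le_trans ?_ le_self_add
    refine mul_le_mul_left (ENNReal.ofReal_le_ofReal ((hpi _).trans_eq ?_)) _
    congr 1; ring
  · rw [quadratic_phase_of_ge h, abs_of_nonpos (by linarith : x - y ≤ 0)]
    refine le_trans ?_ le_add_self
    refine mul_le_mul_left (ENNReal.ofReal_le_ofReal ((hpi _).trans_eq ?_)) _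
    congr 1; ring

theorem exists_lintegral_bw_linear_le {κ : ℝ} (hκ : 1 < κ) :
    ∃ C : ℝ≥0, ∀ c k : ℝ, ENNReal.ofReal |k| * ∫⁻ x, bw (-κ) (c + 4 * Real.pi * k * x) ≤ C := by
  refine ⟨(∫⁻ x, bw (-κ) x).toNNReal, fun c k ↦ ?_⟩
  rw [ENNReal.coe_toNNReal (lintegral_bw_ne_top hκ)]
  rcases eq_or_ne k 0 with rfl | hk
  · simp
  · rw [← lintegral_comp_mul_add_le (measurable_bw (-κ)) (k := 4 * Real.pi * k)
      (by have := Real.pi_pos; positivity) c]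
    refine mul_le_mul_left (ENNReal.ofReal_le_ofReal ?_) _
    rw [abs_mul, abs_of_pos (by positivity : 0 < 4 * Real.pi)]
    nlinarith [abs_nonneg k, Real.pi_gt_three]

/-! ### Bounded trilinear forms -/

/-- The `L²` norm of a function with values in `[0, ∞]`. -/
def l2 {α : Type*} [MeasureSpace α] (f : α → ℝ≥0∞) : ℝ≥0∞ := (∫⁻ x, f x ^ 2) ^ (1 / 2 : ℝ)

theorem l2_sq {α : Type*} [MeasureSpace α] (f : α → ℝ≥0∞) : l2 f ^ 2 = ∫⁻ x, f x ^ 2 := by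
  rw [l2, ← ENNReal.rpow_two, ← ENNReal.rpow_mul]; norm_num

theorem le_of_sq_le_sq {a b : ℝ≥0∞} (h : a ^ 2 ≤ b ^ 2) : a ≤ b := by
  by_contra! hlt
  exact absurd h (not_le.2 (ENNReal.pow_lt_pow_left two_ne_zero hlt))

theorem sq_lintegral_mul_le {α : Type*} [MeasurableSpace α] (μ : Measure α) {f g : α → ℝ≥0∞}
    (hf : AEMeasurable f μ) (hg : AEMeasurable g μ) :
    (∫⁻ x, f x * g x ∂μ) ^ 2 ≤ (∫⁻ x, f x ^ 2 ∂μ) * ∫⁻ x, g x ^ 2 ∂μ := by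
  have h := ENNReal.lintegral_mul_le_Lp_mul_Lq μ (Real.HolderConjugate.two_two) hf hg
  simp only [ENNReal.rpow_two, Pi.mul_apply] at h
  calc _ ≤ ((∫⁻ x, f x ^ 2 ∂μ) ^ (1 / 2 : ℝ) * (∫⁻ x, g x ^ 2 ∂μ) ^ (1 / 2 : ℝ)) ^ 2 := by gcongr
    _ = _ := by
      rw [mul_pow, ← ENNReal.rpow_two, ← ENNReal.rpow_two, ← ENNReal.rpow_mul, ← ENNReal.rpow_mul]
      norm_num

/-- The kernel `M` defines a trilinear form
`∫∫ M(z, z₁) f(z) g(z₁) h(z - z₁) dz₁ dz` that is bounded on `L² × L² × L²`. -/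
def IsTriBounded (M : ℝ × ℝ → ℝ × ℝ → ℝ≥0∞) : Prop :=
  ∃ C : ℝ≥0, ∀ f g h : ℝ × ℝ → ℝ≥0∞, Measurable f → Measurable g → Measurable h →
    ∫⁻ z, ∫⁻ z₁, M z z₁ * (f z * g z₁ * h (z - z₁)) ≤ C * (l2 f * l2 g * l2 h)

theorem IsTriBounded.of_le {M N : ℝ × ℝ → ℝ × ℝ → ℝ≥0∞} (hN : IsTriBounded N) (c : ℝ≥0)
    (h : ∀ z z₁, M z z₁ ≤ c * N z z₁) : IsTriBounded M := by
  obtain ⟨C, hC⟩ := hN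
  refine ⟨c * C, fun f g k hf hg hk ↦ ?_⟩
  calc _ ≤ ∫⁻ z, ∫⁻ z₁, c * (N z z₁ * (f z * g z₁ * k (z - z₁))) := by
        refine lintegral_mono fun z ↦ lintegral_mono fun z₁ ↦ ?_
        rw [← mul_assoc (c : ℝ≥0∞)]; exact mul_le_mul_left (h z z₁) _
    _ = c * ∫⁻ z, ∫⁻ z₁, N z z₁ * (f z * g z₁ * k (z - z₁)) := by
        simp only [lintegral_const_mul' _ _ (ENNReal.coe_ne_top (r := c))]
    _ ≤ c * (C * (l2 f * l2 g * l2 k)) := by gcongr; exact hC f g k hf hg hk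
    _ = _ := by push_cast; ring

theorem IsTriBounded.add {M N : ℝ × ℝ → ℝ × ℝ → ℝ≥0∞} (hM : IsTriBounded M)
    (hN : IsTriBounded N) (hm : Measurable (Function.uncurry M)) :
    IsTriBounded fun z z₁ ↦ M z z₁ + N z z₁ := by
  obtain ⟨C, hC⟩ := hM
  obtain ⟨D, hD⟩ := hN
  refine ⟨C + D, fun f g k hf hg hk ↦ ?_⟩
  have hm' : Measurable fun w : (ℝ × ℝ) × (ℝ × ℝ) ↦ M w.1 w.2 * (f w.1 * g w.2 * k (w.1 - w.2)) :=
    Measurable.mul hm (by fun_prop)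
  simp only [add_mul]
  calc _ = ∫⁻ z, ((∫⁻ z₁, M z z₁ * (f z * g z₁ * k (z - z₁))) +
        ∫⁻ z₁, N z z₁ * (f z * g z₁ * k (z - z₁))) := by
        refine lintegral_congr fun z ↦ lintegral_add_left ?_ _
        exact hm'.comp (measurable_const.prodMk measurable_id)
    _ = _ := lintegral_add_left hm'.lintegral_prod_right' _
    _ ≤ _ := by
        push_cast; rw [add_mul]; exact add_le_add (hC f g k hf hg hk) (hD f g k hf hg hk)

theorem sq_lintegral_lintegral_mul_le {F G : (ℝ × ℝ) × (ℝ × ℝ) → ℝ≥0∞} (hF : Measurable F)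
    (hG : Measurable G) :
    (∫⁻ z, ∫⁻ z₁, F (z, z₁) * G (z, z₁)) ^ 2 ≤
      (∫⁻ z, ∫⁻ z₁, F (z, z₁) ^ 2) * ∫⁻ z, ∫⁻ z₁, G (z, z₁) ^ 2 := by
  have h := sq_lintegral_mul_le (volume.prod volume) hF.aemeasurable hG.aemeasurable
  rwa [lintegral_prod _ (by fun_prop), lintegral_prod _ (by fun_prop),
    lintegral_prod _ (by fun_prop)] at h

theorem lintegral_mul_conv_sq {g h : ℝ × ℝ → ℝ≥0∞} (hg : Measurable g) (hh : Measurable h) :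
    ∫⁻ z, ∫⁻ z₁, (g z₁ * h (z - z₁)) ^ 2 = (∫⁻ z, g z ^ 2) * ∫⁻ z, h z ^ 2 := by
  rw [lintegral_lintegral_swap (by fun_prop)]
  simp only [mul_pow]
  calc _ = ∫⁻ z₁, g z₁ ^ 2 * ∫⁻ z, h z ^ 2 := by
        refine lintegral_congr fun z₁ ↦ ?_
        rw [lintegral_const_mul _ (by fun_prop), lintegral_sub_right_eq_self (fun z ↦ h z ^ 2)]
    _ = _ := lintegral_mul_const _ (by fun_prop)

/-- A kernel that is square integrable in `z₁`, uniformly in `z`. -/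
theorem IsTriBounded.of_fix_output {M : ℝ × ℝ → ℝ × ℝ → ℝ≥0∞} (hM : Measurable (Function.uncurry M))
    (C : ℝ≥0) (h : ∀ z, ∫⁻ z₁, M z z₁ ^ 2 ≤ C ^ 2) : IsTriBounded M := by
  refine ⟨C, fun f g k hf hg hk ↦ le_of_sq_le_sq ?_⟩
  have hF : Measurable fun w : (ℝ × ℝ) × (ℝ × ℝ) ↦ M w.1 w.2 * f w.1 :=
    Measurable.mul hM (by fun_prop)
  have := sq_lintegral_lintegral_mul_le hF
    (G := fun w ↦ g w.2 * k (w.1 - w.2)) (by fun_prop)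
  calc _ = (∫⁻ z, ∫⁻ z₁, M z z₁ * f z * (g z₁ * k (z - z₁))) ^ 2 := by
        congr! 5; ring
    _ ≤ _ := this
    _ ≤ (∫⁻ z, C ^ 2 * f z ^ 2) * ((∫⁻ z, g z ^ 2) * ∫⁻ z, k z ^ 2) := by
        rw [lintegral_mul_conv_sq hg hk]
        gcongr with z
        simp only [mul_pow]
        have hMz : Measurable (M z) := hM.comp (measurable_const.prodMk measurable_id)
        rw [lintegral_mul_const _ (by fun_prop)]
        gcongr; exact h z
    _ = _ := by
        rw [lintegral_const_mul _ (by fun_prop), ← l2_sq, ← l2_sq, ← l2_sq]; ring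

/-- A kernel that is square integrable in `z`, uniformly in `z₁`. -/
theorem IsTriBounded.of_fix_input {M : ℝ × ℝ → ℝ × ℝ → ℝ≥0∞} (hM : Measurable (Function.uncurry M))
    (C : ℝ≥0) (h : ∀ z₁, ∫⁻ z, M z z₁ ^ 2 ≤ C ^ 2) : IsTriBounded M := by
  refine ⟨C, fun f g k hf hg hk ↦ le_of_sq_le_sq ?_⟩
  have hM' : Measurable fun w : (ℝ × ℝ) × (ℝ × ℝ) ↦ M w.1 w.2 := hM
  have hF : Measurable fun w : (ℝ × ℝ) × (ℝ × ℝ) ↦ M w.1 w.2 * g w.2 :=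
    Measurable.mul hM (by fun_prop)
  have := sq_lintegral_lintegral_mul_le hF
    (G := fun w ↦ f w.1 * k (w.1 - w.2)) (by fun_prop)
  have e1 : ∫⁻ z, ∫⁻ z₁, (f z * k (z - z₁)) ^ 2 = (∫⁻ z, f z ^ 2) * ∫⁻ z, k z ^ 2 := by
    simp only [mul_pow]
    calc _ = ∫⁻ z, f z ^ 2 * ∫⁻ z, k z ^ 2 := by
          refine lintegral_congr fun z ↦ ?_
          rw [lintegral_const_mul _ (by fun_prop), lintegral_sub_left_eq_self (fun z ↦ k z ^ 2)]
      _ = _ := lintegral_mul_const _ (by fun_prop)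
  calc _ = (∫⁻ z, ∫⁻ z₁, M z z₁ * g z₁ * (f z * k (z - z₁))) ^ 2 := by
        congr! 5; ring
    _ ≤ _ := this
    _ ≤ (∫⁻ z, C ^ 2 * g z ^ 2) * ((∫⁻ z, f z ^ 2) * ∫⁻ z, k z ^ 2) := by
        rw [e1, lintegral_lintegral_swap (by fun_prop)]
        gcongr with z
        simp only [mul_pow]
        have hMz : Measurable fun y ↦ M y z := hM.comp (measurable_id.prodMk measurable_const)
        rw [lintegral_mul_const _ (by fun_prop)]
        gcongr; exact h z
    _ = _ := by
        rw [lintegral_const_mul _ (by fun_prop), ← l2_sq, ← l2_sq, ← l2_sq]; ring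

/-- A kernel that is square integrable along the lines `z - z₁ = w`, uniformly in `w`. -/
theorem IsTriBounded.of_fix_difference {M : ℝ × ℝ → ℝ × ℝ → ℝ≥0∞}
    (hM : Measurable (Function.uncurry M))
    (C : ℝ≥0) (h : ∀ w, ∫⁻ z₁, M (w + z₁) z₁ ^ 2 ≤ C ^ 2) : IsTriBounded M := by
  refine ⟨C, fun f g k hf hg hk ↦ le_of_sq_le_sq ?_⟩
  have hM' : Measurable fun w : (ℝ × ℝ) × (ℝ × ℝ) ↦ M w.1 w.2 := hM
  have hF : Measurable fun w : (ℝ × ℝ) × (ℝ × ℝ) ↦ M w.1 w.2 * k (w.1 - w.2) :=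
    Measurable.mul hM (by fun_prop)
  have := sq_lintegral_lintegral_mul_le hF
    (G := fun w ↦ f w.1 * g w.2) (by fun_prop)
  have e1 : ∫⁻ z, ∫⁻ z₁, (f z * g z₁) ^ 2 = (∫⁻ z, f z ^ 2) * ∫⁻ z, g z ^ 2 := by
    simp only [mul_pow]
    calc _ = ∫⁻ z, f z ^ 2 * ∫⁻ z, g z ^ 2 := by
          refine lintegral_congr fun z ↦ ?_
          rw [lintegral_const_mul _ (by fun_prop)]
      _ = _ := lintegral_mul_const _ (by fun_prop)
  have e2 : ∫⁻ z, ∫⁻ z₁, (M z z₁ * k (z - z₁)) ^ 2 ≤ ∫⁻ w, C ^ 2 * k w ^ 2 := by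
    rw [lintegral_lintegral_swap (by fun_prop)]
    calc _ = ∫⁻ z₁, ∫⁻ w, (M (w + z₁) z₁ * k w) ^ 2 := by
          refine lintegral_congr fun z₁ ↦ ?_
          rw [← lintegral_add_right_eq_self _ z₁]
          simp
      _ = ∫⁻ w, ∫⁻ z₁, (M (w + z₁) z₁ * k w) ^ 2 := by
          rw [lintegral_lintegral_swap]
          have : Measurable fun w : (ℝ × ℝ) × (ℝ × ℝ) ↦ M (w.2 + w.1) w.1 :=
            hM.comp (by fun_prop : Measurable fun w : (ℝ × ℝ) × (ℝ × ℝ) ↦ (w.2 + w.1, w.1))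
          exact (by fun_prop : Measurable fun w : (ℝ × ℝ) × (ℝ × ℝ) ↦
            (M (w.2 + w.1) w.1 * k w.2) ^ 2).aemeasurable
      _ ≤ _ := by
          gcongr with w
          simp only [mul_pow]
          have : Measurable fun z₁ ↦ M (w + z₁) z₁ :=
            hM.comp (by fun_prop : Measurable fun z₁ : ℝ × ℝ ↦ (w + z₁, z₁))
          rw [lintegral_mul_const _ (by fun_prop)]
          gcongr; exact h w
  calc _ = (∫⁻ z, ∫⁻ z₁, M z z₁ * k (z - z₁) * (f z * g z₁)) ^ 2 := by
        congr! 5; ring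
    _ ≤ _ := this
    _ ≤ (∫⁻ w, C ^ 2 * k w ^ 2) * ((∫⁻ z, f z ^ 2) * ∫⁻ z, g z ^ 2) := by
        rw [e1]; gcongr
    _ = _ := by
        rw [lintegral_const_mul _ (by fun_prop), ← l2_sq, ← l2_sq, ← l2_sq]; ring

/-! ### Kernels adapted to the two dispersions -/

@[fun_prop]
theorem measurable_schrodingerPhase : Measurable schrodingerPhase := by
  unfold schrodingerPhase; fun_prop

@[fun_prop]
theorem measurable_benjaminOnoPhase (ν : ℝ) : Measurable (benjaminOnoPhase ν) := by
  unfold benjaminOnoPhase; fun_prop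

/-- The weight of exponent `κ` in the distance to the characteristic curve of the dispersion `p`. -/
def modWeight (p : ℝ → ℝ) (κ : ℝ) (z : ℝ × ℝ) : ℝ≥0∞ := bw κ (z.1 + p z.2)

@[fun_prop]
theorem measurable_modWeight {p : ℝ → ℝ} (hp : Measurable p) (κ : ℝ) :
    Measurable (modWeight p κ) := by
  unfold modWeight; fun_prop

theorem exists_lintegral_bw_mul_bw_le' {κ κ₁ κ₂ : ℝ} (hκ : 0 ≤ κ) (h₁ : κ ≤ κ₁) (h₂ : κ ≤ κ₂)
    (h : 1 < κ₁ ∨ 1 < κ₂) :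
    ∃ C : ℝ≥0, ∀ A B : ℝ, ∫⁻ x, bw (-κ₁) (x + A) * bw (-κ₂) (x + B) ≤ C * bw (-κ) (A - B) := by
  rcases h with h | h
  · obtain ⟨C, hC⟩ := exists_lintegral_bw_mul_bw_le hκ h₁ h
    refine ⟨C, fun A B ↦ ?_⟩
    rw [bw_sub_comm]
    refine (lintegral_mono fun x ↦ ?_).trans (hC B A)
    rw [mul_comm]; gcongr; exact bw_exp_mono (by linarith) _
  · obtain ⟨C, hC⟩ := exists_lintegral_bw_mul_bw_le hκ h₂ h
    refine ⟨C, fun A B ↦ (lintegral_mono fun x ↦ ?_).trans (hC A B)⟩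
    gcongr; exact bw_exp_mono (by linarith) _

theorem lintegral_time_space {F : ℝ × ℝ → ℝ≥0∞} (hF : Measurable F) :
    ∫⁻ z, F z = ∫⁻ ξ, ∫⁻ τ, F (τ, ξ) := by
  rw [Measure.volume_eq_prod, lintegral_prod_symm' _ hF]

theorem exists_sq_ge (C : ℝ≥0) : ∃ D : ℝ≥0, (C : ℝ≥0∞) ≤ (D : ℝ≥0∞) ^ 2 :=
  ⟨C + 1, by norm_cast; nlinarith [(zero_le : 0 ≤ C)]⟩

/-- Modulation weights on the two inputs, with a weight `w` in the space frequencies. -/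
theorem isTriBounded_inputs {ν κ κ₁ κ₂ : ℝ} (hκ : 0 ≤ κ) (h₁ : κ ≤ 2 * κ₁) (h₂ : κ ≤ 2 * κ₂)
    (h : 1 < 2 * κ₁ ∨ 1 < 2 * κ₂) {w : ℝ → ℝ → ℝ≥0∞} (hw : Measurable (Function.uncurry w))
    {C : ℝ≥0} (hC : ∀ e y, ∫⁻ x, w y x ^ 2 *
      bw (-κ) (e + 2 * Real.pi * x ^ 2 + 2 * Real.pi * (-ν) * |x - y| * (x - y)) ≤ C) :
    IsTriBounded fun z z₁ ↦ w z.2 z₁.2 *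
      (modWeight schrodingerPhase (-κ₁) z₁ * modWeight (benjaminOnoPhase ν) (-κ₂) (z - z₁)) := by
  obtain ⟨C₁, hC₁⟩ := exists_lintegral_bw_mul_bw_le' hκ h₁ h₂ h
  obtain ⟨D, hD⟩ := exists_sq_ge (C₁ * C)
  have hw' : Measurable fun x : ℝ × ℝ ↦ w x.1 x.2 := hw
  have hw2 : Measurable fun x : (ℝ × ℝ) × (ℝ × ℝ) ↦ w x.1.2 x.2.2 :=
    hw'.comp (by fun_prop : Measurable fun x : (ℝ × ℝ) × (ℝ × ℝ) ↦ (x.1.2, x.2.2))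
  refine IsTriBounded.of_fix_output (by unfold Function.uncurry; fun_prop) D fun z ↦ ?_
  have hwz : Measurable fun x : ℝ ↦ w z.2 x :=
    hw'.comp (by fun_prop : Measurable fun x : ℝ ↦ (z.2, x))
  rw [lintegral_time_space (by fun_prop)]
  refine le_trans ?_ hD
  calc _ ≤ ∫⁻ ξ, w z.2 ξ ^ 2 * (C₁ * bw (-κ) (z.1 + 2 * Real.pi * ξ ^ 2 +
        2 * Real.pi * (-ν) * |ξ - z.2| * (ξ - z.2))) := by
        gcongr with ξ
        simp only [mul_pow]
        rw [lintegral_const_mul _ (by fun_prop)]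
        gcongr
        refine le_trans (le_of_eq ?_) ((hC₁ (schrodingerPhase ξ)
          (-(z.1 + benjaminOnoPhase ν (z.2 - ξ)))).trans (le_of_eq ?_))
        · refine lintegral_congr fun τ ↦ ?_
          simp only [modWeight, bw_sq]
          congr 1
          · congr 1; ring
          · rw [← bw_neg_arg]; congr 1
            · ring
            · simp; ring
        · congr 2
          rw [abs_sub_comm, schrodingerPhase, benjaminOnoPhase]; ring
    _ ≤ _ := by
        simp only [mul_left_comm _ (C₁ : ℝ≥0∞)]
        rw [lintegral_const_mul _ (by fun_prop)]
        push_cast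
        gcongr; exact hC z.1 z.2

/-- Modulation weights on the output and on the second input. -/
theorem isTriBounded_output_second {ν κ κ₁ κ₂ : ℝ} (hν : |ν| ≠ 1) (hκ : 1 / 2 < κ)
    (h₁ : κ ≤ 2 * κ₁) (h₂ : κ ≤ 2 * κ₂) (h : 1 < 2 * κ₁ ∨ 1 < 2 * κ₂) :
    IsTriBounded fun z z₁ ↦
      modWeight schrodingerPhase (-κ₁) z * modWeight (benjaminOnoPhase ν) (-κ₂) (z - z₁) := by
  obtain ⟨C₁, hC₁⟩ := exists_lintegral_bw_mul_bw_le' (by linarith) h₁ h₂ h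
  obtain ⟨C, hC⟩ := exists_lintegral_bw_phase_le (ν := -ν) (by simpa using hν) hκ
  obtain ⟨D, hD⟩ := exists_sq_ge (C₁ * C)
  refine IsTriBounded.of_fix_input (by unfold Function.uncurry; fun_prop) D fun z₁ ↦ ?_
  rw [lintegral_time_space (by fun_prop)]
  refine le_trans ?_ hD
  calc _ ≤ ∫⁻ ξ, C₁ * bw (-κ) (z₁.1 + 2 * Real.pi * ξ ^ 2 +
        2 * Real.pi * (-ν) * |ξ - z₁.2| * (ξ - z₁.2)) := by
        gcongr with ξ
        simp only [mul_pow]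
        refine le_trans (le_of_eq ?_) ((hC₁ (schrodingerPhase ξ)
          (-z₁.1 + benjaminOnoPhase ν (ξ - z₁.2))).trans (le_of_eq ?_))
        · refine lintegral_congr fun τ ↦ ?_
          simp only [modWeight, bw_sq]
          congr 2 <;> first | ring1 | (simp; ring1)
        · congr 2
          rw [schrodingerPhase, benjaminOnoPhase]; ring
    _ ≤ _ := by
        rw [lintegral_const_mul _ (by fun_prop)]
        push_cast
        gcongr; exact hC z₁.1 z₁.2

/-- Modulation weights on the output and on the first input. In these variables the phase is
linear, with the slope `4π(ξ - ξ₁)`, which gains half a derivative. -/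
theorem isTriBounded_output_first {κ : ℝ} (hκ : 1 / 2 < κ) :
    IsTriBounded fun z z₁ ↦ ENNReal.ofReal √|z.2 - z₁.2| *
      (modWeight schrodingerPhase (-κ) z * modWeight schrodingerPhase (-κ) z₁) := by
  obtain ⟨C₁, hC₁⟩ := exists_lintegral_bw_mul_bw_le' (κ := 2 * κ) (κ₁ := 2 * κ) (κ₂ := 2 * κ)
    (by linarith) le_rfl le_rfl (Or.inl (by linarith))
  obtain ⟨C, hC⟩ := exists_lintegral_bw_linear_le (κ := 2 * κ) (by linarith)
  obtain ⟨D, hD⟩ := exists_sq_ge (C₁ * C)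
  refine IsTriBounded.of_fix_difference (by unfold Function.uncurry; fun_prop) D fun w ↦ ?_
  rw [lintegral_time_space (by fun_prop)]
  refine le_trans ?_ hD
  calc _ ≤ ∫⁻ ξ, ENNReal.ofReal |w.2| * (C₁ * bw (-(2 * κ)) ((w.1 + 2 * Real.pi * w.2 ^ 2) +
        4 * Real.pi * w.2 * ξ)) := by
        gcongr with ξ
        simp only [mul_pow, Prod.snd_add, add_sub_cancel_right]
        rw [lintegral_const_mul _ (by fun_prop), ← ENNReal.ofReal_pow (Real.sqrt_nonneg _),
          Real.sq_sqrt (abs_nonneg _)]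
        gcongr
        refine le_trans (le_of_eq ?_) ((hC₁ (w.1 + schrodingerPhase (w.2 + ξ))
          (schrodingerPhase ξ)).trans (le_of_eq ?_))
        · refine lintegral_congr fun τ ↦ ?_
          simp only [modWeight, bw_sq]
          congr 2 <;> first | ring1 | (simp; ring1)
        · congr 2
          rw [schrodingerPhase, schrodingerPhase]; ring
    _ ≤ _ := by
        rw [lintegral_const_mul _ (by fun_prop), lintegral_const_mul _ (by fun_prop)]
        push_cast
        rw [mul_left_comm]
        gcongr; exact hC _ w.2

theorem isTriBounded_inputs_one {ν κ κ₁ κ₂ : ℝ} (hν : |ν| ≠ 1) (hκ : 1 / 2 < κ)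
    (h₁ : κ ≤ 2 * κ₁) (h₂ : κ ≤ 2 * κ₂) (h : 1 < 2 * κ₁ ∨ 1 < 2 * κ₂) :
    IsTriBounded fun z z₁ ↦
      modWeight schrodingerPhase (-κ₁) z₁ * modWeight (benjaminOnoPhase ν) (-κ₂) (z - z₁) := by
  obtain ⟨C, hC⟩ := exists_lintegral_bw_phase_le (ν := -ν) (by simpa using hν) hκ
  have := isTriBounded_inputs (ν := ν) (w := fun _ _ ↦ 1) (by linarith) h₁ h₂ h
    (by unfold Function.uncurry; fun_prop) (C := C) (by simpa using hC)
  simpa using this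

/-- The phase for a fixed output is stationary at `ξ₁ = ν|ξ - ξ₁|`; away from this set half a
derivative is gained. -/
theorem isTriBounded_inputs_deriv {ν κ : ℝ} (hν : |ν| ≠ 1) (hκ : 1 / 2 < κ) :
    IsTriBounded fun z z₁ ↦ ENNReal.ofReal √(abs (z₁.2 - ν * |z.2 - z₁.2|)) *
      (modWeight schrodingerPhase (-κ) z₁ * modWeight (benjaminOnoPhase ν) (-κ) (z - z₁)) := by
  obtain ⟨C, hC⟩ := exists_lintegral_deriv_mul_bw_phase_le (ν := -ν) (κ := 2 * κ)
    (by simpa using hν) (by linarith)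
  refine isTriBounded_inputs (ν := ν) (w := fun y x ↦ ENNReal.ofReal √(abs (x - ν * |y - x|)))
    (κ := 2 * κ) (by linarith) le_rfl le_rfl (Or.inl (by linarith))
    (by unfold Function.uncurry; fun_prop) (C := C) fun e y ↦ ?_
  refine le_trans (le_of_eq ?_) (hC e y)
  refine lintegral_congr fun x ↦ ?_
  rw [← ENNReal.ofReal_pow (Real.sqrt_nonneg _), Real.sq_sqrt (abs_nonneg _), abs_sub_comm y x,
    sub_eq_add_neg, neg_mul]

/-! ### The resonance function -/

/-- The resonance function `σ - σ₁ - σ₂`, where `σ = τ + p(ξ)` is the modulation. -/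
def resonance (ν ξ ξ₁ : ℝ) : ℝ := 2 * Real.pi * (ξ - ξ₁) * (ξ + ξ₁ - ν * |ξ - ξ₁|)

theorem resonance_eq (ν : ℝ) (z z₁ : ℝ × ℝ) : resonance ν z.2 z₁.2 =
    (z.1 + schrodingerPhase z.2) - (z₁.1 + schrodingerPhase z₁.2) -
      ((z - z₁).1 + benjaminOnoPhase ν (z - z₁).2) := by
  simp only [resonance, schrodingerPhase, benjaminOnoPhase, Prod.fst_sub, Prod.snd_sub]
  ring

/-- Since `|ν| ≠ 1`, either the resonance function is of the size of `(ξ - ξ₁)²`, or all space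
frequencies are comparable and the phase is not stationary. -/
theorem exists_resonance_dichotomy {ν : ℝ} (hν : |ν| ≠ 1) : ∃ c : ℝ, 0 < c ∧ ∀ ξ ξ₁ : ℝ,
    c * (ξ - ξ₁) ^ 2 ≤ |resonance ν ξ ξ₁| ∨ (c * |ξ - ξ₁| ≤ abs (ξ₁ - ν * |ξ - ξ₁|) ∧
      c * |ξ - ξ₁| ≤ |ξ| ∧ c * |ξ - ξ₁| ≤ |ξ₁|) := by
  have h0 : 0 < abs (|ν| - 1) := abs_pos.2 (sub_ne_zero.2 hν)
  refine ⟨abs (|ν| - 1) / 4, by positivity, fun ξ ξ₁ ↦ ?_⟩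
  set k := abs (|ν| - 1) with hk
  set y := ξ - ξ₁ with hy
  set E := ξ + ξ₁ - ν * |y| with hE
  have hlow : k * |y| ≤ abs (ν * |y| - y) ∧ k * |y| ≤ abs (ν * |y| + y) := by
    have e : k * |y| = abs (abs (ν * |y|) - |y|) := by
      rw [abs_mul, abs_abs, hk, ← abs_abs y, ← abs_mul, abs_abs]; congr 1; ring
    rw [e]
    refine ⟨abs_abs_sub_abs_le _ _, ?_⟩
    have := abs_abs_sub_abs_le (ν * |y|) (-y)
    rwa [abs_neg, sub_neg_eq_add] at this
  rcases le_or_gt (k / 2 * |y|) |E| with h | h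
  · left
    rw [resonance, abs_mul, abs_mul, abs_of_pos Real.two_pi_pos, ← hy, ← hE, ← sq_abs]
    have h1 : |y| * (k / 2 * |y|) ≤ |y| * |E| := by gcongr
    nlinarith [Real.pi_gt_three, mul_nonneg (abs_nonneg y) (abs_nonneg E)]
  · right
    have tri : ∀ a t : ℝ, k * |y| ≤ |a| → 2 * t = E + a ∨ 2 * t = E - a → k / 4 * |y| ≤ |t| := by
      intro a t ha ht
      have h2 : |a| ≤ |E| + 2 * |t| := by
        rw [← abs_two (α := ℝ), ← abs_mul]
        rcases ht with ht | ht
        · rw [show a = 2 * t - E by linarith]; linarith [abs_sub (2 * t) E]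
        · rw [show a = E - 2 * t by linarith]; exact abs_sub _ _
      linarith
    refine ⟨tri (ν * |y| + y) _ hlow.2 (Or.inr ?_), tri (ν * |y| + y) _ hlow.2 (Or.inl ?_),
      tri (ν * |y| - y) _ hlow.1 (Or.inl ?_)⟩ <;> rw [hE] <;> linarith

/-! ### Pointwise bounds of the multipliers -/

theorem rpow_neg_le_one {S k : ℝ} (hS : 1 ≤ S) (hk : 0 ≤ k) : S ^ (-k) ≤ 1 :=
  Real.rpow_le_one_of_one_le_of_nonpos hS (by linarith)

theorem bracket_le_two_mul (ξ ξ₁ : ℝ) :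
    bracket ξ ≤ 2 * (bracket ξ₁ * bracket (ξ - ξ₁)) := by
  have h := bracket_add_le ξ₁ (ξ - ξ₁)
  rw [add_sub_cancel] at h
  nlinarith [one_le_bracket ξ₁, one_le_bracket (ξ - ξ₁)]

theorem rpow_mul_rpow_neg_le {X Y c s : ℝ} (hX : 0 < X) (hY : 0 < Y) (hc : 0 < c) (hs : 0 ≤ s)
    (h : X ≤ c * Y) : X ^ s * Y ^ (-s) ≤ c ^ s := by
  rw [Real.rpow_neg hY.le, ← div_eq_mul_inv, div_le_iff₀ (Real.rpow_pos_of_pos hY s),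
    ← Real.mul_rpow hc.le hY.le]
  exact Real.rpow_le_rpow hX.le h hs

/-- Exponents of modulations may be permuted so that the largest modulation carries the smallest
one. -/
theorem rpow_neg_mul_rpow_neg_le {S S₁ a b β : ℝ} (hS : 1 ≤ S) (h : S ≤ S₁) (haβ : a ≤ β)
    (hβb : β ≤ b) : S ^ (-a) * S₁ ^ (-b) ≤ S₁ ^ (-a) * S ^ (-β) := by
  have hS0 : 0 < S := by linarith
  have hS1 : 0 < S₁ := by linarith
  have h1 : S₁ ^ (-b) ≤ S₁ ^ (-a) * S₁ ^ (a - β) := by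
    rw [← Real.rpow_add hS1]
    exact Real.rpow_le_rpow_of_exponent_le (by linarith) (by linarith)
  have h2 : S₁ ^ (a - β) ≤ S ^ (a - β) := Real.rpow_le_rpow_of_nonpos hS0 h (by linarith)
  calc S ^ (-a) * S₁ ^ (-b) ≤
    S ^ (-a) * (S₁ ^ (-a) * S ^ (a - β)) := by gcongr; exact h1.trans (by gcongr)
    _ = S₁ ^ (-a) * (S ^ (-a) * S ^ (a - β)) := by ring
    _ = _ := by rw [← Real.rpow_add hS0]; congr 2; ring

theorem exists_bracket_sq_le (c : ℝ) (hc : 0 < c) : ∃ K : ℝ, 0 < K ∧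
    ∀ y S S₁ S₂ D : ℝ, 1 ≤ S → 1 ≤ S₁ → 1 ≤ S₂ → |D| ≤ S + S₁ + S₂ → c * y ^ 2 ≤ |D| →
      bracket y ^ 2 ≤ K * max S (max S₁ S₂) := by
  refine ⟨1 + 3 / c, by positivity, fun y S S₁ S₂ D h h₁ h₂ hD hy ↦ ?_⟩
  have e : bracket y ^ 2 = 1 + y ^ 2 := Real.sq_sqrt (by positivity)
  set m := max S (max S₁ S₂)
  have a1 : S ≤ m := le_max_left _ _
  have a2 : S₁ ≤ m := (le_max_left _ _).trans (le_max_right _ _)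
  have a3 : S₂ ≤ m := (le_max_right _ _).trans (le_max_right _ _)
  have : y ^ 2 ≤ 3 / c * m := by
    rw [div_mul_eq_mul_div, le_div_iff₀ hc]; linarith
  rw [e]; linarith

theorem rpow_le_of_sq_le {X K m d a : ℝ} (hX : 1 ≤ X) (hK : 0 < K) (hm : 1 ≤ m) (ha : 0 ≤ a)
    (hd : d ≤ 2 * a) (h : X ^ 2 ≤ K * m) : X ^ d ≤ K ^ a * m ^ a := by
  rw [← Real.mul_rpow hK.le (by linarith)]
  calc X ^ d ≤ X ^ (2 * a) := Real.rpow_le_rpow_of_exponent_le hX hd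
    _ = (X ^ 2) ^ a := by rw [Real.rpow_mul (by linarith), Real.rpow_two]
    _ ≤ _ := Real.rpow_le_rpow (by positivity) h ha

/-- The multiplier of the estimate for the product `u v`. -/
theorem exists_schrodinger_multiplier_le {ν s s' a b b' β : ℝ} (hν : |ν| ≠ 1) (hs : 0 ≤ s)
    (hs' : -1 / 2 ≤ s') (hd : s - s' ≤ 1) (ha : 0 ≤ a) (hda : s - s' ≤ 2 * a) (haβ : a ≤ β)
    (hb : β ≤ b) (hb' : β ≤ b') :
    ∃ C : ℝ, 0 ≤ C ∧ ∀ ξ ξ₁ S S₁ S₂ : ℝ, 1 ≤ S → 1 ≤ S₁ → 1 ≤ S₂ →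
      |resonance ν ξ ξ₁| ≤ S + S₁ + S₂ →
      bracket ξ ^ s * bracket ξ₁ ^ (-s) * bracket (ξ - ξ₁) ^ (-s') *
        (S ^ (-a) * S₁ ^ (-b) * S₂ ^ (-b')) ≤
      C * (S₁ ^ (-β) * S₂ ^ (-β) + √(abs (ξ₁ - ν * |ξ - ξ₁|)) * (S₁ ^ (-β) * S₂ ^ (-β)) +
        S ^ (-β) * S₂ ^ (-β) + √|ξ - ξ₁| * (S ^ (-β) * S₁ ^ (-β))) := by
  obtain ⟨c, hc, hdich⟩ := exists_resonance_dichotomy hν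
  obtain ⟨K, hK, hKb⟩ := exists_bracket_sq_le c hc
  set c₁ : ℝ := 1 + 1 / c with hc₁
  have hc₁0 : 1 ≤ c₁ := by rw [hc₁]; have : 0 < 1 / c := by positivity
                           linarith
  set C : ℝ := c₁ ^ s * (1 + √(1 / c)) + 2 ^ s * K ^ a + 2 ^ s * 2 with hC
  have hC1 : c₁ ^ s * (1 + √(1 / c)) ≤ C := by
    rw [hC]; have : 0 ≤ 2 ^ s * K ^ a + 2 ^ s * 2 := by positivity
    linarith
  have hC2 : 2 ^ s * K ^ a ≤ C := by
    rw [hC]; have : 0 ≤ c₁ ^ s * (1 + √(1 / c)) + 2 ^ s * 2 := by positivity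
    linarith
  have hC3 : 2 ^ s * 2 ≤ C := by
    rw [hC]; have : 0 ≤ c₁ ^ s * (1 + √(1 / c)) + 2 ^ s * K ^ a := by positivity
    linarith
  have hC0 : 0 ≤ C := le_trans (by positivity) hC2
  refine ⟨C, hC0, fun ξ ξ₁ S S₁ S₂ hS hS₁ hS₂ hres ↦ ?_⟩
  have hX := bracket_pos ξ
  have hX₁ := bracket_pos ξ₁
  have hX₂ := bracket_pos (ξ - ξ₁)
  have hX₂1 := one_le_bracket (ξ - ξ₁)
  have pS : 0 < S := by linarith
  have pS₁ : 0 < S₁ := by linarith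
  have pS₂ : 0 < S₂ := by linarith
  have eb : S₁ ^ (-b) ≤ S₁ ^ (-β) := Real.rpow_le_rpow_of_exponent_le hS₁ (by linarith)
  have eb' : S₂ ^ (-b') ≤ S₂ ^ (-β) := Real.rpow_le_rpow_of_exponent_le hS₂ (by linarith)
  have ea : S ^ (-a) ≤ 1 := rpow_neg_le_one hS ha
  set m := bracket ξ ^ s * bracket ξ₁ ^ (-s) * bracket (ξ - ξ₁) ^ (-s') with hm
  have hm0 : 0 ≤ m := by positivity
  -- what a bound of `m` yields if the modulation of the output is dropped
  have hdrop : ∀ t : ℝ, m ≤ t → m * (S ^ (-a) * S₁ ^ (-b) * S₂ ^ (-b')) ≤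
      t * (S₁ ^ (-β) * S₂ ^ (-β)) := by
    intro t ht
    calc _ ≤ m * (1 * S₁ ^ (-β) * S₂ ^ (-β)) := by gcongr
      _ = m * (S₁ ^ (-β) * S₂ ^ (-β)) := by ring
      _ ≤ _ := by gcongr
  have q1 : 0 ≤ S₁ ^ (-β) * S₂ ^ (-β) := by positivity
  have q2 : 0 ≤ √(abs (ξ₁ - ν * |ξ - ξ₁|)) * (S₁ ^ (-β) * S₂ ^ (-β)) := by positivity
  have q3 : 0 ≤ S ^ (-β) * S₂ ^ (-β) := by positivity
  have q4 : 0 ≤ √|ξ - ξ₁| * (S ^ (-β) * S₁ ^ (-β)) := by positivity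
  -- crude bound `m ≤ 2 ^ s ⟨ξ₂⟩ ^ (s - s')`
  have hm2 : m ≤ 2 ^ s * bracket (ξ - ξ₁) ^ (s - s') := by
    have h1 := bracket_le_two_mul ξ ξ₁
    have h2 : bracket ξ ^ s * bracket ξ₁ ^ (-s) ≤ (2 * bracket (ξ - ξ₁)) ^ s :=
      rpow_mul_rpow_neg_le hX hX₁ (by positivity) hs (by linarith)
    calc m ≤ (2 * bracket (ξ - ξ₁)) ^ s * bracket (ξ - ξ₁) ^ (-s') := by rw [hm]; gcongr
      _ = _ := by
        rw [Real.mul_rpow (by norm_num) hX₂.le, mul_assoc, ← Real.rpow_add hX₂,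
          ← sub_eq_add_neg s s']
  rcases hdich ξ ξ₁ with h | ⟨h1, h2, h3⟩
  · have hK2 := hKb (ξ - ξ₁) S S₁ S₂ _ hS hS₁ hS₂ hres h
    have hM1 : 1 ≤ max S (max S₁ S₂) := le_max_of_le_left hS
    have hmM : m ≤ C * (max S (max S₁ S₂)) ^ a := by
      refine hm2.trans ?_
      calc _ ≤ 2 ^ s * (K ^ a * (max S (max S₁ S₂)) ^ a) := by
            gcongr; exact rpow_le_of_sq_le hX₂1 hK hM1 ha hda hK2
        _ = 2 ^ s * K ^ a * (max S (max S₁ S₂)) ^ a := by ring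
        _ ≤ _ := by gcongr
    have cancel : ∀ Y : ℝ, 1 ≤ Y → Y ^ a * Y ^ (-a) = 1 := fun Y hY ↦ by
      rw [← Real.rpow_add (by linarith), add_neg_cancel, Real.rpow_zero]
    -- the largest modulation is that of the second input; low frequencies `ξ - ξ₁` are treated
    -- separately, because the factor `√|ξ - ξ₁|` is not available for them
    have hlast : S ≤ S₂ → S₁ ≤ S₂ → m * (S ^ (-a) * S₁ ^ (-b) * S₂ ^ (-b')) ≤
      C * (S₁ ^ (-β) * S₂ ^ (-β) + √(abs (ξ₁ - ν * |ξ - ξ₁|)) * (S₁ ^ (-β) * S₂ ^ (-β)) +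
        S ^ (-β) * S₂ ^ (-β) + √|ξ - ξ₁| * (S ^ (-β) * S₁ ^ (-β))) := by
      intro hle' hle₂
      rw [max_eq_right (hle'.trans (le_max_right _ _)), max_eq_right hle₂] at hmM
      rcases le_or_gt 1 |ξ - ξ₁| with hy | hy
      · have hsw := rpow_neg_mul_rpow_neg_le hS hle' haβ hb'
        calc _ = m * (S ^ (-a) * S₂ ^ (-b')) * S₁ ^ (-b) := by ring
          _ ≤ C * S₂ ^ a * (S₂ ^ (-a) * S ^ (-β)) * S₁ ^ (-β) := by gcongr
          _ = C * (S₂ ^ a * S₂ ^ (-a)) * (1 * (S ^ (-β) * S₁ ^ (-β))) := by ring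
          _ ≤ C * (√|ξ - ξ₁| * (S ^ (-β) * S₁ ^ (-β))) := by
            rw [cancel S₂ hS₂, mul_one]; gcongr; exact Real.one_le_sqrt.2 hy
          _ ≤ _ := by gcongr; linarith
      · have : bracket (ξ - ξ₁) ^ (s - s') ≤ 2 := by
          calc _ ≤ bracket (ξ - ξ₁) ^ (1 : ℝ) := Real.rpow_le_rpow_of_exponent_le hX₂1 hd
            _ ≤ 2 := by rw [Real.rpow_one]; linarith [bracket_le_one_add_abs (ξ - ξ₁)]
        have h5 : m ≤ C := (hm2.trans (by gcongr)).trans hC3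
        refine (hdrop C h5).trans ?_
        gcongr; linarith
    rcases le_total S₁ S with hle | hle
    · rcases le_total S₂ S with hle' | hle'
      · rw [max_eq_left (max_le hle hle')] at hmM
        calc _ ≤ C * S ^ a * (S ^ (-a) * S₁ ^ (-β) * S₂ ^ (-β)) := by gcongr
          _ = C * (S ^ a * S ^ (-a)) * (S₁ ^ (-β) * S₂ ^ (-β)) := by ring
          _ = C * (S₁ ^ (-β) * S₂ ^ (-β)) := by rw [cancel S hS, mul_one]
          _ ≤ _ := by gcongr; linarith
      · exact hlast hle' (hle.trans hle')
    · rcases le_total S₂ S₁ with hle' | hle'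
      · rw [max_eq_right (hle.trans (le_max_left _ _)), max_eq_left hle'] at hmM
        have hsw := rpow_neg_mul_rpow_neg_le hS hle haβ hb
        calc _ = m * (S ^ (-a) * S₁ ^ (-b)) * S₂ ^ (-b') := by ring
          _ ≤ C * S₁ ^ a * (S₁ ^ (-a) * S ^ (-β)) * S₂ ^ (-β) := by gcongr
          _ = C * (S₁ ^ a * S₁ ^ (-a)) * (S ^ (-β) * S₂ ^ (-β)) := by ring
          _ = C * (S ^ (-β) * S₂ ^ (-β)) := by rw [cancel S₁ hS₁, mul_one]
          _ ≤ _ := by gcongr; linarith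
      · have hle'' := hle.trans hle'
        exact hlast hle'' hle'
  · have h4 : bracket ξ ≤ c₁ * bracket ξ₁ := by
      apply bracket_le_mul hc₁0
      have : |ξ - ξ₁| ≤ 1 / c * |ξ₁| := by
        rw [div_mul_eq_mul_div, le_div_iff₀ hc, one_mul]; linarith
      have h5 := abs_add_le ξ₁ (ξ - ξ₁)
      rw [add_sub_cancel] at h5
      rw [hc₁]; linarith
    have h5 : bracket (ξ - ξ₁) ^ (-s') ≤ 1 + √(1 / c) * √(abs (ξ₁ - ν * |ξ - ξ₁|)) := by
      calc _ ≤ bracket (ξ - ξ₁) ^ (1 / 2 : ℝ) :=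
            Real.rpow_le_rpow_of_exponent_le hX₂1 (by linarith)
        _ ≤ √(1 + |ξ - ξ₁|) := by
            rw [← Real.sqrt_eq_rpow]; exact Real.sqrt_le_sqrt (bracket_le_one_add_abs _)
        _ ≤ 1 + √|ξ - ξ₁| := by
            rw [Real.sqrt_le_iff]
            refine ⟨by positivity, ?_⟩
            nlinarith [Real.sq_sqrt (abs_nonneg (ξ - ξ₁)), Real.sqrt_nonneg |ξ - ξ₁|]
        _ ≤ _ := by
            rw [← Real.sqrt_mul (by positivity)]
            gcongr
            rw [div_mul_eq_mul_div, le_div_iff₀ hc, one_mul]; linarith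
    have h6 : m ≤ c₁ ^ s * (1 + √(1 / c) * √(abs (ξ₁ - ν * |ξ - ξ₁|))) := by
      rw [hm]; gcongr; exact rpow_mul_rpow_neg_le hX hX₁ (by linarith) hs h4
    refine (hdrop _ h6).trans ?_
    have w1 : c₁ ^ s * 1 ≤ C := le_trans (by gcongr; linarith [Real.sqrt_nonneg (1 / c)]) hC1
    have w2 : c₁ ^ s * √(1 / c) ≤ C := le_trans (by gcongr; linarith) hC1
    calc _ = c₁ ^ s * 1 * (S₁ ^ (-β) * S₂ ^ (-β)) + c₁ ^ s * √(1 / c) *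
          (√(abs (ξ₁ - ν * |ξ - ξ₁|)) * (S₁ ^ (-β) * S₂ ^ (-β))) := by ring
      _ ≤ C * (S₁ ^ (-β) * S₂ ^ (-β)) + C *
          (√(abs (ξ₁ - ν * |ξ - ξ₁|)) * (S₁ ^ (-β) * S₂ ^ (-β))) := by gcongr
      _ ≤ _ := by
        rw [← mul_add]; exact mul_le_mul_of_nonneg_left (by linarith) hC0

/-- The multiplier of the estimate for `∂ₓ(u₁ ū₂)`. -/
theorem exists_benjaminOno_multiplier_le {ν s s' a b : ℝ} (hν : |ν| ≠ 1) (hs : 0 ≤ s)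
    (hs' : s' ≤ 2 * s - 1 / 2) (hb : 0 ≤ b) (hdb : 1 - (s - s') ≤ 2 * b) (ha : 0 ≤ a)
    (hda : 1 / 2 - (s - s') ≤ 2 * a) :
    ∃ C : ℝ, 0 ≤ C ∧ ∀ ξ ξ₁ S S₁ S₂ : ℝ, 1 ≤ S → 1 ≤ S₁ → 1 ≤ S₂ →
      |resonance ν ξ ξ₁| ≤ S + S₁ + S₂ →
      |ξ - ξ₁| * bracket (ξ - ξ₁) ^ s' * bracket ξ ^ (-s) * bracket ξ₁ ^ (-s) *
        (S ^ (-b) * S₁ ^ (-b) * S₂ ^ (-a)) ≤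
      C * (√|ξ - ξ₁| * (S ^ (-b) * S₁ ^ (-b)) + S₁ ^ (-b) * S₂ ^ (-a) +
        S ^ (-b) * S₂ ^ (-a)) := by
  obtain ⟨c, hc, hdich⟩ := exists_resonance_dichotomy hν
  obtain ⟨K, hK, hKb⟩ := exists_bracket_sq_le c hc
  set c₁ : ℝ := 1 + 1 / c with hc₁
  have hc0 : 0 < 1 / c := by positivity
  have hc₁0 : 1 ≤ c₁ := by rw [hc₁]; linarith
  set C : ℝ := c₁ ^ s * c₁ ^ s + 2 ^ s * K ^ b + 2 ^ s * K ^ a with hC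
  have p1 : 0 ≤ c₁ ^ s * c₁ ^ s := by positivity
  have p2 : 0 ≤ 2 ^ s * K ^ b := by positivity
  have p3 : 0 ≤ 2 ^ s * K ^ a := by positivity
  have hC1 : c₁ ^ s * c₁ ^ s ≤ C := by linarith
  have hC2 : 2 ^ s * K ^ b ≤ C := by linarith
  have hC3 : 2 ^ s * K ^ a ≤ C := by linarith
  have hC0 : 0 ≤ C := by linarith
  refine ⟨C, hC0, fun ξ ξ₁ S S₁ S₂ hS hS₁ hS₂ hres ↦ ?_⟩
  have hX := bracket_pos ξ
  have hX₁ := bracket_pos ξ₁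
  have hX1 := one_le_bracket ξ
  have hX₁1 := one_le_bracket ξ₁
  have hX₂ := bracket_pos (ξ - ξ₁)
  have hX₂1 := one_le_bracket (ξ - ξ₁)
  have pS : 0 < S := by linarith
  have pS₁ : 0 < S₁ := by linarith
  have pS₂ : 0 < S₂ := by linarith
  have ea : S₂ ^ (-a) ≤ 1 := rpow_neg_le_one hS₂ ha
  set X₂ := bracket (ξ - ξ₁) with hX₂def
  set m := |ξ - ξ₁| * X₂ ^ s' * bracket ξ ^ (-s) * bracket ξ₁ ^ (-s) with hm
  have hm0 : 0 ≤ m := by positivity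
  have q1 : 0 ≤ √|ξ - ξ₁| * (S ^ (-b) * S₁ ^ (-b)) := by positivity
  have q2 : 0 ≤ S₁ ^ (-b) * S₂ ^ (-a) := by positivity
  have q3 : 0 ≤ S ^ (-b) * S₂ ^ (-a) := by positivity
  have hy0 : |ξ - ξ₁| ≤ X₂ := abs_le_bracket _
  -- half of the derivative
  have hhalf : |ξ - ξ₁| ≤ √|ξ - ξ₁| * X₂ ^ (1 / 2 : ℝ) := by
    rw [← Real.sqrt_eq_rpow]
    nth_rewrite 1 [← Real.mul_self_sqrt (abs_nonneg (ξ - ξ₁))]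
    gcongr
  rcases hdich ξ ξ₁ with h | ⟨-, h2, h3⟩
  · have hK2 := hKb (ξ - ξ₁) S S₁ S₂ _ hS hS₁ hS₂ hres h
    have hM1 : 1 ≤ max S (max S₁ S₂) := le_max_of_le_left hS
    set M := max S (max S₁ S₂) with hM
    -- the larger input frequency controls `ξ₂`
    have hm2 : m ≤ 2 ^ s * (|ξ - ξ₁| * X₂ ^ (s' - s)) := by
      have h1 : X₂ ≤ 2 * (bracket ξ * bracket ξ₁) := by
        have := bracket_le_two_mul (ξ - ξ₁) ξ
        rwa [sub_sub_cancel_left, bracket_neg] at this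
      have h2 : X₂ ^ s * (bracket ξ * bracket ξ₁) ^ (-s) ≤ 2 ^ s :=
        rpow_mul_rpow_neg_le hX₂ (by positivity) (by norm_num) hs h1
      calc m = |ξ - ξ₁| * X₂ ^ (s' - s) * (X₂ ^ s * (bracket ξ * bracket ξ₁) ^ (-s)) := by
            rw [hm, Real.mul_rpow hX.le hX₁.le]
            have : X₂ ^ s' = X₂ ^ (s' - s) * X₂ ^ s := by
              rw [← Real.rpow_add hX₂, sub_add_cancel]
            rw [this]; ring
        _ ≤ |ξ - ξ₁| * X₂ ^ (s' - s) * 2 ^ s := by gcongr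
        _ = _ := by ring
    have hmb : m ≤ C * M ^ b := by
      refine hm2.trans ?_
      calc _ ≤ 2 ^ s * (X₂ * X₂ ^ (s' - s)) := by gcongr
        _ = 2 ^ s * X₂ ^ (1 - (s - s')) := by
            nth_rewrite 1 [← Real.rpow_one X₂]
            rw [← Real.rpow_add hX₂]; congr 2; ring
        _ ≤ 2 ^ s * (K ^ b * M ^ b) := by
            gcongr; exact rpow_le_of_sq_le hX₂1 hK hM1 hb hdb hK2
        _ = 2 ^ s * K ^ b * M ^ b := by ring
        _ ≤ _ := by gcongr
    have hma : m ≤ C * (√|ξ - ξ₁| * M ^ a) := by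
      refine hm2.trans ?_
      calc _ ≤ 2 ^ s * (√|ξ - ξ₁| * X₂ ^ (1 / 2 : ℝ) * X₂ ^ (s' - s)) := by gcongr
        _ = 2 ^ s * (√|ξ - ξ₁| * X₂ ^ (1 / 2 - (s - s'))) := by
            rw [mul_assoc (√|ξ - ξ₁|), ← Real.rpow_add hX₂]; congr 3; ring
        _ ≤ 2 ^ s * (√|ξ - ξ₁| * (K ^ a * M ^ a)) := by
            gcongr; exact rpow_le_of_sq_le hX₂1 hK hM1 ha hda hK2
        _ = 2 ^ s * K ^ a * (√|ξ - ξ₁| * M ^ a) := by ring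
        _ ≤ _ := by gcongr
    have cancel : ∀ Y r : ℝ, 1 ≤ Y → Y ^ r * Y ^ (-r) = 1 := fun Y r hY ↦ by
      rw [← Real.rpow_add (by linarith), add_neg_cancel, Real.rpow_zero]
    have hM3 : M = S ∨ M = S₁ ∨ M = S₂ := by
      rcases max_choice S (max S₁ S₂) with h | h
      · exact Or.inl h
      · right; rw [hM, h]; exact max_choice _ _
    rcases hM3 with e | e | e
    · rw [e] at hmb
      calc _ ≤ C * S ^ b * (S ^ (-b) * S₁ ^ (-b) * S₂ ^ (-a)) := by gcongr
        _ = C * (S ^ b * S ^ (-b)) * (S₁ ^ (-b) * S₂ ^ (-a)) := by ring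
        _ = C * (S₁ ^ (-b) * S₂ ^ (-a)) := by rw [cancel S b hS, mul_one]
        _ ≤ _ := by gcongr; linarith
    · rw [e] at hmb
      calc _ ≤ C * S₁ ^ b * (S ^ (-b) * S₁ ^ (-b) * S₂ ^ (-a)) := by gcongr
        _ = C * (S₁ ^ b * S₁ ^ (-b)) * (S ^ (-b) * S₂ ^ (-a)) := by ring
        _ = C * (S ^ (-b) * S₂ ^ (-a)) := by rw [cancel S₁ b hS₁, mul_one]
        _ ≤ _ := by gcongr; linarith
    · rw [e] at hma
      calc _ ≤ C * (√|ξ - ξ₁| * S₂ ^ a) * (S ^ (-b) * S₁ ^ (-b) * S₂ ^ (-a)) := by gcongr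
        _ = C * (S₂ ^ a * S₂ ^ (-a)) * (√|ξ - ξ₁| * (S ^ (-b) * S₁ ^ (-b))) := by ring
        _ = C * (√|ξ - ξ₁| * (S ^ (-b) * S₁ ^ (-b))) := by rw [cancel S₂ a hS₂, mul_one]
        _ ≤ _ := by gcongr; linarith
  · have hcmp : ∀ t : ℝ, c * |ξ - ξ₁| ≤ |t| → X₂ ≤ c₁ * bracket t := by
      intro t ht
      apply bracket_le_mul hc₁0
      have : |ξ - ξ₁| ≤ 1 / c * |t| := by
        rw [div_mul_eq_mul_div, le_div_iff₀ hc, one_mul]; linarith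
      rw [hc₁]; nlinarith [abs_nonneg t]
    have r1 := rpow_mul_rpow_neg_le hX₂ hX (by linarith) hs (hcmp ξ h2)
    have r2 := rpow_mul_rpow_neg_le hX₂ hX₁ (by linarith) hs (hcmp ξ₁ h3)
    have hm2 : m ≤ C * √|ξ - ξ₁| := by
      calc m = |ξ - ξ₁| * X₂ ^ (s' - 2 * s) * ((X₂ ^ s * bracket ξ ^ (-s)) *
              (X₂ ^ s * bracket ξ₁ ^ (-s))) := by
            have : X₂ ^ s' = X₂ ^ (s' - 2 * s) * (X₂ ^ s * X₂ ^ s) := by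
              rw [← Real.rpow_add hX₂, ← Real.rpow_add hX₂]; congr 1; ring
            rw [hm, this]; ring
        _ ≤ |ξ - ξ₁| * X₂ ^ (-(1 / 2) : ℝ) * (c₁ ^ s * c₁ ^ s) := by
            gcongr
            linarith
        _ ≤ √|ξ - ξ₁| * X₂ ^ (1 / 2 : ℝ) * X₂ ^ (-(1 / 2) : ℝ) * C := by gcongr
        _ = _ := by
            rw [mul_assoc (√|ξ - ξ₁|), ← Real.rpow_add hX₂, add_neg_cancel, Real.rpow_zero]; ring
    calc _ ≤ C * √|ξ - ξ₁| * (S ^ (-b) * S₁ ^ (-b) * 1) := by gcongr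
      _ = C * (√|ξ - ξ₁| * (S ^ (-b) * S₁ ^ (-b))) := by ring
      _ ≤ _ := by gcongr; linarith

/-! ### Trilinear forms of the two nonlinearities -/

theorem bracket_rpow_nonneg (κ x : ℝ) : 0 ≤ bracket x ^ κ := (bracket_rpow_pos κ x).le

theorem abs_resonance_le (ν : ℝ) (z z₁ : ℝ × ℝ) : |resonance ν z.2 z₁.2| ≤
    bracket (z.1 + schrodingerPhase z.2) + bracket (z₁.1 + schrodingerPhase z₁.2) +
      bracket ((z - z₁).1 + benjaminOnoPhase ν (z - z₁).2) := by
  rw [resonance_eq]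
  refine (abs_sub _ _).trans (add_le_add ((abs_sub _ _).trans (add_le_add ?_ ?_)) ?_) <;>
    exact abs_le_bracket _

/-- The trilinear form of `u v`, with the exponents of the weights on the output and the inputs. -/
theorem isTriBounded_schrodinger {ν s s' a b b' : ℝ} (hν : |ν| ≠ 1) (hs : 0 ≤ s)
    (hs' : -1 / 2 ≤ s') (hd : s - s' ≤ 1) (ha : 0 ≤ a) (ha' : a ≤ 1 / 2) (hda : s - s' ≤ 2 * a)
    (hb : 1 / 2 < b) (hb' : 1 / 2 < b') :
    IsTriBounded fun z z₁ ↦ bw s z.2 * bw (-s) z₁.2 * bw (-s') (z.2 - z₁.2) *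
      (modWeight schrodingerPhase (-a) z * modWeight schrodingerPhase (-b) z₁ *
        modWeight (benjaminOnoPhase ν) (-b') (z - z₁)) := by
  set β := min b b' with hβ
  have hβ2 : 1 / 2 < β := lt_min hb hb'
  obtain ⟨C, hC0, hC⟩ := exists_schrodinger_multiplier_le (β := β) hν hs hs' hd ha hda
    (by linarith) (min_le_left b b') (min_le_right b b')
  have h1 := isTriBounded_inputs_one (κ := 2 * β) (κ₁ := β) (κ₂ := β) hν (by linarith) le_rfl le_rfl
    (Or.inl (by linarith))
  have h2 := isTriBounded_inputs_deriv hν hβ2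
  have h3 := isTriBounded_output_second (κ := 2 * β) (κ₁ := β) (κ₂ := β) hν (by linarith) le_rfl
    le_rfl (Or.inl (by linarith))
  have h4 := isTriBounded_output_first hβ2
  refine (((h1.add h2 ?_).add h3 ?_).add h4 ?_).of_le C.toNNReal fun z z₁ ↦ ?_
  any_goals unfold Function.uncurry; fun_prop
  have key := hC z.2 z₁.2 _ _ _ (one_le_bracket _) (one_le_bracket _) (one_le_bracket _)
    (abs_resonance_le ν z z₁)
  have h0 := bracket_pos z.2
  have h01 := bracket_pos z₁.2
  have h02 := bracket_pos (z.2 - z₁.2)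
  have g0 := bracket_pos (z.1 + schrodingerPhase z.2)
  have g1 := bracket_pos (z₁.1 + schrodingerPhase z₁.2)
  have g2 := bracket_pos ((z - z₁).1 + benjaminOnoPhase ν (z - z₁).2)
  simp only [modWeight, bw]
  generalize bracket z.2 = X, bracket z₁.2 = X₁, bracket (z.2 - z₁.2) = X₂,
    bracket (z.1 + schrodingerPhase z.2) = S, bracket (z₁.1 + schrodingerPhase z₁.2) = S₁,
    bracket ((z - z₁).1 + benjaminOnoPhase ν (z - z₁).2) = S₂ at *
  have := ENNReal.ofReal_le_ofReal key
  repeat first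
    | rw [ENNReal.ofReal_mul] at this
    | rw [ENNReal.ofReal_add] at this
  · exact this
  all_goals positivity

/-- The trilinear form of `∂ₓ(u₁ ū₂)`. The frequency of the output is `z - z₁`, and `z`, `z₁` are
those of the two Schrödinger factors. -/
theorem isTriBounded_benjaminOno {ν s s' a b : ℝ} (hν : |ν| ≠ 1) (hs : 0 ≤ s)
    (hs' : s' ≤ 2 * s - 1 / 2) (hb : 1 / 2 < b) (hdb : 1 - (s - s') ≤ 2 * b) (ha : 1 / 4 < a)
    (hab : a ≤ b) (hda : 1 / 2 - (s - s') ≤ 2 * a) :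
    IsTriBounded fun z z₁ ↦
      ENNReal.ofReal |z.2 - z₁.2| * bw s' (z.2 - z₁.2) * bw (-s) z.2 * bw (-s) z₁.2 *
      (modWeight schrodingerPhase (-b) z * modWeight schrodingerPhase (-b) z₁ *
        modWeight (benjaminOnoPhase ν) (-a) (z - z₁)) := by
  obtain ⟨C, hC0, hC⟩ := exists_benjaminOno_multiplier_le hν hs hs' (by linarith : 0 ≤ b) hdb
    (by linarith : 0 ≤ a) hda
  have h1 := isTriBounded_output_first hb
  have h2 := isTriBounded_inputs_one (κ := 2 * a) (κ₁ := b) (κ₂ := a) hν (by linarith)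
    (by linarith) le_rfl (Or.inl (by linarith))
  have h3 := isTriBounded_output_second (κ := 2 * a) (κ₁ := b) (κ₂ := a) hν (by linarith)
    (by linarith) le_rfl (Or.inl (by linarith))
  refine ((h1.add h2 ?_).add h3 ?_).of_le C.toNNReal fun z z₁ ↦ ?_
  any_goals unfold Function.uncurry; fun_prop
  have key := hC z.2 z₁.2 _ _ _ (one_le_bracket _) (one_le_bracket _) (one_le_bracket _)
    (abs_resonance_le ν z z₁)
  have h0 := bracket_pos z.2
  have h01 := bracket_pos z₁.2
  have h02 := bracket_pos (z.2 - z₁.2)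
  have g0 := bracket_pos (z.1 + schrodingerPhase z.2)
  have g1 := bracket_pos (z₁.1 + schrodingerPhase z₁.2)
  have g2 := bracket_pos ((z - z₁).1 + benjaminOnoPhase ν (z - z₁).2)
  simp only [modWeight, bw]
  generalize bracket z.2 = X, bracket z₁.2 = X₁, bracket (z.2 - z₁.2) = X₂,
    bracket (z.1 + schrodingerPhase z.2) = S, bracket (z₁.1 + schrodingerPhase z₁.2) = S₁,
    bracket ((z - z₁).1 + benjaminOnoPhase ν (z - z₁).2) = S₂ at *
  have := ENNReal.ofReal_le_ofReal key
  repeat first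
    | rw [ENNReal.ofReal_mul] at this
    | rw [ENNReal.ofReal_add] at this
  · exact this
  all_goals positivity

/-! ### Bilinear estimates -/

theorem l2_congr_ae {α : Type*} [MeasureSpace α] {f g : α → ℝ≥0∞} (h : f =ᵐ[volume] g) :
    l2 f = l2 g := by
  unfold l2
  congr 1
  refine lintegral_congr_ae (h.mono fun x hx ↦ ?_)
  simp only [hx]

theorem l2_mono_ae {α : Type*} [MeasureSpace α] {f g : α → ℝ≥0∞} (h : f ≤ᵐ[volume] g) :
    l2 f ≤ l2 g := by
  unfold l2
  refine ENNReal.rpow_le_rpow (lintegral_mono_ae (h.mono fun x hx ↦ ?_)) (by norm_num)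
  exact pow_le_pow_left' hx 2

theorem l2_mono {α : Type*} [MeasureSpace α] {f g : α → ℝ≥0∞} (h : ∀ x, f x ≤ g x) :
    l2 f ≤ l2 g := l2_mono_ae (Eventually.of_forall h)

/-- The `L²` norm by duality. -/
theorem l2_le_of_forall_lintegral_mul_le {H : ℝ × ℝ → ℝ≥0∞} (hH : Measurable H) {C : ℝ≥0∞}
    (h : ∀ f : ℝ × ℝ → ℝ≥0∞, Measurable f → ∫⁻ z, f z * H z ≤ C * l2 f) : l2 H ≤ C := by
  set F : ℕ → ℝ × ℝ → ℝ≥0∞ := fun n ↦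
    (Metric.closedBall 0 (n : ℝ)).indicator fun z ↦ min (H z) n with hF
  have hFm : ∀ n, Measurable (F n) := fun n ↦
    (hH.min measurable_const).indicator Metric.isClosed_closedBall.measurableSet
  have hFH : ∀ n z, F n z ≤ H z := fun n z ↦
    (indicator_le_self _ _ z).trans (min_le_left _ _)
  have hFn : ∀ n, l2 (F n) ≠ ∞ := by
    intro n
    have : ∫⁻ z, F n z ^ 2 ≠ ∞ := by
      refine ne_top_of_le_ne_top (b := ∫⁻ z in Metric.closedBall (0 : ℝ × ℝ) n,
        (n : ℝ≥0∞) ^ 2) ?_ ?_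
      · rw [lintegral_const]
        refine ENNReal.mul_ne_top (by finiteness) ?_
        rw [Measure.restrict_apply_univ]
        exact (isCompact_closedBall _ _).measure_lt_top.ne
      · rw [← lintegral_indicator Metric.isClosed_closedBall.measurableSet]
        refine lintegral_mono fun z ↦ ?_
        by_cases hz : z ∈ Metric.closedBall (0 : ℝ × ℝ) n
        · simp only [hF, indicator_of_mem hz]; gcongr; exact min_le_right _ _
        · simp [hF, indicator_of_notMem hz]
    exact ENNReal.rpow_ne_top_of_nonneg (by norm_num) this
  have hle : ∀ n, l2 (F n) ≤ C := by
    intro n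
    by_cases h0 : l2 (F n) = 0
    · rw [h0]; exact zero_le
    · have h1 : l2 (F n) * l2 (F n) ≤ C * l2 (F n) := by
        rw [← sq, l2_sq]
        refine le_trans (lintegral_mono fun z ↦ ?_) (h _ (hFm n))
        rw [sq]; gcongr; exact hFH n z
      exact (ENNReal.mul_le_mul_iff_left h0 (hFn n)).1 h1
  have hmono : Monotone fun n z ↦ F n z ^ 2 := by
    intro m n hmn z
    refine pow_le_pow_left' ?_ 2
    have hmn' : (m : ℝ) ≤ n := by exact_mod_cast hmn
    refine (indicator_le_indicator_of_subset (Metric.closedBall_subset_closedBall hmn')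
      (fun _ ↦ zero_le) z).trans ?_
    refine indicator_le_indicator ?_
    gcongr
  have hsup : ∀ z, ⨆ n, F n z ^ 2 = H z ^ 2 := by
    intro z
    refine iSup_eq_of_tendsto (fun m n hmn ↦ hmono hmn z) ?_
    have : Tendsto (fun n : ℕ ↦ min (H z) n) atTop (𝓝 (min (H z) ∞)) :=
      tendsto_const_nhds.min ENNReal.tendsto_nat_nhds_top
    rw [min_eq_left le_top] at this
    have h2 : Tendsto (fun n ↦ F n z) atTop (𝓝 (H z)) := by
      refine this.congr' ?_
      obtain ⟨N, hN⟩ := exists_nat_ge ‖z‖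
      filter_upwards [eventually_ge_atTop N] with n hn
      have hz : z ∈ Metric.closedBall (0 : ℝ × ℝ) n := by
        rw [mem_closedBall_zero_iff]; exact hN.trans (by exact_mod_cast hn)
      simp [hF, indicator_of_mem hz]
    exact ENNReal.Tendsto.pow h2
  refine le_of_sq_le_sq ?_
  rw [l2_sq]
  simp only [← hsup]
  rw [lintegral_iSup (fun n ↦ (hFm n).pow_const 2) hmono]
  refine iSup_le fun n ↦ ?_
  rw [← l2_sq]
  exact pow_le_pow_left' (hle n) 2

/-- The convolution of functions with values in `[0, ∞]`. -/
def lconv (f g : ℝ × ℝ → ℝ≥0∞) (z : ℝ × ℝ) : ℝ≥0∞ := ∫⁻ z₁, f (z - z₁) * g z₁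

theorem measurable_lconv {f g : ℝ × ℝ → ℝ≥0∞} (hf : Measurable f) (hg : Measurable g) :
    Measurable (lconv f g) := by
  unfold lconv
  exact Measurable.lintegral_prod_right' (f := fun w : (ℝ × ℝ) × (ℝ × ℝ) ↦ f (w.1 - w.2) * g w.2)
    (by fun_prop)

theorem ae_comp_sub_left {P : ℝ × ℝ → Prop} (h : ∀ᵐ z, P z) (z : ℝ × ℝ) : ∀ᵐ z₁, P (z - z₁) :=
  (Measure.measurePreserving_sub_left volume z).quasiMeasurePreserving.ae h

theorem lconv_congr_ae {f f' g g' : ℝ × ℝ → ℝ≥0∞} (hf : f =ᵐ[volume] f') (hg : g =ᵐ[volume] g') :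
    lconv f g = lconv f' g' := by
  funext z
  refine lintegral_congr_ae ?_
  filter_upwards [ae_comp_sub_left hf z, hg] with z₁ h1 h2
  simp only [h1, h2]

/-- The weight of the Bourgain space of the dispersion `p` with exponents `s` and `b`. -/
def bourgainWeight (p : ℝ → ℝ) (s b : ℝ) (z : ℝ × ℝ) : ℝ≥0∞ := bw s z.2 * modWeight p b z

@[fun_prop]
theorem measurable_bourgainWeight {p : ℝ → ℝ} (hp : Measurable p) (s b : ℝ) :
    Measurable (bourgainWeight p s b) := by
  unfold bourgainWeight; fun_prop

theorem bourgainWeight_neg_mul (p : ℝ → ℝ) (s b : ℝ) (z : ℝ × ℝ) (c : ℝ≥0∞) :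
    bw (-s) z.2 * modWeight p (-b) z * (bourgainWeight p s b z * c) = c := by
  rw [bourgainWeight, modWeight, modWeight]
  calc _ = (bw (-s) z.2 * bw s z.2) * (bw (-b) (z.1 + p z.2) * bw b (z.1 + p z.2)) * c := by ring
    _ = _ := by rw [bw_neg_mul, bw_neg_mul, one_mul, one_mul]

/-- The estimate `X^{s,b} × Y^{s',b'} → X^{s,-a}` of the product, for absolute values of the
Fourier transforms. -/
theorem exists_l2_schrodinger_product_le {ν s s' a b b' : ℝ} (hν : |ν| ≠ 1) (hs : 0 ≤ s)
    (hs' : -1 / 2 ≤ s') (hd : s - s' ≤ 1) (ha : 0 ≤ a) (ha' : a ≤ 1 / 2) (hda : s - s' ≤ 2 * a)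
    (hb : 1 / 2 < b) (hb' : 1 / 2 < b') :
    ∃ C : ℝ≥0, ∀ f g : ℝ × ℝ → ℝ≥0∞, AEMeasurable f → AEMeasurable g →
      l2 (fun z ↦ bourgainWeight schrodingerPhase s (-a) z * lconv f g z) ≤
        C * (l2 (fun z ↦ bourgainWeight schrodingerPhase s b z * f z) *
          l2 (fun z ↦ bourgainWeight (benjaminOnoPhase ν) s' b' z * g z)) := by
  obtain ⟨C, hC⟩ := isTriBounded_schrodinger hν hs hs' hd ha ha' hda hb hb'
  refine ⟨C, fun f g hf hg ↦ ?_⟩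
  wlog hm : Measurable f ∧ Measurable g generalizing f g
  · have := this (hf.mk f) (hg.mk g) hf.measurable_mk.aemeasurable hg.measurable_mk.aemeasurable
      ⟨hf.measurable_mk, hg.measurable_mk⟩
    rw [lconv_congr_ae hf.ae_eq_mk hg.ae_eq_mk]
    refine this.trans (le_of_eq ?_)
    congr 2
    · exact l2_congr_ae (hf.ae_eq_mk.mono fun z hz ↦ by simp only [hz])
    · exact l2_congr_ae (hg.ae_eq_mk.mono fun z hz ↦ by simp only [hz])
  obtain ⟨hf, hg⟩ := hm
  have hlm := measurable_lconv hf hg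
  refine l2_le_of_forall_lintegral_mul_le (by fun_prop) fun k hk ↦ ?_
  refine le_trans (le_of_eq ?_) ((hC k (fun z ↦ bourgainWeight schrodingerPhase s b z * f z)
    (fun z ↦ bourgainWeight (benjaminOnoPhase ν) s' b' z * g z) hk (by fun_prop)
    (by fun_prop)).trans (le_of_eq (by ring)))
  refine lintegral_congr fun z ↦ ?_
  have hsub : lconv f g z = ∫⁻ z₁, f z₁ * g (z - z₁) := by
    rw [lconv, ← lintegral_sub_left_eq_self _ z]
    simp
  rw [hsub, ← lintegral_const_mul _ (by fun_prop), ← lintegral_const_mul _ (by fun_prop)]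
  refine lintegral_congr fun z₁ ↦ ?_
  symm
  calc _ = k z * (bw s z.2 * modWeight schrodingerPhase (-a) z *
        ((bw (-s) z₁.2 * modWeight schrodingerPhase (-b) z₁ *
          (bourgainWeight schrodingerPhase s b z₁ * f z₁)) *
        (bw (-s') (z - z₁).2 * modWeight (benjaminOnoPhase ν) (-b') (z - z₁) *
          (bourgainWeight (benjaminOnoPhase ν) s' b' (z - z₁) * g (z - z₁))))) := by
        rw [Prod.snd_sub]; ring
    _ = _ := by rw [bourgainWeight_neg_mul, bourgainWeight_neg_mul, bourgainWeight]

/-- The estimate `X^{s,b} × X^{s,b} → Y^{s',-a}` of `∂ₓ(u₁ ū₂)`, for absolute values of the Fourier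
transforms. -/
theorem exists_l2_benjaminOno_product_le {ν s s' a b : ℝ} (hν : |ν| ≠ 1) (hs : 0 ≤ s)
    (hs' : s' ≤ 2 * s - 1 / 2) (hb : 1 / 2 < b) (hdb : 1 - (s - s') ≤ 2 * b) (ha : 1 / 4 < a)
    (hab : a ≤ b) (hda : 1 / 2 - (s - s') ≤ 2 * a) :
    ∃ C : ℝ≥0, ∀ f g : ℝ × ℝ → ℝ≥0∞, AEMeasurable f → AEMeasurable g →
      l2 (fun z ↦ bourgainWeight (benjaminOnoPhase ν) s' (-a) z *
          (ENNReal.ofReal |z.2| * lconv f (fun z ↦ g (-z)) z)) ≤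
        C * (l2 (fun z ↦ bourgainWeight schrodingerPhase s b z * f z) *
          l2 (fun z ↦ bourgainWeight schrodingerPhase s b z * g z)) := by
  obtain ⟨C, hC⟩ := isTriBounded_benjaminOno hν hs hs' hb hdb ha hab hda
  refine ⟨C, fun f g hf hg ↦ ?_⟩
  wlog hm : Measurable f ∧ Measurable g generalizing f g
  · have := this (hf.mk f) (hg.mk g) hf.measurable_mk.aemeasurable hg.measurable_mk.aemeasurable
      ⟨hf.measurable_mk, hg.measurable_mk⟩
    have hneg : (fun z ↦ g (-z)) =ᵐ[volume] fun z ↦ hg.mk g (-z) :=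
      (Measure.measurePreserving_neg volume).quasiMeasurePreserving.ae hg.ae_eq_mk
    rw [lconv_congr_ae hf.ae_eq_mk hneg]
    refine this.trans (le_of_eq ?_)
    congr 2
    · exact l2_congr_ae (hf.ae_eq_mk.mono fun z hz ↦ by simp only [hz])
    · exact l2_congr_ae (hg.ae_eq_mk.mono fun z hz ↦ by simp only [hz])
  obtain ⟨hf, hg⟩ := hm
  have hlm := measurable_lconv hf (hg.comp measurable_neg)
  have hlm' : Measurable (lconv f fun z ↦ g (-z)) := hlm
  refine l2_le_of_forall_lintegral_mul_le (by fun_prop) fun k hk ↦ ?_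
  refine le_trans (le_of_eq ?_) ((hC (fun z ↦ bourgainWeight schrodingerPhase s b z * f z)
    (fun z ↦ bourgainWeight schrodingerPhase s b z * g z) k (by fun_prop) (by fun_prop)
    hk).trans (le_of_eq (by ring)))
  have hsub : ∀ z, lconv f (fun z ↦ g (-z)) z = ∫⁻ z₁, f (z + z₁) * g z₁ := by
    intro z
    rw [lconv, ← lintegral_neg_eq_self]
    simp
  have hwm : Measurable fun z : ℝ × ℝ ↦ k z * (bourgainWeight (benjaminOnoPhase ν) s' (-a) z *
      ENNReal.ofReal |z.2|) := by fun_prop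
  calc ∫⁻ z, k z * (bourgainWeight (benjaminOnoPhase ν) s' (-a) z *
          (ENNReal.ofReal |z.2| * lconv f (fun z ↦ g (-z)) z))
      = ∫⁻ z, ∫⁻ z₁, k z * (bourgainWeight (benjaminOnoPhase ν) s' (-a) z *
          ENNReal.ofReal |z.2|) * (f (z + z₁) * g z₁) := by
        refine lintegral_congr fun z ↦ ?_
        rw [lintegral_const_mul _ (by fun_prop), hsub]; ring
    _ = ∫⁻ z₁, ∫⁻ z, k z * (bourgainWeight (benjaminOnoPhase ν) s' (-a) z *
          ENNReal.ofReal |z.2|) * (f (z + z₁) * g z₁) :=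
        lintegral_lintegral_swap (by fun_prop)
    _ = ∫⁻ z₁, ∫⁻ z, k (z - z₁) * (bourgainWeight (benjaminOnoPhase ν) s' (-a) (z - z₁) *
          ENNReal.ofReal |(z - z₁).2|) * (f z * g z₁) := by
        refine lintegral_congr fun z₁ ↦ ?_
        rw [← lintegral_sub_right_eq_self _ z₁]
        simp
    _ = ∫⁻ z, ∫⁻ z₁, k (z - z₁) * (bourgainWeight (benjaminOnoPhase ν) s' (-a) (z - z₁) *
          ENNReal.ofReal |(z - z₁).2|) * (f z * g z₁) :=
        lintegral_lintegral_swap (by fun_prop)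
    _ = _ := by
        refine lintegral_congr fun z ↦ lintegral_congr fun z₁ ↦ ?_
        symm
        calc _ = k (z - z₁) * ((bw s' (z - z₁).2 * modWeight (benjaminOnoPhase ν) (-a) (z - z₁)) *
              ENNReal.ofReal |(z - z₁).2|) *
              ((bw (-s) z.2 * modWeight schrodingerPhase (-b) z *
                (bourgainWeight schrodingerPhase s b z * f z)) *
              (bw (-s) z₁.2 * modWeight schrodingerPhase (-b) z₁ *
                (bourgainWeight schrodingerPhase s b z₁ * g z₁))) := by
              rw [Prod.snd_sub]; ring
          _ = _ := by rw [bourgainWeight_neg_mul, bourgainWeight_neg_mul, bourgainWeight]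

/-! ### The truncated Duhamel operator in one variable -/

/-- A smooth bump function in time that is `1` on `[-1, 1]`. -/
def timeBump : ContDiffBump (0 : ℝ) := ⟨1, 2, one_pos, one_lt_two⟩

/-- A Schwartz function of time that is `1` on `[-1, 1]`. -/
def cutoff : 𝓢(ℝ, ℂ) :=
  HasCompactSupport.toSchwartzMap (f := fun t ↦ ((timeBump t : ℝ) : ℂ))
    (timeBump.hasCompactSupport.comp_left Complex.ofReal_zero)
    (Complex.ofRealCLM.contDiff.comp timeBump.contDiff)

theorem cutoff_eq_one {t : ℝ} (ht : |t| ≤ 1) : cutoff t = 1 := by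
  have h : t ∈ Metric.closedBall (0 : ℝ) timeBump.rIn := by
    rw [mem_closedBall_zero_iff, Real.norm_eq_abs]; exact ht
  change ((timeBump t : ℝ) : ℂ) = 1
  rw [timeBump.one_of_mem_closedBall h, Complex.ofReal_one]

/-- The Fourier transform of the cutoff. -/
def cutoffHat : 𝓢(ℝ, ℂ) := 𝓕 cutoff

theorem integral_exp_mul_cutoffHat (t : ℝ) :
    ∫ x : ℝ, Complex.exp (2 * Real.pi * Complex.I * t * x) * cutoffHat x = cutoff t := by
  have h : (𝓕⁻ (𝓕 cutoff)) t = cutoff t := by rw [FourierTransform.fourierInv_fourier_eq]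
  rw [← h, SchwartzMap.fourierInv_coe, Real.fourierInv_eq']
  refine integral_congr_ae (Eventually.of_forall fun x ↦ ?_)
  simp only [smul_eq_mul, cutoffHat]
  congr 2
  simp; ring

theorem exists_schwartz_le (f : 𝓢(ℝ, ℂ)) : ∃ C : ℝ, 0 ≤ C ∧ ∀ x, ‖f x‖ ≤
    C * bracket x ^ (-2 : ℝ) := by
  obtain ⟨C₀, h₀, hC₀⟩ := f.decay 0 0
  obtain ⟨C₂, h₂, hC₂⟩ := f.decay 2 0
  refine ⟨C₀ + C₂, by positivity, fun x ↦ ?_⟩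
  have a := hC₀ x
  have b := hC₂ x
  simp only [norm_iteratedFDeriv_zero, pow_zero, one_mul, Real.norm_eq_abs, sq_abs] at a b
  rw [Real.rpow_neg (bracket_pos x).le, Real.rpow_two, ← div_eq_mul_inv,
    le_div_iff₀ (pow_pos (bracket_pos x) 2), bracket, Real.sq_sqrt (by positivity)]
  nlinarith

/-- The factor `|y|` on the right cancels the denominator of `truncKernel`. -/
theorem exists_cutoffHat_sub_le : ∃ C : ℝ, 0 ≤ C ∧ ∀ x y : ℝ,
    ‖cutoffHat (x - y) - cutoffHat x‖ ≤
      C * (bracket (x - y) ^ (-2 : ℝ) + bracket x ^ (-2 : ℝ)) * (|y| * bracket y ^ (-1 : ℝ)) := by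
  obtain ⟨C, h0, hC⟩ := exists_schwartz_le cutoffHat
  obtain ⟨D, hD0, hD⟩ := exists_schwartz_le (SchwartzMap.derivCLM ℂ ℂ cutoffHat)
  refine ⟨2 * C + 18 * D, by positivity, fun x y ↦ ?_⟩
  have p1 := bracket_rpow_nonneg (-2) (x - y)
  have p2 := bracket_rpow_nonneg (-2) x
  have hb := bracket_pos y
  rcases le_or_gt 1 |y| with hy | hy
  · have h1 : 1 ≤ 2 * (|y| * bracket y ^ (-1 : ℝ)) := by
      rw [Real.rpow_neg_one, ← mul_assoc, ← div_eq_mul_inv, le_div_iff₀ hb, one_mul]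
      exact bracket_le_two_mul_abs hy
    calc _ ≤ C * bracket (x - y) ^ (-2 : ℝ) + C * bracket x ^ (-2 : ℝ) :=
          (norm_sub_le _ _).trans (add_le_add (hC _) (hC _))
      _ = C * (bracket (x - y) ^ (-2 : ℝ) + bracket x ^ (-2 : ℝ)) * 1 := by ring
      _ ≤ C * (bracket (x - y) ^ (-2 : ℝ) + bracket x ^ (-2 : ℝ)) *
          (2 * (|y| * bracket y ^ (-1 : ℝ))) := by gcongr
      _ = 2 * C * (bracket (x - y) ^ (-2 : ℝ) + bracket x ^ (-2 : ℝ)) *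
          (|y| * bracket y ^ (-1 : ℝ)) := by ring
      _ ≤ _ := by gcongr; linarith
  · -- mean value theorem on the segment between `x` and `x - y`
    have hb2 : bracket y ≤ 2 := (bracket_le_one_add_abs y).trans (by linarith)
    have h1 : |y| ≤ 2 * (|y| * bracket y ^ (-1 : ℝ)) := by
      rw [Real.rpow_neg_one, ← mul_assoc, ← div_eq_mul_inv, le_div_iff₀ hb]
      nlinarith [abs_nonneg y]
    have hmv : ‖cutoffHat (x - y) - cutoffHat x‖ ≤
        9 * D * bracket x ^ (-2 : ℝ) * ‖(x - y) - x‖ := by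
      refine (convex_closedBall x |y|).norm_image_sub_le_of_norm_hasDerivWithin_le (𝕜 := ℝ)
        (f' := deriv cutoffHat)
        (fun w _ ↦ (cutoffHat.differentiableAt).hasDerivAt.hasDerivWithinAt) (fun w hw ↦ ?_)
        (Metric.mem_closedBall_self (abs_nonneg y)) (by simp [Metric.mem_closedBall])
      rw [← SchwartzMap.derivCLM_apply ℂ]
      refine (hD w).trans ?_
      have hwx : bracket x ≤ 3 * bracket w := by
        have e := bracket_add_le w (x - w)
        rw [add_sub_cancel] at e
        have hw' : |x - w| ≤ 1 := by
          rw [Metric.mem_closedBall, dist_comm, Real.dist_eq] at hw; linarith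
        linarith [bracket_le_one_add_abs (x - w), one_le_bracket w]
      have h9 : bracket w ^ (-2 : ℝ) ≤ 9 * bracket x ^ (-2 : ℝ) := by
        rw [Real.rpow_neg (bracket_pos _).le, Real.rpow_neg (bracket_pos _).le, Real.rpow_two,
          Real.rpow_two, ← div_eq_mul_inv, le_div_iff₀ (pow_pos (bracket_pos x) 2),
          inv_mul_le_iff₀ (pow_pos (bracket_pos w) 2)]
        nlinarith [bracket_pos x, bracket_pos w]
      nlinarith
    rw [sub_sub_cancel_left, norm_neg, Real.norm_eq_abs] at hmv
    calc _ ≤ 9 * D * bracket x ^ (-2 : ℝ) * |y| := hmv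
      _ ≤ 9 * D * bracket x ^ (-2 : ℝ) * (2 * (|y| * bracket y ^ (-1 : ℝ))) := by gcongr
      _ = 18 * D * bracket x ^ (-2 : ℝ) * (|y| * bracket y ^ (-1 : ℝ)) := by ring
      _ ≤ _ := by gcongr <;> linarith

/-- The Fourier transform in `t`, at the frequency `x`, of the function
`χ(t / δ) ∫₀ᵗ exp (2πi r y) dr`. For `y = 0` this formula gives `0` by division by zero, which does
not matter for integrals in `y`. -/
def truncKernel (δ x y : ℝ) : ℂ :=
  δ * (cutoffHat (δ * (x - y)) - cutoffHat (δ * x)) / (2 * Real.pi * Complex.I * y)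

@[fun_prop]
theorem measurable_truncKernel (δ : ℝ) :
    Measurable fun w : ℝ × ℝ ↦ truncKernel δ w.1 w.2 := by
  unfold truncKernel
  have := cutoffHat.continuous.measurable
  fun_prop

theorem measurable_truncKernel_right (δ x : ℝ) : Measurable (truncKernel δ x) := by
  unfold truncKernel
  have := cutoffHat.continuous.measurable
  fun_prop

theorem exists_truncKernel_le : ∃ C : ℝ, 0 ≤ C ∧ ∀ δ x y : ℝ, 0 < δ →
    ‖truncKernel δ x y‖ ≤ C * δ ^ 2 * ((bracket (δ * x - δ * y) ^ (-2 : ℝ) +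
      bracket (δ * x) ^ (-2 : ℝ)) * bracket (δ * y) ^ (-1 : ℝ)) := by
  obtain ⟨C, h0, hC⟩ := exists_cutoffHat_sub_le
  refine ⟨C, h0, fun δ x y hδ ↦ ?_⟩
  have p1 := bracket_rpow_nonneg (-2) (δ * x - δ * y)
  have p2 := bracket_rpow_nonneg (-2) (δ * x)
  have p3 := bracket_rpow_nonneg (-1) (δ * y)
  rcases eq_or_ne y 0 with rfl | hy
  · rw [show truncKernel δ x 0 = 0 by simp [truncKernel], norm_zero]; positivity
  have hn : ‖(2 * Real.pi * Complex.I * y : ℂ)‖ = 2 * Real.pi * |y| := by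
    simp [abs_of_pos Real.pi_pos]
  have hpos : 0 < 2 * Real.pi * |y| := mul_pos Real.two_pi_pos (abs_pos.2 hy)
  rw [truncKernel, norm_div, norm_mul, hn, Complex.norm_real, Real.norm_of_nonneg hδ.le, mul_sub,
    div_le_iff₀ hpos]
  have hk := hC (δ * x) (δ * y)
  rw [abs_mul, abs_of_pos hδ] at hk
  set E := C * δ ^ 2 * ((bracket (δ * x - δ * y) ^ (-2 : ℝ) +
      bracket (δ * x) ^ (-2 : ℝ)) * bracket (δ * y) ^ (-1 : ℝ)) with hE
  have hE0 : 0 ≤ E := by positivity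
  calc _ ≤ δ * (C * (bracket (δ * x - δ * y) ^ (-2 : ℝ) + bracket (δ * x) ^ (-2 : ℝ)) *
        (δ * |y| * bracket (δ * y) ^ (-1 : ℝ))) := by gcongr
    _ = E * |y| := by rw [hE]; ring
    _ ≤ E * (2 * Real.pi * |y|) := by
        gcongr; nlinarith [abs_nonneg y, Real.pi_gt_three]

theorem truncKernel_integral {δ y t : ℝ} (hδ : 0 < δ) (hy : y ≠ 0) :
    ∫ x : ℝ, Complex.exp (2 * Real.pi * Complex.I * t * x) * truncKernel δ x y =
      cutoff (t / δ) * ∫ r in (0 : ℝ)..t, Complex.exp (2 * Real.pi * Complex.I * y * r) := by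
  have hI : (2 * Real.pi * Complex.I * y : ℂ) ≠ 0 := by
    simp [Real.pi_ne_zero, hy]
  have hδ' : (δ : ℂ) ≠ 0 := by exact_mod_cast hδ.ne'
  have scale : ∀ c : ℝ, ∫ x : ℝ, δ * (Complex.exp (2 * Real.pi * Complex.I * t * x) *
      cutoffHat (δ * (x - c))) =
        Complex.exp (2 * Real.pi * Complex.I * t * c) * cutoff (t / δ) := by
    intro c
    rw [← integral_add_right_eq_self _ c]
    have := Measure.integral_comp_mul_left (fun x : ℝ ↦ Complex.exp (2 * Real.pi * Complex.I *
      (t / δ : ℝ) * x) * cutoffHat x) δ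
    rw [integral_exp_mul_cutoffHat, abs_of_pos (inv_pos.2 hδ)] at this
    calc _ = ∫ x : ℝ, Complex.exp (2 * Real.pi * Complex.I * t * c) * δ *
          (Complex.exp (2 * Real.pi * Complex.I * (t / δ : ℝ) * (δ * x : ℝ)) *
            cutoffHat (δ * x)) := by
          refine integral_congr_ae (Eventually.of_forall fun x ↦ ?_)
          simp only [add_sub_cancel_right]
          have : Complex.exp (2 * Real.pi * Complex.I * t * ((x + c : ℝ) : ℂ)) =
              Complex.exp (2 * Real.pi * Complex.I * t * c) *
              Complex.exp (2 * Real.pi * Complex.I * (t / δ : ℝ) * (δ * x : ℝ)) := by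
            rw [← Complex.exp_add]; congr 1; push_cast; field_simp; ring
          rw [this]; ring
      _ = _ := by
          rw [integral_const_mul, this, Complex.real_smul]; push_cast; field_simp
  have hint : ∀ c : ℝ, Integrable fun x : ℝ ↦ δ * (Complex.exp (2 * Real.pi * Complex.I * t * x) *
      cutoffHat (δ * (x - c))) := by
    intro c
    refine Integrable.const_mul ?_ _
    have h1 : Integrable fun x : ℝ ↦ cutoffHat (δ * (x - c)) :=
      (cutoffHat.integrable.comp_mul_left' hδ.ne').comp_sub_right c
    refine h1.bdd_mul (c := 1) (by fun_prop) (Eventually.of_forall fun x ↦ ?_)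
    rw [show (2 * Real.pi * Complex.I * t * x : ℂ) = ((2 * Real.pi * t * x : ℝ) : ℂ) * Complex.I by
      push_cast; ring, Complex.norm_exp_ofReal_mul_I]
  have h0 := scale 0
  have hi0 := hint 0
  simp only [sub_zero, Complex.ofReal_zero, mul_zero, Complex.exp_zero, one_mul] at h0 hi0
  calc _ = ∫ x : ℝ, (δ * (Complex.exp (2 * Real.pi * Complex.I * t * x) *
        cutoffHat (δ * (x - y))) - δ * (Complex.exp (2 * Real.pi * Complex.I * t * x) *
        cutoffHat (δ * x))) / (2 * Real.pi * Complex.I * y) := by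
        refine integral_congr_ae (Eventually.of_forall fun x ↦ ?_)
        simp only [truncKernel]; ring
    _ = (Complex.exp (2 * Real.pi * Complex.I * t * y) * cutoff (t / δ) - cutoff (t / δ)) /
        (2 * Real.pi * Complex.I * y) := by
        rw [integral_div, integral_sub (hint y) hi0, scale, h0]
    _ = _ := by
        rw [integral_exp_mul_complex hI]
        simp only [Complex.ofReal_zero, mul_zero, Complex.exp_zero]
        rw [show (2 * Real.pi * Complex.I * t * y : ℂ) = 2 * Real.pi * Complex.I * y * t by ring]
        ring

/-! ### Bounds of the truncated Duhamel operator in one variable -/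

theorem l2_add_le {α : Type*} [MeasureSpace α] {f g : α → ℝ≥0∞} (hf : AEMeasurable f)
    (hg : AEMeasurable g) : l2 (fun x ↦ f x + g x) ≤ l2 f + l2 g := by
  have := ENNReal.lintegral_Lp_add_le hf hg (p := 2) (by norm_num)
  simpa only [l2, ENNReal.rpow_two, Pi.add_apply] using this

theorem l2_const_mul {α : Type*} [MeasureSpace α] {c : ℝ≥0∞} (hc : c ≠ ∞) (f : α → ℝ≥0∞) :
    l2 (fun x ↦ c * f x) = c * l2 f := by
  simp only [l2, mul_pow]
  rw [lintegral_const_mul' _ _ (by finiteness), ENNReal.mul_rpow_of_nonneg _ _ (by norm_num),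
    ← ENNReal.rpow_two, ← ENNReal.rpow_mul]
  norm_num

theorem lintegral_mul_le_l2_mul_l2 {α : Type*} [MeasureSpace α] {f g : α → ℝ≥0∞}
    (hf : AEMeasurable f) (hg : AEMeasurable g) : ∫⁻ x, f x * g x ≤ l2 f * l2 g := by
  refine le_of_sq_le_sq ?_
  rw [mul_pow, l2_sq, l2_sq]
  exact sq_lintegral_mul_le _ hf hg

/-- Young's inequality for the convolution of an integrable and a square integrable function. -/
theorem l2_convolution_le {w φ : ℝ → ℝ≥0∞} (hw : Measurable w) (hφ : Measurable φ) :
    l2 (fun x ↦ ∫⁻ y, w (x - y) * φ y) ≤ (∫⁻ x, w x) * l2 φ := by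
  refine le_of_sq_le_sq ?_
  rw [mul_pow, l2_sq, l2_sq]
  have hs : ∀ t : ℝ≥0∞, (t ^ (1 / 2 : ℝ)) ^ 2 = t := fun t ↦ by
    rw [← ENNReal.rpow_two, ← ENNReal.rpow_mul]; norm_num
  have hx : ∀ x, (∫⁻ y, w (x - y) * φ y) ^ 2 ≤ (∫⁻ x, w x) * ∫⁻ y, w (x - y) * φ y ^ 2 := by
    intro x
    have := sq_lintegral_mul_le volume (f := fun y ↦ w (x - y) ^ (1 / 2 : ℝ))
      (g := fun y ↦ w (x - y) ^ (1 / 2 : ℝ) * φ y) (by fun_prop) (by fun_prop)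
    simp only [mul_pow, hs, ← mul_assoc, ← sq] at this
    rwa [lintegral_sub_left_eq_self] at this
  calc _ ≤ ∫⁻ x, (∫⁻ x, w x) * ∫⁻ y, w (x - y) * φ y ^ 2 := lintegral_mono hx
    _ = (∫⁻ x, w x) * ∫⁻ x, ∫⁻ y, w (x - y) * φ y ^ 2 := by
        refine lintegral_const_mul _ ?_
        exact Measurable.lintegral_prod_right' (f := fun v : ℝ × ℝ ↦ w (v.1 - v.2) * φ v.2 ^ 2)
          (by fun_prop)
    _ = (∫⁻ x, w x) * ∫⁻ y, ∫⁻ x, w (x - y) * φ y ^ 2 := by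
        rw [lintegral_lintegral_swap (by fun_prop)]
    _ = (∫⁻ x, w x) * ∫⁻ y, (∫⁻ x, w x) * φ y ^ 2 := by
        congr 1
        refine lintegral_congr fun y ↦ ?_
        rw [lintegral_mul_const _ (by fun_prop), lintegral_sub_right_eq_self]
    _ = _ := by rw [lintegral_const_mul _ (by fun_prop)]; ring

theorem rpow_bracket_le_scaled {δ κ x : ℝ} (hδ : 0 < δ) (hδ1 : δ ≤ 1) (hκ : 0 ≤ κ) :
    bracket x ^ κ ≤ δ ^ (-κ) * bracket (δ * x) ^ κ := by
  have h : bracket x ≤ δ⁻¹ * bracket (δ * x) := by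
    refine bracket_le_mul (one_le_inv_iff₀.2 ⟨hδ, hδ1⟩) ?_
    rw [abs_mul, abs_of_pos hδ, inv_mul_cancel_left₀ hδ.ne']
  calc _ ≤ (δ⁻¹ * bracket (δ * x)) ^ κ := Real.rpow_le_rpow (bracket_pos x).le h hκ
    _ = _ := by
      rw [Real.mul_rpow (by positivity) (bracket_pos _).le, Real.inv_rpow hδ.le,
        Real.rpow_neg hδ.le]

/-- The weighted kernel is bounded by a convolution kernel and a kernel of rank one, in the
variables scaled by `δ`. -/
theorem exists_weighted_truncKernel_le {a b : ℝ} (ha : 0 ≤ a) (hb : 0 ≤ b) (hab : a + b ≤ 1) :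
    ∃ C : ℝ≥0, ∀ δ x y : ℝ, 0 < δ → δ ≤ 1 →
      bw b x * ‖truncKernel δ x y‖ₑ * bw a y ≤ C * ENNReal.ofReal (δ ^ (2 - a - b)) *
        (bw (b - 2) (δ * x - δ * y) + bw (b - 2) (δ * x) * bw (a - 1) (δ * y)) := by
  obtain ⟨C, h0, hC⟩ := exists_truncKernel_le
  refine ⟨(C * 2 ^ b).toNNReal, fun δ x y hδ hδ1 ↦ ?_⟩
  have e1 := rpow_bracket_le_scaled (x := x) hδ hδ1 hb
  have e2 := rpow_bracket_le_scaled (x := y) hδ hδ1 ha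
  have e3 := hC δ x y hδ
  set X := bracket (δ * x) with hX
  set Y := bracket (δ * y) with hY
  set Z := bracket (δ * x - δ * y) with hZ
  have pX : 0 < X := bracket_pos _
  have pY : 0 < Y := bracket_pos _
  have pZ : 0 < Z := bracket_pos _
  have hY1 : 1 ≤ Y := one_le_bracket _
  have px := bracket_pos x
  have py := bracket_pos y
  have hXYZ : X ^ b ≤ 2 ^ b * (Y ^ b * Z ^ b) := by
    rw [← Real.mul_rpow pY.le pZ.le, ← Real.mul_rpow (by norm_num) (by positivity)]
    exact Real.rpow_le_rpow pX.le (bracket_le_two_mul _ _) hb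
  have hreal : bracket x ^ b * ‖truncKernel δ x y‖ * bracket y ^ a ≤
      C * 2 ^ b * δ ^ (2 - a - b) * (Z ^ (b - 2) + X ^ (b - 2) * Y ^ (a - 1)) := by
    have hδe : δ ^ (-b) * δ ^ 2 * δ ^ (-a) = δ ^ (2 - a - b) := by
      rw [← Real.rpow_two, ← Real.rpow_add hδ, ← Real.rpow_add hδ]; congr 1; ring
    have m1 : X ^ b * Z ^ (-2 : ℝ) * (Y ^ (-1 : ℝ) * Y ^ a) ≤ 2 ^ b * Z ^ (b - 2) := by
      calc _ ≤ 2 ^ b * (Y ^ b * Z ^ b) * Z ^ (-2 : ℝ) * (Y ^ (-1 : ℝ) * Y ^ a) := by gcongr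
        _ = 2 ^ b * (Z ^ b * Z ^ (-2 : ℝ)) * (Y ^ b * (Y ^ (-1 : ℝ) * Y ^ a)) := by ring
        _ = 2 ^ b * Z ^ (b - 2) * Y ^ (b + (-1 + a)) := by
            rw [← Real.rpow_add pZ, ← Real.rpow_add pY, ← Real.rpow_add pY, ← sub_eq_add_neg]
        _ ≤ 2 ^ b * Z ^ (b - 2) * 1 := by
            gcongr; exact Real.rpow_le_one_of_one_le_of_nonpos hY1 (by linarith)
        _ = _ := mul_one _
    have m2 : X ^ b * X ^ (-2 : ℝ) * (Y ^ (-1 : ℝ) * Y ^ a) ≤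
        2 ^ b * (X ^ (b - 2) * Y ^ (a - 1)) := by
      rw [← Real.rpow_add pX, ← Real.rpow_add pY, ← sub_eq_add_neg, neg_add_eq_sub]
      exact le_mul_of_one_le_left (by positivity) (Real.one_le_rpow (by norm_num) hb)
    calc _ ≤ (δ ^ (-b) * X ^ b) * (C * δ ^ 2 * ((Z ^ (-2 : ℝ) + X ^ (-2 : ℝ)) * Y ^ (-1 : ℝ))) *
          (δ ^ (-a) * Y ^ a) := by gcongr
      _ = C * (δ ^ (-b) * δ ^ 2 * δ ^ (-a)) * (X ^ b * Z ^ (-2 : ℝ) * (Y ^ (-1 : ℝ) * Y ^ a) +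
          X ^ b * X ^ (-2 : ℝ) * (Y ^ (-1 : ℝ) * Y ^ a)) := by ring
      _ ≤ C * (δ ^ (-b) * δ ^ 2 * δ ^ (-a)) *
          (2 ^ b * Z ^ (b - 2) + 2 ^ b * (X ^ (b - 2) * Y ^ (a - 1))) := by gcongr
      _ = _ := by rw [hδe]; ring
  have := ENNReal.ofReal_le_ofReal hreal
  rw [ENNReal.ofReal_mul (by positivity), ENNReal.ofReal_mul (by positivity),
    ENNReal.ofReal_mul (by positivity), ENNReal.ofReal_add (by positivity) (by positivity),
    ENNReal.ofReal_mul (p := X ^ (b - 2)) (by positivity), ofReal_norm,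
    ENNReal.ofReal_mul (p := C * 2 ^ b) (by positivity)] at this
  exact this

theorem lintegral_bw_scaled {κ δ : ℝ} (hδ : 0 < δ) :
    ∫⁻ x, bw κ (δ * x) = ENNReal.ofReal δ⁻¹ * ∫⁻ x, bw κ x := by
  rw [← lintegral_comp_mul_add_le (measurable_bw κ) hδ.ne' 0, ← mul_assoc, abs_of_pos hδ,
    ← ENNReal.ofReal_mul (by positivity), inv_mul_cancel₀ hδ.ne']
  simp

/-- The truncated Duhamel operator maps `H^{-a}` to `H^b` in one variable, and gains a power of the
length of the time interval. -/
theorem exists_l2_truncKernel_le {a b : ℝ} (ha : 0 ≤ a) (ha' : a < 1 / 2) (hb : 0 ≤ b)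
    (hb' : b < 1) (hab : a + b ≤ 1) :
    ∃ C : ℝ≥0, ∀ δ : ℝ, 0 < δ → δ ≤ 1 → ∀ φ : ℝ → ℝ≥0∞, Measurable φ →
      l2 (fun x ↦ bw b x * ∫⁻ y, ‖truncKernel δ x y‖ₑ * φ y) ≤
        C * ENNReal.ofReal (δ ^ (1 - a - b)) * l2 (fun y ↦ bw (-a) y * φ y) := by
  obtain ⟨C, hC⟩ := exists_weighted_truncKernel_le ha hb hab
  have hI : ∫⁻ x, bw (b - 2) x ≠ ∞ := by
    rw [show b - 2 = -(2 - b) by ring]; exact lintegral_bw_ne_top (by linarith)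
  have hJ : ∫⁻ x, bw (2 * (b - 2)) x ≠ ∞ := by
    rw [show 2 * (b - 2) = -(2 * (2 - b)) by ring]; exact lintegral_bw_ne_top (by linarith)
  have hK : ∫⁻ x, bw (2 * (a - 1)) x ≠ ∞ := by
    rw [show 2 * (a - 1) = -(2 * (1 - a)) by ring]; exact lintegral_bw_ne_top (by linarith)
  set I := ∫⁻ x, bw (b - 2) x
  set J := ∫⁻ x, bw (2 * (b - 2)) x
  set K := ∫⁻ x, bw (2 * (a - 1)) x
  obtain ⟨D, hD⟩ := exists_sq_ge (J * K).toNNReal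
  rw [ENNReal.coe_toNNReal (by finiteness)] at hD
  refine ⟨C * (I.toNNReal + D) + 1, fun δ hδ hδ1 φ hφ ↦ ?_⟩
  set Φ : ℝ → ℝ≥0∞ := fun y ↦ bw (-a) y * φ y with hΦ
  have hΦm : Measurable Φ := by fun_prop
  have hδi : ENNReal.ofReal δ⁻¹ * ENNReal.ofReal (δ ^ (2 - a - b)) =
      ENNReal.ofReal (δ ^ (1 - a - b)) := by
    rw [← ENNReal.ofReal_mul (by positivity), ← Real.rpow_neg_one, ← Real.rpow_add hδ]
    congr 2; ring
  have hpt : ∀ x, bw b x * ∫⁻ y, ‖truncKernel δ x y‖ₑ * φ y ≤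
      C * ENNReal.ofReal (δ ^ (2 - a - b)) * ((∫⁻ y, bw (b - 2) (δ * (x - y)) * Φ y) +
        (∫⁻ y, bw (a - 1) (δ * y) * Φ y) * bw (b - 2) (δ * x)) := by
    intro x
    have hm := measurable_truncKernel_right δ x
    have hm1 : Measurable fun y ↦ ‖truncKernel δ x y‖ₑ * φ y := hm.enorm.mul hφ
    have hm2 : Measurable fun y ↦ bw (b - 2) (δ * (x - y)) * Φ y := by fun_prop
    have hm3 : Measurable fun y ↦ bw (a - 1) (δ * y) * Φ y := by fun_prop
    have hm4 : Measurable fun y ↦ bw (b - 2) (δ * (x - y)) * Φ y +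
        bw (a - 1) (δ * y) * Φ y * bw (b - 2) (δ * x) := hm2.add (hm3.mul_const _)
    rw [← lintegral_const_mul _ hm1, ← lintegral_mul_const _ hm3, ← lintegral_add_left hm2,
      ← lintegral_const_mul _ hm4]
    refine lintegral_mono fun y ↦ ?_
    have e1 : bw b x * (‖truncKernel δ x y‖ₑ * φ y) =
        bw b x * ‖truncKernel δ x y‖ₑ * bw a y * (bw (-a) y * φ y) := by
      calc _ = bw b x * ‖truncKernel δ x y‖ₑ * (bw a y * bw (-a) y) * φ y := by
            rw [bw_mul_neg]; ring
        _ = _ := by ring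
    rw [e1]
    refine (mul_le_mul_left (hC δ x y hδ hδ1) _).trans (le_of_eq ?_)
    rw [mul_sub, hΦ]; ring
  have h1 : l2 (fun x ↦ ∫⁻ y, bw (b - 2) (δ * (x - y)) * Φ y) ≤
      ENNReal.ofReal δ⁻¹ * I * l2 Φ := by
    have := l2_convolution_le (w := fun x ↦ bw (b - 2) (δ * x)) (by fun_prop) hΦm
    rwa [lintegral_bw_scaled hδ] at this
  have hfin : ∫⁻ y, bw (a - 1) (δ * y) * Φ y ≤ l2 (fun y ↦ bw (a - 1) (δ * y)) * l2 Φ :=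
    lintegral_mul_le_l2_mul_l2 (by fun_prop) hΦm.aemeasurable
  have h2 : l2 (fun y ↦ bw (a - 1) (δ * y)) * l2 (fun x ↦ bw (b - 2) (δ * x)) ≤
      ENNReal.ofReal δ⁻¹ * D := by
    refine le_of_sq_le_sq ?_
    rw [mul_pow, l2_sq, l2_sq]
    simp only [bw_sq]
    rw [lintegral_bw_scaled hδ, lintegral_bw_scaled hδ, mul_pow]
    calc _ = ENNReal.ofReal δ⁻¹ ^ 2 * (J * K) := by ring
      _ ≤ _ := by gcongr
  have hm1 : Measurable fun x ↦ ∫⁻ y, bw (b - 2) (δ * (x - y)) * Φ y :=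
    Measurable.lintegral_prod_right' (f := fun v : ℝ × ℝ ↦ bw (b - 2) (δ * (v.1 - v.2)) * Φ v.2)
      (by fun_prop)
  by_cases hΦt : l2 Φ = ∞
  · rw [hΦt, ENNReal.mul_top]
    · exact le_top
    · refine mul_ne_zero (by simp) ?_
      simpa using Real.rpow_pos_of_pos hδ _
  have hcst : ∫⁻ y, bw (a - 1) (δ * y) * Φ y ≠ ∞ := by
    refine ne_top_of_le_ne_top (ENNReal.mul_ne_top ?_ hΦt) hfin
    refine ENNReal.rpow_ne_top_of_nonneg (by norm_num) ?_
    simp only [bw_sq]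
    rw [lintegral_bw_scaled hδ]; finiteness
  calc _ ≤ _ := l2_mono hpt
    _ = C * ENNReal.ofReal (δ ^ (2 - a - b)) * l2 (fun x ↦ (∫⁻ y, bw (b - 2) (δ * (x - y)) * Φ y) +
        (∫⁻ y, bw (a - 1) (δ * y) * Φ y) * bw (b - 2) (δ * x)) :=
        l2_const_mul (by finiteness) _
    _ ≤ C * ENNReal.ofReal (δ ^ (2 - a - b)) * (ENNReal.ofReal δ⁻¹ * I * l2 Φ +
        ENNReal.ofReal δ⁻¹ * D * l2 Φ) := by
        gcongr
        refine (l2_add_le hm1.aemeasurable (by fun_prop)).trans (add_le_add h1 ?_)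
        rw [l2_const_mul hcst]
        calc _ ≤ l2 (fun y ↦ bw (a - 1) (δ * y)) * l2 Φ * l2 (fun x ↦ bw (b - 2) (δ * x)) := by
              gcongr
          _ = l2 (fun y ↦ bw (a - 1) (δ * y)) * l2 (fun x ↦ bw (b - 2) (δ * x)) * l2 Φ := by ring
          _ ≤ _ := by gcongr
    _ = C * (I + D) * (ENNReal.ofReal δ⁻¹ * ENNReal.ofReal (δ ^ (2 - a - b))) * l2 Φ := by ring
    _ ≤ _ := by
        rw [hδi]; push_cast; rw [ENNReal.coe_toNNReal hI]
        gcongr; exact le_self_add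

/-! ### Bourgain norms, linear groups and Duhamel operators -/

/-- The norm of the Bourgain space of the dispersion `p`, as a function of the space-time Fourier
transform. -/
def bourgainNorm (p : ℝ → ℝ) (s b : ℝ) (g : ℝ × ℝ → ℂ) : ℝ≥0∞ :=
  l2 fun z ↦ bourgainWeight p s b z * ‖g z‖ₑ

/-- The symbol of the linear group of the dispersion `p`. -/
def phaseGroup (p : ℝ → ℝ) (t ξ : ℝ) : ℂ := Complex.exp (-(2 * Real.pi * Complex.I * t * p ξ))

theorem schrodingerGroup_eq_phaseGroup : schrodingerGroup = phaseGroup schrodingerPhase :=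
  funext₂ schrodingerGroup_eq

theorem benjaminOnoGroup_eq_phaseGroup (ν : ℝ) :
    benjaminOnoGroup ν = phaseGroup (benjaminOnoPhase ν) :=
  funext₂ (benjaminOnoGroup_eq ν)

theorem norm_exp_two_pi (t x : ℝ) : ‖Complex.exp (2 * Real.pi * Complex.I * t * x)‖ = 1 := by
  rw [show (2 * Real.pi * Complex.I * t * x : ℂ) = ((2 * Real.pi * t * x : ℝ) : ℂ) * Complex.I by
    push_cast; ring, Complex.norm_exp_ofReal_mul_I]

theorem enorm_exp_two_pi (t x : ℝ) : ‖Complex.exp (2 * Real.pi * Complex.I * t * x)‖ₑ = 1 := by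
  rw [← ofReal_norm, norm_exp_two_pi, ENNReal.ofReal_one]

theorem norm_phaseGroup (p : ℝ → ℝ) (t ξ : ℝ) : ‖phaseGroup p t ξ‖ = 1 := by
  rw [phaseGroup, show (-(2 * Real.pi * Complex.I * t * p ξ) : ℂ) =
    ((-(2 * Real.pi * t * p ξ) : ℝ) : ℂ) * Complex.I by push_cast; ring,
    Complex.norm_exp_ofReal_mul_I]

theorem enorm_phaseGroup (p : ℝ → ℝ) (t ξ : ℝ) : ‖phaseGroup p t ξ‖ₑ = 1 := by
  rw [← ofReal_norm, norm_phaseGroup, ENNReal.ofReal_one]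

/-- The spatial Fourier transform, at time `t`, of the function with space-time Fourier
transform `g`. -/
def slice (g : ℝ × ℝ → ℂ) (t ξ : ℝ) : ℂ :=
  ∫ τ : ℝ, Complex.exp (2 * Real.pi * Complex.I * t * τ) * g (τ, ξ)

/-- The spatial Fourier transform of the Duhamel integral `∫₀ᵗ G(t - t') F(t') dt'`. -/
def duhamelSlice (p : ℝ → ℝ) (F : ℝ × ℝ → ℂ) (t ξ : ℝ) : ℂ :=
  ∫ τ : ℝ, duhamelKernel (phaseGroup p) t τ ξ * F (τ, ξ)

/-- The space-time Fourier transform of `χ(t / δ) ∫₀ᵗ G(t - t') F(t') dt'`, where `χ` is the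
cutoff. -/
def duhamelOp (δ : ℝ) (p : ℝ → ℝ) (F : ℝ × ℝ → ℂ) (z : ℝ × ℝ) : ℂ :=
  ∫ y : ℝ, truncKernel δ (z.1 + p z.2) (y + p z.2) * F (y, z.2)

@[fun_prop]
theorem measurable_duhamelOp (δ : ℝ) {p : ℝ → ℝ} (hp : Measurable p) {F : ℝ × ℝ → ℂ}
    (hF : Measurable F) : Measurable (duhamelOp δ p F) := by
  have h := measurable_truncKernel δ
  have : Measurable fun w : (ℝ × ℝ) × ℝ ↦
      truncKernel δ (w.1.1 + p w.1.2) (w.2 + p w.1.2) * F (w.2, w.1.2) := by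
    refine Measurable.mul (h.comp (g := fun v : ℝ × ℝ ↦ truncKernel δ v.1 v.2)
      (f := fun w : (ℝ × ℝ) × ℝ ↦ (w.1.1 + p w.1.2, w.2 + p w.1.2)) (by fun_prop)) (by fun_prop)
  exact this.stronglyMeasurable.integral_prod_right'.measurable

@[fun_prop]
theorem measurable_slice {g : ℝ × ℝ → ℂ} (hg : Measurable g) (t : ℝ) : Measurable (slice g t) := by
  have : Measurable fun w : ℝ × ℝ ↦
      Complex.exp (2 * Real.pi * Complex.I * t * w.2) * g (w.2, w.1) := by fun_prop
  exact this.stronglyMeasurable.integral_prod_right'.measurable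

/-- The smoothing of the truncated Duhamel operator in Bourgain spaces. -/
theorem exists_bourgainNorm_duhamelOp_le {a b : ℝ} (ha : 0 ≤ a) (ha' : a < 1 / 2) (hb : 0 ≤ b)
    (hb' : b < 1) (hab : a + b ≤ 1) :
    ∃ C : ℝ≥0, ∀ δ : ℝ, 0 < δ → δ ≤ 1 → ∀ p : ℝ → ℝ, Measurable p → ∀ s : ℝ,
      ∀ F : ℝ × ℝ → ℂ, Measurable F →
      bourgainNorm p s b (duhamelOp δ p F) ≤
        C * ENNReal.ofReal (δ ^ (1 - a - b)) * bourgainNorm p s (-a) F := by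
  obtain ⟨C, hC⟩ := exists_l2_truncKernel_le ha ha' hb hb' hab
  refine ⟨C, fun δ hδ hδ1 p hp s F hF ↦ ?_⟩
  have key : ∀ ξ, ∫⁻ τ, (bw b (τ + p ξ) * ‖duhamelOp δ p F (τ, ξ)‖ₑ) ^ 2 ≤
      (C * ENNReal.ofReal (δ ^ (1 - a - b))) ^ 2 * ∫⁻ τ, (bw (-a) (τ + p ξ) * ‖F (τ, ξ)‖ₑ) ^ 2 := by
    intro ξ
    have h := pow_le_pow_left' (hC δ hδ hδ1 (fun y ↦ ‖F (y - p ξ, ξ)‖ₑ) (by fun_prop)) 2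
    rw [mul_pow, l2_sq, l2_sq] at h
    calc _ ≤ ∫⁻ τ, (bw b (τ + p ξ) *
          ∫⁻ y, ‖truncKernel δ (τ + p ξ) y‖ₑ * ‖F (y - p ξ, ξ)‖ₑ) ^ 2 := by
          gcongr with τ
          rw [← lintegral_add_right_eq_self _ (p ξ)]
          refine (enorm_integral_le_lintegral_enorm _).trans (le_of_eq ?_)
          simp only [enorm_mul, add_sub_cancel_right]
      _ = ∫⁻ x, (bw b x * ∫⁻ y, ‖truncKernel δ x y‖ₑ * ‖F (y - p ξ, ξ)‖ₑ) ^ 2 :=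
          lintegral_add_right_eq_self
            (fun x ↦ (bw b x * ∫⁻ y, ‖truncKernel δ x y‖ₑ * ‖F (y - p ξ, ξ)‖ₑ) ^ 2) (p ξ)
      _ ≤ _ := h
      _ = _ := by
          rw [← lintegral_add_right_eq_self _ (p ξ)]
          simp only [add_sub_cancel_right]
  refine le_of_sq_le_sq ?_
  have hm := measurable_duhamelOp δ hp hF
  rw [mul_pow, bourgainNorm, bourgainNorm, l2_sq, l2_sq, lintegral_time_space (by fun_prop),
    lintegral_time_space (by fun_prop), ← lintegral_const_mul' _ _ (by finiteness)]
  refine lintegral_mono fun ξ ↦ ?_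
  simp only [bourgainWeight, modWeight, mul_assoc, mul_pow (bw s ξ)]
  rw [lintegral_const_mul' _ _ (by finiteness [@bw_ne_top s ξ]),
    lintegral_const_mul' _ _ (by finiteness [@bw_ne_top s ξ])]
  calc _ ≤ bw s ξ ^ 2 * _ := mul_le_mul_right (key ξ) _
    _ = _ := by ring

/-- Integration in the time frequency against a weight of exponent above `1 / 2` is controlled by
the Cauchy-Schwarz inequality. -/
theorem exists_l2_lintegral_le {κ : ℝ} (hκ : 1 / 2 < κ) :
    ∃ C : ℝ≥0, ∀ p : ℝ → ℝ, Measurable p → ∀ s c : ℝ, ∀ g : ℝ × ℝ → ℝ≥0∞, Measurable g →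
      l2 (fun ξ ↦ bw s ξ * ∫⁻ τ, bw (c - κ) (τ + p ξ) * g (τ, ξ)) ≤
        C * l2 (fun z ↦ bourgainWeight p s c z * g z) := by
  have hJ : ∫⁻ x, bw (2 * (-κ)) x ≠ ∞ := by
    rw [show 2 * (-κ) = -(2 * κ) by ring]; exact lintegral_bw_ne_top (by linarith)
  set J := ∫⁻ x, bw (2 * (-κ)) x with hJd
  obtain ⟨D, hD⟩ := exists_sq_ge J.toNNReal
  rw [ENNReal.coe_toNNReal hJ] at hD
  refine ⟨D, fun p hp s c g hg ↦ le_of_sq_le_sq ?_⟩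
  rw [mul_pow, l2_sq, l2_sq, lintegral_time_space (by fun_prop),
    ← lintegral_const_mul' _ _ (by finiteness)]
  refine lintegral_mono fun ξ ↦ ?_
  simp only [bourgainWeight, modWeight, mul_assoc, mul_pow (bw s ξ)]
  rw [lintegral_const_mul' _ _ (by finiteness [@bw_ne_top s ξ])]
  have h := sq_lintegral_mul_le volume (f := fun τ ↦ bw (-κ) (τ + p ξ))
    (g := fun τ ↦ bw c (τ + p ξ) * g (τ, ξ)) (by fun_prop) (by fun_prop)
  simp only [bw_sq] at h
  rw [lintegral_add_right_eq_self (fun x ↦ bw (2 * (-κ)) x) (p ξ)] at h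
  calc _ = bw s ξ ^ 2 * (∫⁻ τ, bw (-κ) (τ + p ξ) * (bw c (τ + p ξ) * g (τ, ξ))) ^ 2 := by
        congr 3; ext τ; rw [← mul_assoc, ← bw_add]; congr 2; ring
    _ ≤ bw s ξ ^ 2 * (D ^ 2 * ∫⁻ τ, (bw c (τ + p ξ) * g (τ, ξ)) ^ 2) := by
        gcongr; exact h.trans (by gcongr)
    _ = _ := by ring

theorem ae_ne_top_of_l2_ne_top {f : ℝ → ℝ≥0∞} (hf : Measurable f) {s : ℝ}
    (h : l2 (fun ξ ↦ bw s ξ * f ξ) ≠ ∞) : ∀ᵐ ξ, f ξ ≠ ∞ := by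
  have h2 : ∫⁻ ξ, (bw s ξ * f ξ) ^ 2 ≠ ∞ := by
    rw [← l2_sq]; exact ENNReal.pow_ne_top h
  filter_upwards [ae_lt_top (by fun_prop) h2] with ξ hξ
  intro ht
  rw [ht, ENNReal.mul_top (bw_ne_zero _ _)] at hξ
  simp at hξ

/-- Functions in a Bourgain space with exponent above `1 / 2` have integrable slices. -/
theorem ae_integrable_slice {p : ℝ → ℝ} (hp : Measurable p) {s b : ℝ} (hb : 1 / 2 < b)
    {g : ℝ × ℝ → ℂ} (hg : Measurable g) (h : bourgainNorm p s b g ≠ ∞) :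
    ∀ᵐ ξ, Integrable fun τ ↦ g (τ, ξ) := by
  obtain ⟨C, hC⟩ := exists_l2_lintegral_le hb
  have h1 := ne_top_of_le_ne_top (by finiteness) (hC p hp s b (fun z ↦ ‖g z‖ₑ) (by fun_prop))
  simp only [sub_self, bw_zero, one_mul] at h1
  filter_upwards [ae_ne_top_of_l2_ne_top (by fun_prop) h1] with ξ hξ
  exact ⟨(by fun_prop : Measurable fun τ ↦ g (τ, ξ)).aestronglyMeasurable, lt_top_iff_ne_top.2 hξ⟩

/-- The Duhamel term makes sense in Bourgain spaces with exponent above `-1 / 2`. -/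
theorem ae_lintegral_bw_mul_ne_top {p : ℝ → ℝ} (hp : Measurable p) {s a : ℝ} (ha : a < 1 / 2)
    {F : ℝ × ℝ → ℝ≥0∞} (hF : Measurable F)
    (h : l2 (fun z ↦ bourgainWeight p s (-a) z * F z) ≠ ∞) :
    ∀ᵐ ξ, ∫⁻ τ, bw (-1) (τ + p ξ) * F (τ, ξ) ≠ ∞ := by
  obtain ⟨C, hC⟩ := exists_l2_lintegral_le (κ := 1 - a) (by linarith)
  have h1 := ne_top_of_le_ne_top (by finiteness) (hC p hp s (-a) F hF)
  rw [show -a - (1 - a) = -1 by ring] at h1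
  exact ae_ne_top_of_l2_ne_top (by fun_prop) h1

theorem duhamelKernel_phaseGroup (p : ℝ → ℝ) (t τ ξ : ℝ) :
    duhamelKernel (phaseGroup p) t τ ξ = phaseGroup p t ξ *
      ∫ r in (0 : ℝ)..t, Complex.exp (2 * Real.pi * Complex.I * (τ + p ξ : ℝ) * r) := by
  rw [duhamelKernel, ← intervalIntegral.integral_const_mul]
  congr 1; ext r
  rw [phaseGroup, phaseGroup, ← Complex.exp_add, ← Complex.exp_add]
  congr 1; push_cast; ring

theorem enorm_integral_exp_le (t y : ℝ) :
    ‖∫ r in (0 : ℝ)..t, Complex.exp (2 * Real.pi * Complex.I * y * r)‖ₑ ≤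
      ENNReal.ofReal (|t| + 1) * bw (-1) y := by
  set I := ∫ r in (0 : ℝ)..t, Complex.exp (2 * Real.pi * Complex.I * y * r) with hI
  have h1 : ‖I‖ ≤ |t| := by
    have := intervalIntegral.norm_integral_le_of_norm_le_const (a := 0) (b := t) (C := 1)
      (f := fun r : ℝ ↦ Complex.exp (2 * Real.pi * Complex.I * y * r))
      (fun r _ ↦ (norm_exp_two_pi y r).le)
    simpa using this
  have h2 : |y| * ‖I‖ ≤ 1 := by
    by_cases hy : y = 0
    · simp [hy]
    have hc : (2 * Real.pi * Complex.I * y : ℂ) ≠ 0 := by simp [Real.pi_ne_zero, hy]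
    have h3 : (2 * Real.pi * Complex.I * y : ℂ) * I =
        Complex.exp (2 * Real.pi * Complex.I * y * t) - 1 := by
      rw [hI, integral_exp_mul_complex hc, mul_div_cancel₀ _ hc]; simp
    have h4 : 2 * Real.pi * |y| * ‖I‖ ≤ 2 := by
      have := congrArg norm h3
      rw [norm_mul] at this
      have e : ‖(2 * Real.pi * Complex.I * y : ℂ)‖ = 2 * Real.pi * |y| := by
        simp [abs_of_pos Real.pi_pos]
      rw [e] at this
      rw [this]
      refine (norm_sub_le _ _).trans ?_
      rw [norm_exp_two_pi]; norm_num
    nlinarith [Real.pi_gt_three, mul_nonneg (abs_nonneg y) (norm_nonneg I)]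
  have hb := bracket_pos y
  have h5 : ‖I‖ ≤ (|t| + 1) * bracket y ^ (-1 : ℝ) := by
    rw [Real.rpow_neg_one, ← div_eq_mul_inv, le_div_iff₀ hb]
    nlinarith [bracket_le_one_add_abs y, norm_nonneg I]
  rw [← ofReal_norm, bw, ← ENNReal.ofReal_mul (by positivity)]
  exact ENNReal.ofReal_le_ofReal h5

theorem enorm_duhamelKernel_le (p : ℝ → ℝ) (t τ ξ : ℝ) :
    ‖duhamelKernel (phaseGroup p) t τ ξ‖ₑ ≤ ENNReal.ofReal (|t| + 1) * bw (-1) (τ + p ξ) := by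
  rw [duhamelKernel_phaseGroup, enorm_mul, enorm_phaseGroup, one_mul]
  exact enorm_integral_exp_le t _

theorem continuous_integral_exp (t : ℝ) : Continuous fun y : ℝ ↦
    ∫ r in (0 : ℝ)..t, Complex.exp (2 * Real.pi * Complex.I * y * r) := by
  refine intervalIntegral.continuous_parametric_intervalIntegral_of_continuous' ?_ 0 t
  fun_prop

@[fun_prop]
theorem measurable_duhamelKernel {p : ℝ → ℝ} (hp : Measurable p) (t : ℝ) :
    Measurable fun z : ℝ × ℝ ↦ duhamelKernel (phaseGroup p) t z.1 z.2 := by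
  simp only [duhamelKernel_phaseGroup, phaseGroup]
  have := (continuous_integral_exp t).measurable
  refine Measurable.mul (by fun_prop) ?_
  exact this.comp (f := fun z : ℝ × ℝ ↦ z.1 + p z.2) (by fun_prop)

theorem integrable_duhamelKernel_mul {p : ℝ → ℝ} (hp : Measurable p) {F : ℝ × ℝ → ℂ}
    (hF : Measurable F) {ξ : ℝ} (h : ∫⁻ τ, bw (-1) (τ + p ξ) * ‖F (τ, ξ)‖ₑ ≠ ∞) (t : ℝ) :
    Integrable fun τ ↦ duhamelKernel (phaseGroup p) t τ ξ * F (τ, ξ) := by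
  have hm := measurable_duhamelKernel hp t
  refine ⟨(by fun_prop : Measurable _).aestronglyMeasurable, ?_⟩
  calc _ ≤ ∫⁻ τ, ENNReal.ofReal (|t| + 1) * (bw (-1) (τ + p ξ) * ‖F (τ, ξ)‖ₑ) := by
        refine lintegral_mono fun τ ↦ ?_
        rw [enorm_mul, ← mul_assoc]
        gcongr; exact enorm_duhamelKernel_le p t τ ξ
    _ = ENNReal.ofReal (|t| + 1) * _ := lintegral_const_mul' _ _ (by finiteness)
    _ < ∞ := by finiteness

theorem exists_lintegral_truncKernel_le {δ : ℝ} (hδ : 0 < δ) (hδ1 : δ ≤ 1) :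
    ∃ C : ℝ≥0, ∀ y, ∫⁻ x, ‖truncKernel δ x y‖ₑ ≤ C * bw (-1) y := by
  obtain ⟨C, hC⟩ := exists_weighted_truncKernel_le (a := 1) (b := 0) (by norm_num) le_rfl
    (by norm_num)
  have hI : ∫⁻ x, bw (0 - 2) (δ * x) ≠ ∞ := by
    rw [lintegral_bw_scaled hδ]
    have : ∫⁻ x, bw (0 - 2) x ≠ ∞ := by rw [zero_sub]; exact lintegral_bw_ne_top (by norm_num)
    finiteness
  set I := ∫⁻ x, bw (0 - 2) (δ * x) with hId
  refine ⟨(C * ENNReal.ofReal (δ ^ ((2 : ℝ) - 1 - 0)) * (I + I)).toNNReal, fun y ↦ ?_⟩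
  rw [ENNReal.coe_toNNReal (by finiteness)]
  have h : ∀ x, ‖truncKernel δ x y‖ₑ ≤ C * ENNReal.ofReal (δ ^ ((2 : ℝ) - 1 - 0)) *
      (bw (0 - 2) (δ * (x - y)) + bw (0 - 2) (δ * x)) * bw (-1) y := by
    intro x
    have := mul_le_mul_left (hC δ x y hδ hδ1) (bw (-1) y)
    rw [mul_assoc _ (bw 1 y), bw_mul_neg, bw_zero, one_mul, mul_one, sub_self, bw_zero, mul_one,
      ← mul_sub] at this
    exact this
  refine (lintegral_mono h).trans (le_of_eq ?_)
  have hm1 : Measurable fun x ↦ bw (0 - 2) (δ * (x - y)) := by fun_prop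
  rw [lintegral_mul_const _ (by fun_prop), lintegral_const_mul _ (by fun_prop),
    lintegral_add_left hm1, lintegral_sub_right_eq_self (fun x ↦ bw (0 - 2) (δ * x)) y]

/-- The time slices of the truncated Duhamel operator are those of the Duhamel integral. -/
theorem slice_duhamelOp {δ : ℝ} (hδ : 0 < δ) (hδ1 : δ ≤ 1) {p : ℝ → ℝ} {F : ℝ × ℝ → ℂ}
    (hF : Measurable F) {ξ : ℝ} (h : ∫⁻ τ, bw (-1) (τ + p ξ) * ‖F (τ, ξ)‖ₑ ≠ ∞) (t : ℝ) :
    slice (duhamelOp δ p F) t ξ = cutoff (t / δ) * duhamelSlice p F t ξ := by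
  obtain ⟨C, hC⟩ := exists_lintegral_truncKernel_le hδ hδ1
  have hk : Measurable fun w : ℝ × ℝ ↦ truncKernel δ (w.1 + p ξ) (w.2 + p ξ) :=
    (measurable_truncKernel δ).comp (f := fun w : ℝ × ℝ ↦ (w.1 + p ξ, w.2 + p ξ)) (by fun_prop)
  have hm : Measurable fun w : ℝ × ℝ ↦ Complex.exp (2 * Real.pi * Complex.I * t * w.1) *
      (truncKernel δ (w.1 + p ξ) (w.2 + p ξ) * F (w.2, ξ)) := by fun_prop
  have hint : Integrable (fun w : ℝ × ℝ ↦ Complex.exp (2 * Real.pi * Complex.I * t * w.1) *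
      (truncKernel δ (w.1 + p ξ) (w.2 + p ξ) * F (w.2, ξ))) (volume.prod volume) := by
    refine ⟨hm.aestronglyMeasurable, ?_⟩
    rw [hasFiniteIntegral_iff_enorm, lintegral_prod_symm' _ (by fun_prop)]
    simp only [enorm_mul, enorm_exp_two_pi, one_mul]
    calc _ ≤ ∫⁻ y, C * (bw (-1) (y + p ξ) * ‖F (y, ξ)‖ₑ) := by
          refine lintegral_mono fun y ↦ ?_
          rw [lintegral_mul_const _ (by fun_prop), ← mul_assoc,
            lintegral_add_right_eq_self (fun x ↦ ‖truncKernel δ x (y + p ξ)‖ₑ) (p ξ)]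
          gcongr; exact hC _
      _ = C * _ := lintegral_const_mul' _ _ (by finiteness)
      _ < ∞ := by finiteness
  have hne : ∀ᵐ y : ℝ, y + p ξ ≠ 0 := by
    filter_upwards [Measure.ae_ne volume (-p ξ)] with y hy h0
    exact hy (by linarith)
  simp only [slice, duhamelOp, duhamelSlice, ← integral_const_mul]
  rw [integral_integral_swap hint]
  refine integral_congr_ae ?_
  filter_upwards [hne] with y hy
  simp only [← mul_assoc]
  rw [integral_mul_const]
  congr 1
  rw [duhamelKernel_phaseGroup, mul_left_comm, ← truncKernel_integral hδ hy,
    ← integral_add_right_eq_self (fun x : ℝ ↦ Complex.exp (2 * Real.pi * Complex.I * t * x) *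
      truncKernel δ x (y + p ξ)) (p ξ), ← integral_const_mul, phaseGroup]
  refine integral_congr_ae (Eventually.of_forall fun x ↦ ?_)
  simp only
  rw [← mul_assoc, ← Complex.exp_add]
  congr 2; push_cast; ring

/-- The space-time Fourier transform of `χ(t) G(t) φ`, where `χ` is the cutoff and `φ` has the
Fourier transform `f`. -/
def linearOp (p : ℝ → ℝ) (f : ℝ → ℂ) (z : ℝ × ℝ) : ℂ := cutoffHat (z.1 + p z.2) * f z.2

@[fun_prop]
theorem measurable_linearOp {p : ℝ → ℝ} (hp : Measurable p) {f : ℝ → ℂ} (hf : Measurable f) :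
    Measurable (linearOp p f) := by
  have := cutoffHat.continuous.measurable
  unfold linearOp; fun_prop

theorem slice_linearOp (p : ℝ → ℝ) (f : ℝ → ℂ) (t ξ : ℝ) :
    slice (linearOp p f) t ξ = cutoff t * (phaseGroup p t ξ * f ξ) := by
  rw [← integral_exp_mul_cutoffHat, slice]
  simp only [linearOp, ← mul_assoc]
  rw [integral_mul_const]
  congr 1
  rw [← integral_add_right_eq_self (fun x : ℝ ↦ Complex.exp (2 * Real.pi * Complex.I * t * x) *
    cutoffHat x) (p ξ), ← integral_mul_const]
  refine integral_congr_ae (Eventually.of_forall fun x ↦ ?_)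
  simp only
  rw [mul_right_comm _ (cutoffHat _), phaseGroup, ← Complex.exp_add]
  congr 2; push_cast; ring

/-- The Bourgain norm of `χ(t) G(t) φ` is a multiple of the Sobolev norm of `φ`, since the
modulation and the frequency separate. -/
theorem exists_bourgainNorm_linearOp_eq {b : ℝ} (hb : b ≤ 1) :
    ∃ C : ℝ≥0, ∀ p : ℝ → ℝ, Measurable p → ∀ s : ℝ, ∀ f : ℝ → ℂ, Measurable f →
      bourgainNorm p s b (linearOp p f) = C * l2 (fun ξ ↦ bw s ξ * ‖f ξ‖ₑ) := by
  obtain ⟨D, hD0, hD⟩ := exists_schwartz_le cutoffHat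
  have hmc := cutoffHat.continuous.measurable
  have hfin : l2 (fun x ↦ bw b x * ‖cutoffHat x‖ₑ) ≠ ∞ := by
    refine ENNReal.rpow_ne_top_of_nonneg (by norm_num) ?_
    have hJ : ∫⁻ x, bw (2 * (b - 2)) x ≠ ∞ := by
      rw [show 2 * (b - 2) = -(2 * (2 - b)) by ring]; exact lintegral_bw_ne_top (by linarith)
    refine ne_top_of_le_ne_top (b := ENNReal.ofReal D ^ 2 * ∫⁻ x, bw (2 * (b - 2)) x)
      (by finiteness) ?_
    rw [← lintegral_const_mul' _ _ (by finiteness)]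
    refine lintegral_mono fun x ↦ ?_
    rw [← bw_sq, ← mul_pow]
    refine pow_le_pow_left' ?_ 2
    rw [show b - 2 = b + -2 by ring, bw_add, mul_left_comm]
    refine mul_le_mul_right ?_ _
    rw [← ofReal_norm, bw, ← ENNReal.ofReal_mul hD0]
    exact ENNReal.ofReal_le_ofReal (hD x)
  refine ⟨(l2 (fun x ↦ bw b x * ‖cutoffHat x‖ₑ)).toNNReal, fun p hp s f hf ↦ ?_⟩
  rw [ENNReal.coe_toNNReal hfin]
  have hs : ∀ x y : ℝ≥0∞, x ^ 2 = y ^ 2 → x = y := fun x y h ↦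
    le_antisymm (le_of_sq_le_sq h.le) (le_of_sq_le_sq h.ge)
  refine hs _ _ ?_
  rw [mul_pow, bourgainNorm, l2_sq, l2_sq, l2_sq, lintegral_time_space (by fun_prop),
    ← lintegral_const_mul _ (by fun_prop)]
  refine lintegral_congr fun ξ ↦ ?_
  rw [← lintegral_add_right_eq_self (fun x ↦ (bw b x * ‖cutoffHat x‖ₑ) ^ 2) (p ξ),
    ← lintegral_mul_const _ (by fun_prop)]
  refine lintegral_congr fun τ ↦ ?_
  rw [bourgainWeight, modWeight, linearOp, enorm_mul]
  ring

/-! ### Tempered distributions with a function as Fourier transform -/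

theorem HasFourier.locallyIntegrable {f : 𝓢'(ℝ, ℂ)} {h : ℝ → ℂ} (hf : HasFourier f h) :
    LocallyIntegrable h := by
  rw [locallyIntegrable_iff]
  intro k hk
  obtain ⟨r, hr⟩ := hk.isBounded.subset_closedBall 0
  let B : ContDiffBump (0 : ℝ) :=
    ⟨max r 1, max r 1 + 1, lt_of_lt_of_le one_pos (le_max_right _ _), by linarith⟩
  let χ : 𝓢(ℝ, ℂ) := HasCompactSupport.toSchwartzMap (f := fun t ↦ ((B t : ℝ) : ℂ))
    (B.hasCompactSupport.comp_left Complex.ofReal_zero)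
    (Complex.ofRealCLM.contDiff.comp B.contDiff)
  refine ((hf χ).1.integrableOn (s := k)).congr_fun_ae ?_
  refine (ae_restrict_mem hk.measurableSet).mono fun x hx ↦ ?_
  have h1 : χ x = 1 := by
    change ((B x : ℝ) : ℂ) = 1
    rw [B.one_of_mem_closedBall (Metric.closedBall_subset_closedBall (le_max_left _ _) (hr hx)),
      Complex.ofReal_one]
  simp only [h1, one_mul]

theorem HasFourier.aemeasurable {f : 𝓢'(ℝ, ℂ)} {h : ℝ → ℂ} (hf : HasFourier f h) :
    AEMeasurable h :=
  hf.locallyIntegrable.aestronglyMeasurable.aemeasurable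

/-- Functions with the same pairings with Schwartz functions agree. -/
theorem ae_eq_of_forall_schwartz {h h' : ℝ → ℂ} (hh : LocallyIntegrable h)
    (hh' : LocallyIntegrable h') (H : ∀ χ : 𝓢(ℝ, ℂ), ∫ ξ, χ ξ * h ξ = ∫ ξ, χ ξ * h' ξ) :
    h =ᵐ[volume] h' := by
  refine ae_eq_of_integral_contDiff_smul_eq hh hh' fun g hg hgc ↦ ?_
  have h₁ : HasCompactSupport (fun x ↦ ((g x : ℝ) : ℂ)) := hgc.comp_left Complex.ofReal_zero
  have h₂ : ContDiff ℝ ((⊤ : ℕ∞) : WithTop ℕ∞) (fun x ↦ ((g x : ℝ) : ℂ)) :=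
      Complex.ofRealCLM.contDiff.comp hg
  exact H (h₁.toSchwartzMap h₂)

theorem HasFourier.ae_eq {f : 𝓢'(ℝ, ℂ)} {h h' : ℝ → ℂ} (hf : HasFourier f h)
    (hf' : HasFourier f h') : h =ᵐ[volume] h' :=
  ae_eq_of_forall_schwartz hf.locallyIntegrable hf'.locallyIntegrable
    fun χ ↦ (hf χ).2.symm.trans (hf' χ).2

theorem HasFourier.congr {f : 𝓢'(ℝ, ℂ)} {h h' : ℝ → ℂ} (hf : HasFourier f h)
    (hh : h =ᵐ[volume] h') : HasFourier f h' := fun χ ↦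
  ⟨(hf χ).1.congr (hh.mono fun ξ hξ ↦ by simp only [hξ]),
    (hf χ).2.trans (integral_congr_ae (hh.mono fun ξ hξ ↦ by simp only [hξ]))⟩

theorem fourierInv_fourier (f : 𝓢'(ℝ, ℂ)) : 𝓕⁻ (𝓕 f) = f :=
  FourierTransform.fourierInv_fourier_eq f

theorem HasFourier.eq {f f' : 𝓢'(ℝ, ℂ)} {h : ℝ → ℂ} (hf : HasFourier f h)
    (hf' : HasFourier f' h) : f = f' := by
  have : 𝓕 f = 𝓕 f' := by ext χ; rw [(hf χ).2, (hf' χ).2]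
  rw [← fourierInv_fourier f, this, fourierInv_fourier]

theorem HasFourier.add {f f' : 𝓢'(ℝ, ℂ)} {h h' : ℝ → ℂ} (hf : HasFourier f h)
    (hf' : HasFourier f' h') : HasFourier (f + f') (fun ξ ↦ h ξ + h' ξ) := fun χ ↦ by
  have e : 𝓕 (f + f') χ = 𝓕 f χ + 𝓕 f' χ := rfl
  rw [e, (hf χ).2, (hf' χ).2, ← integral_add (hf χ).1 (hf' χ).1]
  simp only [mul_add]
  exact ⟨(hf χ).1.add (hf' χ).1, trivial⟩

theorem HasFourier.smul {f : 𝓢'(ℝ, ℂ)} {h : ℝ → ℂ} (c : ℂ) (hf : HasFourier f h) :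
    HasFourier (c • f) (fun ξ ↦ c * h ξ) := fun χ ↦ by
  have e : 𝓕 (c • f) χ = c * 𝓕 f χ := rfl
  rw [e, (hf χ).2, ← integral_const_mul]
  simp only [mul_left_comm _ c]
  exact ⟨(hf χ).1.const_mul c, trivial⟩

theorem HasFourier.sub {f f' : 𝓢'(ℝ, ℂ)} {h h' : ℝ → ℂ} (hf : HasFourier f h)
    (hf' : HasFourier f' h') : HasFourier (f - f') (fun ξ ↦ h ξ - h' ξ) := by
  have := hf.add (hf'.smul (-1))
  rw [neg_one_smul ℂ f', ← sub_eq_add_neg] at this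
  simpa only [neg_one_mul, ← sub_eq_add_neg] using this

/-- The norm of `H^s`, as a function of the Fourier transform. -/
def weightedL2 (s : ℝ) (h : ℝ → ℂ) : ℝ≥0∞ := l2 fun ξ ↦ bw s ξ * ‖h ξ‖ₑ

theorem l2_enorm_eq_eLpNorm {α : Type*} [MeasureSpace α] (f : α → ℂ) :
    l2 (fun x ↦ ‖f x‖ₑ) = eLpNorm f 2 := by
  rw [eLpNorm_eq_lintegral_rpow_enorm_toReal (by norm_num) (by norm_num), l2]
  simp

theorem enorm_bracket_rpow_mul (s ξ : ℝ) (c : ℂ) :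
    ‖((bracket ξ ^ s : ℝ) : ℂ) * c‖ₑ = bw s ξ * ‖c‖ₑ := by
  rw [enorm_mul, bw, ← ofReal_norm (((bracket ξ ^ s : ℝ) : ℂ)), Complex.norm_real,
    Real.norm_of_nonneg (bracket_rpow_nonneg s ξ)]

theorem weightedL2_eq_eLpNorm (s : ℝ) (h : ℝ → ℂ) :
    weightedL2 s h = eLpNorm (fun ξ ↦ ((bracket ξ ^ s : ℝ) : ℂ) * h ξ) 2 := by
  rw [← l2_enorm_eq_eLpNorm, weightedL2]
  simp only [enorm_bracket_rpow_mul]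

theorem besselSymbol_eq (s : ℝ) :
    (fun x : ℝ ↦ (((1 + ‖x‖ ^ 2) ^ (s / 2) : ℝ) : ℂ)) = fun x ↦ ((bracket x ^ s : ℝ) : ℂ) := by
  ext x
  rw [bracket, Real.sqrt_eq_rpow, ← Real.rpow_mul (by positivity), Real.norm_eq_abs, sq_abs]
  congr 2; ring

theorem hasTemperateGrowth_bracket_rpow (s : ℝ) :
    (fun x : ℝ ↦ ((bracket x ^ s : ℝ) : ℂ)).HasTemperateGrowth := by
  rw [← besselSymbol_eq]; fun_prop

theorem bracket_rpow_neg_mul (s ξ : ℝ) (c : ℂ) :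
    ((bracket ξ ^ (-s) : ℝ) : ℂ) * (((bracket ξ ^ s : ℝ) : ℂ) * c) = c := by
  rw [← mul_assoc, ← Complex.ofReal_mul, ← Real.rpow_add (bracket_pos ξ), neg_add_cancel,
    Real.rpow_zero, Complex.ofReal_one, one_mul]

theorem bracket_rpow_mul_neg (s ξ : ℝ) (c : ℂ) :
    ((bracket ξ ^ s : ℝ) : ℂ) * (((bracket ξ ^ (-s) : ℝ) : ℂ) * c) = c := by
  simpa using bracket_rpow_neg_mul (-s) ξ c

theorem memLp_of_weightedL2_ne_top {s : ℝ} {h : ℝ → ℂ} (hm : AEMeasurable h)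
    (hh : weightedL2 s h ≠ ∞) : MemLp (fun ξ ↦ ((bracket ξ ^ s : ℝ) : ℂ) * h ξ) 2 := by
  refine ⟨AEMeasurable.aestronglyMeasurable ?_, ?_⟩
  · have := (Complex.continuous_ofReal.comp (continuous_bracket_rpow s)).measurable
    exact this.aemeasurable.mul hm
  · rw [← weightedL2_eq_eLpNorm]; exact lt_top_iff_ne_top.2 hh

/-- A function in a weighted `L²` space is the Fourier transform of a tempered distribution. -/
theorem exists_hasFourier {s : ℝ} {h : ℝ → ℂ} (hm : AEMeasurable h) (hh : weightedL2 s h ≠ ∞) :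
    ∃ f : 𝓢'(ℝ, ℂ), HasFourier f h := by
  have hL := memLp_of_weightedL2_ne_top hm hh
  refine ⟨𝓕⁻ (smulLeftCLM ℂ (fun x : ℝ ↦ ((bracket x ^ (-s) : ℝ) : ℂ)) (hL.toLp _)), fun χ ↦ ?_⟩
  rw [FourierTransform.fourier_fourierInv_eq, smulLeftCLM_apply_apply,
    Lp.toTemperedDistribution_apply]
  set θ := SchwartzMap.smulLeftCLM ℂ (fun x : ℝ ↦ ((bracket x ^ (-s) : ℝ) : ℂ)) χ with hθ
  have e : (fun ξ ↦ χ ξ * h ξ) = fun ξ ↦ θ ξ * (((bracket ξ ^ s : ℝ) : ℂ) * h ξ) := by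
    ext ξ
    rw [hθ, SchwartzMap.smulLeftCLM_apply_apply (hasTemperateGrowth_bracket_rpow _), smul_eq_mul,
      mul_right_comm, bracket_rpow_neg_mul, mul_comm]
  rw [e]
  refine ⟨(θ.memLp 2).integrable_mul hL, ?_⟩
  refine integral_congr_ae (hL.coeFn_toLp.mono fun ξ hξ ↦ ?_)
  simp only [hξ, smul_eq_mul]

theorem HasFourier.smulLeftCLM_fourier {s : ℝ} {f : 𝓢'(ℝ, ℂ)} {h : ℝ → ℂ} (hf : HasFourier f h)
    (hL : MemLp (fun ξ ↦ ((bracket ξ ^ s : ℝ) : ℂ) * h ξ) 2) :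
    smulLeftCLM ℂ (fun x : ℝ ↦ ((bracket x ^ s : ℝ) : ℂ)) (𝓕 f) =
      ((hL.toLp _ : Lp ℂ 2 (volume : Measure ℝ)) : 𝓢'(ℝ, ℂ)) := by
  ext χ
  rw [smulLeftCLM_apply_apply, (hf _).2, Lp.toTemperedDistribution_apply]
  refine integral_congr_ae (hL.coeFn_toLp.mono fun ξ hξ ↦ ?_)
  simp only [hξ, smul_eq_mul]
  rw [SchwartzMap.smulLeftCLM_apply_apply (hasTemperateGrowth_bracket_rpow _), smul_eq_mul]
  ring

theorem HasFourier.memSobolev {s : ℝ} {f : 𝓢'(ℝ, ℂ)} {h : ℝ → ℂ} (hf : HasFourier f h)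
    (hh : weightedL2 s h ≠ ∞) : MemSobolev s 2 f := by
  have hL := memLp_of_weightedL2_ne_top hf.aemeasurable hh
  rw [memSobolev_iff_exists_smulLeftCLM_fourier, besselSymbol_eq]
  exact ⟨_, hf.smulLeftCLM_fourier hL⟩

theorem HasFourier.sobolevNorm_eq {s : ℝ} {f : 𝓢'(ℝ, ℂ)} {h : ℝ → ℂ} (hf : HasFourier f h)
    (hh : weightedL2 s h ≠ ∞) : sobolevNorm s f = weightedL2 s h := by
  have hL := memLp_of_weightedL2_ne_top hf.aemeasurable hh
  have hS := hf.smulLeftCLM_fourier hL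
  have key : ∀ g : Lp ℂ 2 (volume : Measure ℝ), besselPotential ℝ ℂ s f = (g : 𝓢'(ℝ, ℂ)) →
      ‖g‖ₑ = weightedL2 s h := by
    intro g hg
    have h1 := congrArg 𝓕 hg
    rw [fourier_besselPotential_eq_smulLeftCLM_fourier_apply, besselSymbol_eq, hS,
      Lp.fourier_toTemperedDistribution_eq] at h1
    have h2 : hL.toLp _ = 𝓕 g :=
      LinearMap.ker_eq_bot.1 (Lp.ker_toTemperedDistributionCLM_eq_bot (F := ℂ) (μ := volume)
        (p := 2)) h1
    have h3 : ‖g‖ₑ = ‖𝓕 g‖ₑ := by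
      rw [← ofReal_norm, ← ofReal_norm, Lp.norm_fourier_eq]
    rw [h3, ← h2, Lp.enorm_toLp, weightedL2_eq_eLpNorm]
  obtain ⟨g, hg⟩ := hf.memSobolev hh
  refine le_antisymm ?_ ?_
  · rw [← key g hg]; exact iInf₂_le g hg
  · exact le_iInf₂ fun g hg ↦ (key g hg).ge

theorem exists_hasFourier_of_memSobolev {s : ℝ} {f : 𝓢'(ℝ, ℂ)} (hf : MemSobolev s 2 f) :
    ∃ h : ℝ → ℂ, Measurable h ∧ HasFourier f h ∧ weightedL2 s h ≠ ∞ := by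
  rw [memSobolev_iff_exists_smulLeftCLM_fourier, besselSymbol_eq] at hf
  obtain ⟨g, hg⟩ := hf
  have hgm : Measurable g := (Lp.stronglyMeasurable g).measurable
  have hbm := (Complex.continuous_ofReal.comp (continuous_bracket_rpow (-s))).measurable
  have hm : Measurable fun ξ ↦ ((bracket ξ ^ (-s) : ℝ) : ℂ) * g ξ := hbm.mul hgm
  have hfin : weightedL2 s (fun ξ ↦ ((bracket ξ ^ (-s) : ℝ) : ℂ) * g ξ) ≠ ∞ := by
    rw [weightedL2_eq_eLpNorm]
    simp only [bracket_rpow_mul_neg]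
    exact (Lp.memLp g).2.ne
  refine ⟨_, hm, ?_, hfin⟩
  obtain ⟨f', hf'⟩ := exists_hasFourier hm.aemeasurable hfin
  have hL := memLp_of_weightedL2_ne_top hm.aemeasurable hfin
  have e : (hL.toLp _ : Lp ℂ 2 (volume : Measure ℝ)) = g := by
    refine Lp.ext (hL.coeFn_toLp.trans (Eventually.of_forall fun ξ ↦ ?_))
    simp only [bracket_rpow_mul_neg]
  have h1 := hf'.smulLeftCLM_fourier hL
  rw [e, ← hg] at h1
  have h2 := congrArg (smulLeftCLM ℂ (fun x : ℝ ↦ ((bracket x ^ (-s) : ℝ) : ℂ))) h1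
  rw [smulLeftCLM_smulLeftCLM_apply (hasTemperateGrowth_bracket_rpow _)
    (hasTemperateGrowth_bracket_rpow _), smulLeftCLM_smulLeftCLM_apply
    (hasTemperateGrowth_bracket_rpow _) (hasTemperateGrowth_bracket_rpow _)] at h2
  have h3 : ((fun x : ℝ ↦ ((bracket x ^ s : ℝ) : ℂ)) * fun x : ℝ ↦ ((bracket x ^ (-s) : ℝ) : ℂ)) =
      fun _ ↦ 1 := by
    ext x
    simpa using bracket_rpow_mul_neg s x 1
  simp only [h3, smulLeftCLM_const, one_smul] at h2
  have h4 : f' = f := by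
    rw [← fourierInv_fourier f, ← h2, fourierInv_fourier]
  rwa [h4] at hf'

/-! ### Real-valued distributions -/

/-- The complex conjugate of a Schwartz function. -/
def schwartzConj (χ : 𝓢(ℝ, ℂ)) : 𝓢(ℝ, ℂ) :=
  SchwartzMap.postcompCLM (𝕜 := ℝ) (Complex.conjCLE : ℂ →L[ℝ] ℂ) χ

@[simp]
theorem schwartzConj_apply (χ : 𝓢(ℝ, ℂ)) (x : ℝ) : schwartzConj χ x = conj (χ x) := rfl

/-- The reflected complex conjugate of a Schwartz function. -/
def schwartzConjNeg (χ : 𝓢(ℝ, ℂ)) : 𝓢(ℝ, ℂ) :=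
  SchwartzMap.compCLMOfContinuousLinearEquiv ℝ (ContinuousLinearEquiv.neg ℝ) (schwartzConj χ)

@[simp]
theorem schwartzConjNeg_apply (χ : 𝓢(ℝ, ℂ)) (x : ℝ) : schwartzConjNeg χ x = conj (χ (-x)) := rfl

theorem fourier_schwartzConjNeg (χ : 𝓢(ℝ, ℂ)) : 𝓕 (schwartzConjNeg χ) = schwartzConj (𝓕 χ) := by
  ext ξ
  rw [schwartzConj_apply, SchwartzMap.fourier_coe, SchwartzMap.fourier_coe, Real.fourier_eq',
    Real.fourier_eq', ← integral_conj, ← integral_neg_eq_self]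
  refine integral_congr_ae (Eventually.of_forall fun x ↦ ?_)
  simp only [schwartzConjNeg_apply, smul_eq_mul, map_mul, ← Complex.exp_conj, neg_neg,
    Complex.conj_I, Complex.conj_ofReal]
  congr 2
  simp

theorem isRealValued_iff_conj (f : 𝓢'(ℝ, ℂ)) :
    IsRealValued f ↔ ∀ χ, f (schwartzConj χ) = conj (f χ) := by
  constructor
  · intro h χ
    have h1 := h (χ + schwartzConj χ) fun x ↦ by simp
    have h2 := h (Complex.I • (χ - schwartzConj χ)) fun x ↦ by simp
    rw [map_add, Complex.add_im] at h1
    rw [map_smul, map_sub, smul_eq_mul, Complex.I_mul_im, Complex.sub_re] at h2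
    refine Complex.ext ?_ ?_
    · rw [Complex.conj_re]; linarith
    · rw [Complex.conj_im]; linarith
  · intro h χ hχ
    have : schwartzConj χ = χ := by
      ext x; rw [schwartzConj_apply]; exact Complex.conj_eq_iff_im.2 (hχ x)
    have h1 := h χ
    rw [this] at h1
    exact Complex.conj_eq_iff_im.1 h1.symm

/-- A distribution is real-valued if and only if its Fourier transform is Hermitian. -/
theorem HasFourier.isRealValued_iff {f : 𝓢'(ℝ, ℂ)} {h : ℝ → ℂ} (hf : HasFourier f h) :
    IsRealValued f ↔ ∀ᵐ ξ, h (-ξ) = conj (h ξ) := by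
  have e1 : ∀ χ : 𝓢(ℝ, ℂ), f (schwartzConj (𝓕 χ)) = ∫ ξ, conj (χ ξ) * h (-ξ) := by
    intro χ
    rw [← fourier_schwartzConjNeg, ← TemperedDistribution.fourier_apply, (hf _).2,
      ← integral_neg_eq_self]
    simp
  have e2 : ∀ χ : 𝓢(ℝ, ℂ), conj (f (𝓕 χ)) = ∫ ξ, conj (χ ξ) * conj (h ξ) := by
    intro χ
    rw [← TemperedDistribution.fourier_apply, (hf _).2, ← integral_conj]
    simp
  rw [isRealValued_iff_conj]
  constructor
  · intro H
    have hl1 : LocallyIntegrable fun ξ ↦ h (-ξ) := by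
      rw [locallyIntegrable_iff]
      intro k hk
      have h1 := (locallyIntegrable_iff.1 hf.locallyIntegrable) (-k) hk.neg
      rw [← integrable_indicator_iff hk.measurableSet]
      rw [← integrable_indicator_iff hk.neg.measurableSet] at h1
      refine h1.comp_neg.congr (Eventually.of_forall fun x ↦ ?_)
      have e : -x ∈ -k ↔ x ∈ k := Set.neg_mem_neg
      change (-k).indicator h (-x) = _
      by_cases hx : x ∈ k
      · rw [indicator_of_mem (e.2 hx), indicator_of_mem hx]
      · rw [indicator_of_notMem (e.not.2 hx), indicator_of_notMem hx]
    have hl2 : LocallyIntegrable fun ξ ↦ conj (h ξ) := by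
      rw [locallyIntegrable_iff]
      intro k hk
      have h1 := (locallyIntegrable_iff.1 hf.locallyIntegrable) k hk
      exact (Complex.conjCLE : ℂ →L[ℝ] ℂ).integrable_comp h1
    refine ae_eq_of_forall_schwartz hl1 hl2 fun χ ↦ ?_
    have h1 := e1 (schwartzConj χ)
    rw [H, e2] at h1
    simpa using h1.symm
  · intro H χ
    have h1 : χ = 𝓕 (𝓕⁻ χ) := by rw [FourierTransform.fourier_fourierInv_eq]
    rw [h1, e1, e2]
    exact integral_congr_ae (H.mono fun ξ hξ ↦ by simp only [hξ])

/-! ### Time slices -/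

theorem ae_ae_slice {P : ℝ × ℝ → Prop} (h : ∀ᵐ z, P z) : ∀ᵐ ξ : ℝ, ∀ᵐ τ : ℝ, P (τ, ξ) := by
  have h1 : ∀ᵐ w : ℝ × ℝ ∂(volume.prod volume), P w.swap :=
    (Measure.measurePreserving_swap (μ := (volume : Measure ℝ))
      (ν := (volume : Measure ℝ))).quasiMeasurePreserving.ae h
  exact Measure.ae_ae_of_ae_prod h1

theorem ae_of_ae_snd {P : ℝ → Prop} (h : ∀ᵐ ξ, P ξ) : ∀ᵐ z : ℝ × ℝ, P z.2 :=
  Measure.quasiMeasurePreserving_snd.ae h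

theorem enorm_slice_le (g : ℝ × ℝ → ℂ) (t ξ : ℝ) : ‖slice g t ξ‖ₑ ≤ ∫⁻ τ, ‖g (τ, ξ)‖ₑ := by
  refine (enorm_integral_le_lintegral_enorm _).trans (le_of_eq ?_)
  simp only [enorm_mul, enorm_exp_two_pi, one_mul]

theorem exists_l2_lintegral_enorm_le {b : ℝ} (hb : 1 / 2 < b) :
    ∃ C : ℝ≥0, ∀ p : ℝ → ℝ, Measurable p → ∀ s : ℝ, ∀ g : ℝ × ℝ → ℂ, Measurable g →
      l2 (fun ξ ↦ bw s ξ * ∫⁻ τ, ‖g (τ, ξ)‖ₑ) ≤ C * bourgainNorm p s b g := by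
  obtain ⟨C, hC⟩ := exists_l2_lintegral_le hb
  refine ⟨C, fun p hp s g hg ↦ ?_⟩
  have h := hC p hp s b (fun z ↦ ‖g z‖ₑ) (by fun_prop)
  simp only [sub_self, bw_zero, one_mul] at h
  exact h

/-- The embedding of a Bourgain space in `L^∞(ℝ; H^s)`. -/
theorem exists_weightedL2_slice_le {b : ℝ} (hb : 1 / 2 < b) :
    ∃ C : ℝ≥0, ∀ p : ℝ → ℝ, Measurable p → ∀ s : ℝ, ∀ g : ℝ × ℝ → ℂ, Measurable g → ∀ t : ℝ,
      weightedL2 s (slice g t) ≤ C * bourgainNorm p s b g := by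
  obtain ⟨C, hC⟩ := exists_l2_lintegral_enorm_le hb
  refine ⟨C, fun p hp s g hg t ↦ (l2_mono fun ξ ↦ ?_).trans (hC p hp s g hg)⟩
  exact mul_le_mul_right (enorm_slice_le g t ξ) _

theorem continuous_slice {g : ℝ × ℝ → ℂ} {ξ : ℝ} (h : Integrable fun τ ↦ g (τ, ξ)) :
    Continuous fun t ↦ slice g t ξ := by
  refine continuous_of_dominated (bound := fun τ ↦ ‖g (τ, ξ)‖) (fun t ↦ ?_) (fun t ↦ ?_) h.norm ?_
  · exact (by fun_prop : Continuous fun τ : ℝ ↦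
      Complex.exp (2 * Real.pi * Complex.I * t * τ)).aestronglyMeasurable.mul h.1
  · exact Eventually.of_forall fun τ ↦ by rw [norm_mul, norm_exp_two_pi, one_mul]
  · exact Eventually.of_forall fun τ ↦ by fun_prop

/-- The embedding of a Bourgain space in `C⁰(ℝ; H^s)`. -/
theorem tendsto_weightedL2_slice_sub {b : ℝ} (hb : 1 / 2 < b) {p : ℝ → ℝ} (hp : Measurable p)
    {s : ℝ} {g : ℝ × ℝ → ℂ} (hg : Measurable g) (h : bourgainNorm p s b g ≠ ∞) (t₀ : ℝ) :
    Tendsto (fun t ↦ weightedL2 s fun ξ ↦ slice g t ξ - slice g t₀ ξ) (𝓝 t₀) (𝓝 0) := by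
  obtain ⟨C, hC⟩ := exists_l2_lintegral_enorm_le hb
  have hfin : l2 (fun ξ ↦ bw s ξ * ∫⁻ τ, ‖g (τ, ξ)‖ₑ) ≠ ∞ :=
    ne_top_of_le_ne_top (by finiteness) (hC p hp s g hg)
  have hI : ∫⁻ ξ : ℝ, (2 * (bw s ξ * ∫⁻ τ : ℝ, ‖g (τ, ξ)‖ₑ)) ^ 2 ≠ ∞ := by
    rw [← l2_sq (fun ξ : ℝ ↦ 2 * (bw s ξ * ∫⁻ τ : ℝ, ‖g (τ, ξ)‖ₑ)),
      l2_const_mul ENNReal.ofNat_ne_top]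
    finiteness
  have h0 : Tendsto (fun t ↦ ∫⁻ ξ, (bw s ξ * ‖slice g t ξ - slice g t₀ ξ‖ₑ) ^ 2) (𝓝 t₀)
      (𝓝 (∫⁻ _ : ℝ, 0)) := by
    refine tendsto_lintegral_filter_of_dominated_convergence _
      (Eventually.of_forall fun t ↦ by fun_prop) (Eventually.of_forall fun t ↦
        Eventually.of_forall fun ξ ↦ ?_) hI ?_
    · refine pow_le_pow_left' ?_ 2
      rw [mul_left_comm, two_mul]
      refine mul_le_mul_right (enorm_sub_le.trans ?_) _
      exact add_le_add (enorm_slice_le g t ξ) (enorm_slice_le g t₀ ξ)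
    · filter_upwards [ae_integrable_slice hp hb hg h] with ξ hξ
      have h1 : Tendsto (fun t ↦ ‖slice g t ξ - slice g t₀ ξ‖ₑ) (𝓝 t₀) (𝓝 0) := by
        have hc : Continuous fun t ↦ ‖slice g t ξ - slice g t₀ ξ‖ₑ := by
          have := continuous_slice hξ
          fun_prop
        simpa using hc.tendsto t₀
      have h2 := ENNReal.Tendsto.const_mul (a := bw s ξ) h1 (Or.inr (bw_ne_top _ _))
      rw [mul_zero] at h2
      simpa [Function.comp_def] using ((ENNReal.continuous_pow 2).tendsto 0).comp h2
  rw [lintegral_zero] at h0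
  have h3 := (ENNReal.continuous_rpow_const (y := (1 / 2 : ℝ))).tendsto 0 |>.comp h0
  rwa [ENNReal.zero_rpow_of_pos (by norm_num)] at h3

/-- A Bourgain function has time slices that are tempered distributions. -/
theorem exists_evolution {b : ℝ} (hb : 1 / 2 < b) {p : ℝ → ℝ} (hp : Measurable p)
    {s : ℝ} {g : ℝ × ℝ → ℂ} (hg : Measurable g) (h : bourgainNorm p s b g ≠ ∞) :
    ∃ u : ℝ → 𝓢'(ℝ, ℂ), ∀ t, HasFourier (u t) (slice g t) := by
  obtain ⟨C, hC⟩ := exists_weightedL2_slice_le hb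
  have (t : ℝ) : ∃ f : 𝓢'(ℝ, ℂ), HasFourier f (slice g t) :=
    exists_hasFourier (measurable_slice hg t).aemeasurable
      (ne_top_of_le_ne_top (by finiteness) (hC p hp s g hg t))
  choose u hu using this
  exact ⟨u, hu⟩

/-- The embedding of a Bourgain space in `C⁰([-T, T]; H^s)`. -/
theorem continuousInSobolev_of_hasFourier {b : ℝ} (hb : 1 / 2 < b) {p : ℝ → ℝ}
    (hp : Measurable p) {s : ℝ} {g : ℝ × ℝ → ℂ} (hg : Measurable g)
    (h : bourgainNorm p s b g ≠ ∞) {u : ℝ → 𝓢'(ℝ, ℂ)} (hu : ∀ t, HasFourier (u t) (slice g t))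
    (T : ℝ) : ContinuousInSobolev s T u := by
  obtain ⟨C, hC⟩ := exists_weightedL2_slice_le hb
  have hfin : ∀ t, weightedL2 s (slice g t) ≠ ∞ := fun t ↦
    ne_top_of_le_ne_top (by finiteness) (hC p hp s g hg t)
  have hfin2 : ∀ t t₀, weightedL2 s (fun ξ ↦ slice g t ξ - slice g t₀ ξ) ≠ ∞ := fun t t₀ ↦ by
    refine ne_top_of_le_ne_top (ENNReal.add_ne_top.2 ⟨hfin t, hfin t₀⟩)
      (le_trans (l2_mono fun ξ ↦ ?_) (l2_add_le (by fun_prop) (by fun_prop)))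
    rw [← mul_add]; exact mul_le_mul_right enorm_sub_le _
  refine fun t₀ _ ↦ ⟨(hu t₀).memSobolev (hfin t₀), ?_⟩
  have e : (fun t ↦ sobolevNorm s (u t - u t₀)) =
      fun t ↦ weightedL2 s fun ξ ↦ slice g t ξ - slice g t₀ ξ := by
    ext t; exact ((hu t).sub (hu t₀)).sobolevNorm_eq (hfin2 t t₀)
  rw [e]
  exact (tendsto_weightedL2_slice_sub hb hp hg h t₀).mono_left nhdsWithin_le_nhds

theorem slice_congr {g g' : ℝ × ℝ → ℂ} (h : g =ᵐ[volume] g') :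
    ∀ᵐ ξ, ∀ t, slice g t ξ = slice g' t ξ := by
  filter_upwards [ae_ae_slice h] with ξ hξ t
  exact integral_congr_ae (hξ.mono fun τ hτ ↦ by simp only [hτ])

theorem slice_sub {g g' : ℝ × ℝ → ℂ} {ξ : ℝ} (h : Integrable fun τ ↦ g (τ, ξ))
    (h' : Integrable fun τ ↦ g' (τ, ξ)) (t : ℝ) :
    slice (fun z ↦ g z - g' z) t ξ = slice g t ξ - slice g' t ξ := by
  have hc : Continuous fun τ : ℝ ↦ Complex.exp (2 * Real.pi * Complex.I * t * τ) := by fun_prop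
  have hb : ∀ᵐ τ : ℝ, ‖Complex.exp (2 * Real.pi * Complex.I * t * τ)‖ ≤ 1 :=
    Eventually.of_forall fun τ ↦ (norm_exp_two_pi t τ).le
  simp only [slice, mul_sub]
  exact integral_sub (h.bdd_mul hc.aestronglyMeasurable hb) (h'.bdd_mul hc.aestronglyMeasurable hb)

theorem slice_add {g g' : ℝ × ℝ → ℂ} {ξ : ℝ} (h : Integrable fun τ ↦ g (τ, ξ))
    (h' : Integrable fun τ ↦ g' (τ, ξ)) (t : ℝ) :
    slice (fun z ↦ g z + g' z) t ξ = slice g t ξ + slice g' t ξ := by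
  have hc : Continuous fun τ : ℝ ↦ Complex.exp (2 * Real.pi * Complex.I * t * τ) := by fun_prop
  have hb : ∀ᵐ τ : ℝ, ‖Complex.exp (2 * Real.pi * Complex.I * t * τ)‖ ≤ 1 :=
    Eventually.of_forall fun τ ↦ (norm_exp_two_pi t τ).le
  simp only [slice, mul_add]
  exact integral_add (h.bdd_mul hc.aestronglyMeasurable hb) (h'.bdd_mul hc.aestronglyMeasurable hb)

/-! ### Translations in time -/

/-- The space-time Fourier transform of a translate in time. -/
def timeShift (t₀ : ℝ) (g : ℝ × ℝ → ℂ) (z : ℝ × ℝ) : ℂ :=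
  Complex.exp (2 * Real.pi * Complex.I * t₀ * z.1) * g z

@[fun_prop]
theorem measurable_timeShift {g : ℝ × ℝ → ℂ} (hg : Measurable g) (t₀ : ℝ) :
    Measurable (timeShift t₀ g) := by unfold timeShift; fun_prop

theorem slice_timeShift (t₀ : ℝ) (g : ℝ × ℝ → ℂ) (t ξ : ℝ) :
    slice (timeShift t₀ g) t ξ = slice g (t₀ + t) ξ := by
  simp only [slice, timeShift, ← mul_assoc, ← Complex.exp_add]
  congr 1; ext τ; congr 2; push_cast; ring

theorem enorm_timeShift (t₀ : ℝ) (g : ℝ × ℝ → ℂ) (z : ℝ × ℝ) : ‖timeShift t₀ g z‖ₑ = ‖g z‖ₑ := by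
  rw [timeShift, enorm_mul, enorm_exp_two_pi, one_mul]

theorem bourgainNorm_timeShift (p : ℝ → ℝ) (s b t₀ : ℝ) (g : ℝ × ℝ → ℂ) :
    bourgainNorm p s b (timeShift t₀ g) = bourgainNorm p s b g := by
  simp only [bourgainNorm, enorm_timeShift]

/-- The semigroup property of the Duhamel kernel. -/
theorem duhamelKernel_add (p : ℝ → ℝ) (t₀ t τ ξ : ℝ) :
    duhamelKernel (phaseGroup p) (t₀ + t) τ ξ =
      phaseGroup p t ξ * duhamelKernel (phaseGroup p) t₀ τ ξ +
        Complex.exp (2 * Real.pi * Complex.I * t₀ * τ) * duhamelKernel (phaseGroup p) t τ ξ := by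
  have hi : ∀ a b : ℝ, IntervalIntegrable (fun r : ℝ ↦ phaseGroup p (t₀ + t - r) ξ *
      Complex.exp (2 * Real.pi * Complex.I * r * τ)) volume a b := fun a b ↦ by
    refine Continuous.intervalIntegrable ?_ a b
    unfold phaseGroup; fun_prop
  simp only [duhamelKernel]
  rw [← intervalIntegral.integral_add_adjacent_intervals (hi 0 t₀) (hi t₀ (t₀ + t)),
    ← intervalIntegral.integral_const_mul, ← intervalIntegral.integral_const_mul]
  congr 1
  · congr 1; ext r
    rw [← mul_assoc, phaseGroup, phaseGroup, phaseGroup, ← Complex.exp_add, ← Complex.exp_add,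
      ← Complex.exp_add]
    congr 1; push_cast; ring
  · have h := intervalIntegral.integral_comp_add_left (a := 0) (b := t) (fun r : ℝ ↦
      phaseGroup p (t₀ + t - r) ξ * Complex.exp (2 * Real.pi * Complex.I * r * τ)) t₀
    rw [add_zero] at h
    rw [← h]
    congr 1; ext r
    rw [mul_left_comm, ← Complex.exp_add, add_sub_add_left_eq_sub]
    congr 2; push_cast; ring

theorem duhamelSlice_add_time {p : ℝ → ℝ} (hp : Measurable p) {F : ℝ × ℝ → ℂ}
    (hF : Measurable F) {ξ : ℝ} (h : ∫⁻ τ, bw (-1) (τ + p ξ) * ‖F (τ, ξ)‖ₑ ≠ ∞) (t₀ t : ℝ) :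
    duhamelSlice p F (t₀ + t) ξ =
      phaseGroup p t ξ * duhamelSlice p F t₀ ξ + duhamelSlice p (timeShift t₀ F) t ξ := by
  have h' : ∫⁻ τ, bw (-1) (τ + p ξ) * ‖timeShift t₀ F (τ, ξ)‖ₑ ≠ ∞ := by
    simpa only [enorm_timeShift] using h
  have i1 := (integrable_duhamelKernel_mul hp hF h t₀).const_mul (phaseGroup p t ξ)
  have i2 := integrable_duhamelKernel_mul hp (measurable_timeShift hF t₀) h' t
  rw [duhamelSlice, duhamelSlice, duhamelSlice, ← integral_const_mul, ← integral_add i1 i2]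
  refine integral_congr_ae (Eventually.of_forall fun τ ↦ ?_)
  simp only [duhamelKernel_add, timeShift]
  ring

/-! ### Linearity of the Duhamel operators -/

theorem integrable_truncKernel_mul {δ : ℝ} (hδ : 0 < δ) (hδ1 : δ ≤ 1) {p : ℝ → ℝ}
    {F : ℝ × ℝ → ℂ} (hF : Measurable F) {ξ : ℝ}
    (h : ∫⁻ τ, bw (-1) (τ + p ξ) * ‖F (τ, ξ)‖ₑ ≠ ∞) (x : ℝ) :
    Integrable fun y ↦ truncKernel δ (x + p ξ) (y + p ξ) * F (y, ξ) := by
  obtain ⟨C, hC⟩ := exists_weighted_truncKernel_le (a := 1) (b := 0) (by norm_num) le_rfl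
    (by norm_num)
  have hk := measurable_truncKernel_right δ (x + p ξ)
  refine ⟨(by fun_prop : Measurable _).aestronglyMeasurable, ?_⟩
  calc _ ≤ ∫⁻ y, (C * ENNReal.ofReal (δ ^ ((2 : ℝ) - 1 - 0)) * (1 + 1)) *
        (bw (-1) (y + p ξ) * ‖F (y, ξ)‖ₑ) := by
        refine lintegral_mono fun y ↦ ?_
        rw [enorm_mul, ← mul_assoc]
        refine mul_le_mul_left ?_ _
        have := mul_le_mul_left (hC δ (x + p ξ) (y + p ξ) hδ hδ1) (bw (-1) (y + p ξ))
        rw [mul_assoc _ (bw 1 _), bw_mul_neg, bw_zero, one_mul, mul_one, sub_self, bw_zero,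
          mul_one] at this
        refine this.trans ?_
        gcongr <;> exact bw_le_one (by norm_num) _
    _ = _ := lintegral_const_mul' _ _ (by finiteness)
    _ < ∞ := by finiteness

theorem duhamelOp_congr {δ : ℝ} {p : ℝ → ℝ} {F F' : ℝ × ℝ → ℂ} (h : F =ᵐ[volume] F') :
    duhamelOp δ p F =ᵐ[volume] duhamelOp δ p F' := by
  filter_upwards [ae_of_ae_snd (ae_ae_slice h)] with z hz
  exact integral_congr_ae (hz.mono fun τ hτ ↦ by simp only [hτ])

theorem duhamelSlice_congr {p : ℝ → ℝ} {F F' : ℝ × ℝ → ℂ} (h : F =ᵐ[volume] F') :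
    ∀ᵐ ξ, ∀ t, duhamelSlice p F t ξ = duhamelSlice p F' t ξ := by
  filter_upwards [ae_ae_slice h] with ξ hξ t
  exact integral_congr_ae (hξ.mono fun τ hτ ↦ by simp only [hτ])

theorem duhamelOp_sub {δ : ℝ} (hδ : 0 < δ) (hδ1 : δ ≤ 1) {p : ℝ → ℝ} {F F' : ℝ × ℝ → ℂ}
    (hF : Measurable F) (hF' : Measurable F') {ξ : ℝ}
    (h : ∫⁻ τ, bw (-1) (τ + p ξ) * ‖F (τ, ξ)‖ₑ ≠ ∞)
    (h' : ∫⁻ τ, bw (-1) (τ + p ξ) * ‖F' (τ, ξ)‖ₑ ≠ ∞) (τ : ℝ) :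
    duhamelOp δ p (fun z ↦ F z - F' z) (τ, ξ) =
      duhamelOp δ p F (τ, ξ) - duhamelOp δ p F' (τ, ξ) := by
  simp only [duhamelOp, mul_sub]
  exact integral_sub (integrable_truncKernel_mul hδ hδ1 hF h τ)
    (integrable_truncKernel_mul hδ hδ1 hF' h' τ)

theorem duhamelSlice_sub {p : ℝ → ℝ} (hp : Measurable p) {F F' : ℝ × ℝ → ℂ}
    (hF : Measurable F) (hF' : Measurable F') {ξ : ℝ}
    (h : ∫⁻ τ, bw (-1) (τ + p ξ) * ‖F (τ, ξ)‖ₑ ≠ ∞)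
    (h' : ∫⁻ τ, bw (-1) (τ + p ξ) * ‖F' (τ, ξ)‖ₑ ≠ ∞) (t : ℝ) :
    duhamelSlice p (fun z ↦ F z - F' z) t ξ = duhamelSlice p F t ξ - duhamelSlice p F' t ξ := by
  simp only [duhamelSlice, mul_sub]
  exact integral_sub (integrable_duhamelKernel_mul hp hF h t)
    (integrable_duhamelKernel_mul hp hF' h' t)

/-! ### Bourgain norms of sums -/

theorem bourgainNorm_add_le {p : ℝ → ℝ} (hp : Measurable p) {s b : ℝ} {g g' : ℝ × ℝ → ℂ}
    (hg : Measurable g) (hg' : Measurable g') :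
    bourgainNorm p s b (fun z ↦ g z + g' z) ≤ bourgainNorm p s b g + bourgainNorm p s b g' := by
  refine le_trans (l2_mono fun z ↦ ?_) (l2_add_le (by fun_prop) (by fun_prop))
  rw [← mul_add]; exact mul_le_mul_right (enorm_add_le _ _) _

theorem bourgainNorm_sub_le {p : ℝ → ℝ} (hp : Measurable p) {s b : ℝ} {g g' : ℝ × ℝ → ℂ}
    (hg : Measurable g) (hg' : Measurable g') :
    bourgainNorm p s b (fun z ↦ g z - g' z) ≤ bourgainNorm p s b g + bourgainNorm p s b g' := by
  refine le_trans (l2_mono fun z ↦ ?_) (l2_add_le (by fun_prop) (by fun_prop))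
  rw [← mul_add]; exact mul_le_mul_right enorm_sub_le _

theorem bourgainNorm_congr {p : ℝ → ℝ} {s b : ℝ} {g g' : ℝ × ℝ → ℂ} (h : g =ᵐ[volume] g') :
    bourgainNorm p s b g = bourgainNorm p s b g' :=
  l2_congr_ae (h.mono fun z hz ↦ by simp only [hz])

/-! ### Products in Bourgain spaces -/

section

/-- The data of a Bourgain space: the dispersion and the two exponents. -/
structure BourgainSpace where
  /-- The dispersion. -/
  phase : ℝ → ℝ
  /-- The exponent of the spatial weight. -/
  s : ℝ
  /-- The exponent of the weight in the modulation. -/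
  b : ℝ
  measurable_phase : Measurable phase
  half_lt : 1 / 2 < b

namespace BourgainSpace

/-- The norm, as a function of the space-time Fourier transform. -/
def norm (X : BourgainSpace) (g : ℝ × ℝ → ℂ) : ℝ≥0∞ := bourgainNorm X.phase X.s X.b g

/-- The weight that defines the norm. -/
def weight (X : BourgainSpace) (z : ℝ × ℝ) : ℝ≥0∞ := bourgainWeight X.phase X.s X.b z

/-- The space of the complex conjugates. -/
def conjugate (X : BourgainSpace) : BourgainSpace where
  phase := fun ξ ↦ -X.phase (-ξ)
  s := X.s
  b := X.b
  measurable_phase := (X.measurable_phase.comp measurable_neg).neg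
  half_lt := X.half_lt

theorem conjugate_weight (X : BourgainSpace) (z : ℝ × ℝ) : X.conjugate.weight z =
    X.weight (-z) := by
  simp only [weight, bourgainWeight, modWeight, conjugate, Prod.fst_neg, Prod.snd_neg]
  rw [bw_neg_arg, ← bw_neg_arg X.b]
  congr 2; ring

end BourgainSpace

@[fun_prop]
theorem measurable_conjFourier {g : ℝ × ℝ → ℂ} (hg : Measurable g) : Measurable (conjFourier g) :=
  Complex.continuous_conj.measurable.comp (hg.comp measurable_neg)

theorem BourgainSpace.norm_conjFourier (X : BourgainSpace) (g : ℝ × ℝ → ℂ) :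
    X.conjugate.norm (conjFourier g) = X.norm g := by
  have h := (Measure.measurePreserving_neg (volume : Measure (ℝ × ℝ))).lintegral_comp_emb
    (MeasurableEquiv.neg (ℝ × ℝ)).measurableEmbedding (fun z ↦ (X.weight z * ‖g z‖ₑ) ^ 2)
  change l2 (fun z ↦ X.conjugate.weight z * ‖conjFourier g z‖ₑ) = l2 fun z ↦ X.weight z * ‖g z‖ₑ
  simp only [X.conjugate_weight, conjFourier, RCLike.enorm_conj]
  rw [l2, l2, h]

theorem conj_exp_two_pi (t x : ℝ) : conj (Complex.exp (2 * Real.pi * Complex.I * t * x)) =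
    Complex.exp (2 * Real.pi * Complex.I * t * (-x : ℝ)) := by
  rw [← Complex.exp_conj]
  congr 1
  simp only [map_mul, Complex.conj_I, Complex.conj_ofReal, map_ofNat]
  push_cast; ring

theorem slice_conjFourier (g : ℝ × ℝ → ℂ) (t ξ : ℝ) :
    slice (conjFourier g) t ξ = conj (slice g t (-ξ)) := by
  rw [slice, slice, ← integral_conj, ← integral_neg_eq_self]
  refine integral_congr_ae (Eventually.of_forall fun τ ↦ ?_)
  simp only [conjFourier, map_mul, conj_exp_two_pi, Prod.neg_mk, neg_neg]

theorem conjFourier_timeShift (t₀ : ℝ) (g : ℝ × ℝ → ℂ) :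
    conjFourier (timeShift t₀ g) = timeShift t₀ (conjFourier g) := by
  ext z
  simp only [conjFourier, timeShift, map_mul, conj_exp_two_pi, Prod.fst_neg, neg_neg]

/-- The Fourier transform of the product of two functions, followed by the Fourier multiplier with
symbol `m`. -/
def prodOp (m : ℝ → ℂ) (f g : ℝ × ℝ → ℂ) (z : ℝ × ℝ) : ℂ := m z.2 * productFourier f g z

@[fun_prop]
theorem measurable_prodOp {m : ℝ → ℂ} (hm : Measurable m) {f g : ℝ × ℝ → ℂ} (hf : Measurable f)
    (hg : Measurable g) : Measurable (prodOp m f g) := by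
  have : Measurable fun w : (ℝ × ℝ) × (ℝ × ℝ) ↦ f (w.1 - w.2) * g w.2 := by fun_prop
  have h := this.stronglyMeasurable.integral_prod_right' (ν := volume)
  exact (hm.comp measurable_snd).mul h.measurable

theorem productFourier_comm (f g : ℝ × ℝ → ℂ) : productFourier f g = productFourier g f := by
  ext z
  rw [productFourier, productFourier, ← integral_sub_left_eq_self _ volume z]
  simp only [sub_sub_cancel, mul_comm]

theorem prodOp_comm (m : ℝ → ℂ) (f g : ℝ × ℝ → ℂ) : prodOp m f g = prodOp m g f := by
  ext z; rw [prodOp, prodOp, productFourier_comm]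

theorem lconv_comm (f g : ℝ × ℝ → ℝ≥0∞) : lconv f g = lconv g f := by
  ext z
  rw [lconv, lconv, ← lintegral_sub_left_eq_self _ z]
  simp only [sub_sub_cancel, mul_comm]

theorem prodOp_congr (m : ℝ → ℂ) {f f' g g' : ℝ × ℝ → ℂ} (hf : f =ᵐ[volume] f')
    (hg : g =ᵐ[volume] g') : prodOp m f g = prodOp m f' g' := by
  funext z
  rw [prodOp, prodOp, productFourier, productFourier]
  congr 1
  refine integral_congr_ae ?_
  filter_upwards [ae_comp_sub_left hf z, hg] with z₁ h1 h2
  simp only [h1, h2]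

theorem enorm_prodOp_le (m : ℝ → ℂ) (f g : ℝ × ℝ → ℂ) (z : ℝ × ℝ) :
    ‖prodOp m f g z‖ₑ ≤ ‖m z.2‖ₑ * lconv (fun z ↦ ‖f z‖ₑ) (fun z ↦ ‖g z‖ₑ) z := by
  rw [prodOp, enorm_mul]
  refine mul_le_mul_right ((enorm_integral_le_lintegral_enorm _).trans (le_of_eq ?_)) _
  simp only [enorm_mul, lconv]

theorem timeShift_prodOp (t₀ : ℝ) (m : ℝ → ℂ) (f g : ℝ × ℝ → ℂ) :
    timeShift t₀ (prodOp m f g) = prodOp m (timeShift t₀ f) (timeShift t₀ g) := by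
  ext z
  simp only [timeShift, prodOp, productFourier]
  rw [mul_left_comm, ← integral_const_mul]
  congr 2; ext z₁
  rw [mul_mul_mul_comm, ← Complex.exp_add]
  congr 2
  rw [Prod.fst_sub]; push_cast; ring

theorem integrable_product {f g : ℝ × ℝ → ℂ} (hf : Measurable f) (hg : Measurable g) {z : ℝ × ℝ}
    (h : lconv (fun z ↦ ‖f z‖ₑ) (fun z ↦ ‖g z‖ₑ) z ≠ ∞) :
    Integrable fun z₁ ↦ f (z - z₁) * g z₁ := by
  refine ⟨(by fun_prop : Measurable _).aestronglyMeasurable, lt_top_iff_ne_top.2 ?_⟩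
  simpa only [enorm_mul, lconv] using h

/-- The product, followed by the Fourier multiplier with symbol `m`, is bounded from `X₁ × X₂` to
the space `Y` with modulation exponent `-a`. The bound is for absolute values; together with
`m ≠ 0` almost everywhere it yields the absolute convergence of the convolution integrals. -/
structure ProductBound (m : ℝ → ℂ) (X₁ X₂ Y : BourgainSpace) (a : ℝ) (C : ℝ≥0) : Prop where
  measurable : Measurable m
  ne_zero : ∀ᵐ ξ, m ξ ≠ 0
  lt_half : a < 1 / 2
  bound : ∀ f g : ℝ × ℝ → ℝ≥0∞, Measurable f → Measurable g →
    l2 (fun z ↦ bourgainWeight Y.phase Y.s (-a) z * (‖m z.2‖ₑ * lconv f g z)) ≤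
      C * (l2 (fun z ↦ X₁.weight z * f z) * l2 (fun z ↦ X₂.weight z * g z))

namespace ProductBound

variable {m : ℝ → ℂ} {X₁ X₂ Y : BourgainSpace} {a : ℝ} {C : ℝ≥0} {f f' g g' : ℝ × ℝ → ℂ}

theorem bourgainNorm_le (H : ProductBound m X₁ X₂ Y a C) (hf : Measurable f) (hg : Measurable g) :
    bourgainNorm Y.phase Y.s (-a) (prodOp m f g) ≤ C * (X₁.norm f * X₂.norm g) :=
  (l2_mono fun z ↦ mul_le_mul_right (enorm_prodOp_le m f g z) _).trans
    (H.bound _ _ (by fun_prop) (by fun_prop))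

theorem ae_lintegral_lconv (H : ProductBound m X₁ X₂ Y a C) (hf : Measurable f)
    (hg : Measurable g) (hf' : X₁.norm f ≠ ∞) (hg' : X₂.norm g ≠ ∞) :
    ∀ᵐ ξ, ∫⁻ τ, bw (-1) (τ + Y.phase ξ) * lconv (fun z ↦ ‖f z‖ₑ) (fun z ↦ ‖g z‖ₑ) (τ, ξ) ≠ ∞ := by
  have hm := H.measurable
  have hl := measurable_lconv (f := fun z ↦ ‖f z‖ₑ) (g := fun z ↦ ‖g z‖ₑ) (by fun_prop)
    (by fun_prop)
  have h1 := ae_lintegral_bw_mul_ne_top Y.measurable_phase (s := Y.s) H.lt_half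
    (F := fun z ↦ ‖m z.2‖ₑ * lconv (fun z ↦ ‖f z‖ₑ) (fun z ↦ ‖g z‖ₑ) z) (by fun_prop)
    (ne_top_of_le_ne_top (ENNReal.mul_ne_top (by finiteness) (ENNReal.mul_ne_top hf' hg'))
      (H.bound (fun z ↦ ‖f z‖ₑ) (fun z ↦ ‖g z‖ₑ) (by fun_prop) (by fun_prop)))
  filter_upwards [h1, H.ne_zero] with ξ hξ h0
  simp only [mul_left_comm _ ‖m ξ‖ₑ] at hξ
  rw [lintegral_const_mul' _ _ (by finiteness)] at hξ
  intro ht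
  rw [ht, ENNReal.mul_top (by simpa using h0)] at hξ
  exact hξ rfl

theorem ae_lintegral_prodOp (H : ProductBound m X₁ X₂ Y a C) (hf : Measurable f)
    (hg : Measurable g) (hf' : X₁.norm f ≠ ∞) (hg' : X₂.norm g ≠ ∞) :
    ∀ᵐ ξ, ∫⁻ τ, bw (-1) (τ + Y.phase ξ) * ‖prodOp m f g (τ, ξ)‖ₑ ≠ ∞ := by
  filter_upwards [H.ae_lintegral_lconv hf hg hf' hg'] with ξ hξ
  refine ne_top_of_le_ne_top (b := ‖m ξ‖ₑ * _) (ENNReal.mul_ne_top (by finiteness) hξ) ?_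
  rw [← lintegral_const_mul' _ _ (by finiteness)]
  refine lintegral_mono fun τ ↦ ?_
  rw [mul_left_comm]
  exact mul_le_mul_right (enorm_prodOp_le m f g (τ, ξ)) _

theorem ae_lconv_ne_top (H : ProductBound m X₁ X₂ Y a C) (hf : Measurable f)
    (hg : Measurable g) (hf' : X₁.norm f ≠ ∞) (hg' : X₂.norm g ≠ ∞) :
    ∀ᵐ z, lconv (fun z ↦ ‖f z‖ₑ) (fun z ↦ ‖g z‖ₑ) z ≠ ∞ := by
  have hm := H.measurable
  have hY := Y.measurable_phase
  have hl := measurable_lconv (f := fun z ↦ ‖f z‖ₑ) (g := fun z ↦ ‖g z‖ₑ) (by fun_prop)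
    (by fun_prop)
  have h1 := ne_top_of_le_ne_top (ENNReal.mul_ne_top (by finiteness) (ENNReal.mul_ne_top hf' hg'))
      (H.bound (fun z ↦ ‖f z‖ₑ) (fun z ↦ ‖g z‖ₑ) (by fun_prop) (by fun_prop))
  have h2 := ENNReal.pow_ne_top (n := 2) h1
  rw [l2_sq] at h2
  filter_upwards [ae_lt_top (by fun_prop) h2, ae_of_ae_snd H.ne_zero] with z hz h0 ht
  rw [ht, ENNReal.mul_top (by simpa using h0), ENNReal.mul_top] at hz
  · simp at hz
  · exact mul_ne_zero (bw_ne_zero _ _) (bw_ne_zero _ _)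

theorem productConverges (H : ProductBound m X₁ X₂ Y a C) (hf : Measurable f)
    (hg : Measurable g) (hf' : X₁.norm f ≠ ∞) (hg' : X₂.norm g ≠ ∞) : ProductConverges f g :=
  (H.ae_lconv_ne_top hf hg hf' hg').mono fun _ hz ↦ integrable_product hf hg hz

theorem prodOp_sub_left (H : ProductBound m X₁ X₂ Y a C) (hf : Measurable f)
    (hf' : Measurable f') (hg : Measurable g) (nf : X₁.norm f ≠ ∞) (nf' : X₁.norm f' ≠ ∞)
    (ng : X₂.norm g ≠ ∞) :
    prodOp m (fun z ↦ f z - f' z) g =ᵐ[volume] fun z ↦ prodOp m f g z - prodOp m f' g z := by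
  filter_upwards [H.productConverges hf hg nf ng, H.productConverges hf' hg nf' ng] with z h1 h2
  simp only [prodOp, productFourier, sub_mul]
  rw [integral_sub h1 h2, mul_sub]

theorem prodOp_sub_right (H : ProductBound m X₁ X₂ Y a C) (hf : Measurable f)
    (hg : Measurable g) (hg' : Measurable g') (nf : X₁.norm f ≠ ∞) (ng : X₂.norm g ≠ ∞)
    (ng' : X₂.norm g' ≠ ∞) :
    prodOp m f (fun z ↦ g z - g' z) =ᵐ[volume] fun z ↦ prodOp m f g z - prodOp m f g' z := by
  filter_upwards [H.productConverges hf hg nf ng, H.productConverges hf hg' nf ng'] with z h1 h2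
  simp only [prodOp, productFourier, mul_sub]
  rw [integral_sub h1 h2, mul_sub]

theorem duhamelSlice_sub_left (H : ProductBound m X₁ X₂ Y a C) (hf : Measurable f)
    (hf' : Measurable f') (hg : Measurable g) (nf : X₁.norm f ≠ ∞) (nf' : X₁.norm f' ≠ ∞)
    (ng : X₂.norm g ≠ ∞) :
    ∀ᵐ ξ, ∀ t, duhamelSlice Y.phase (prodOp m (fun z ↦ f z - f' z) g) t ξ =
      duhamelSlice Y.phase (prodOp m f g) t ξ - duhamelSlice Y.phase (prodOp m f' g) t ξ := by
  have hm := H.measurable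
  filter_upwards [duhamelSlice_congr (p := Y.phase) (H.prodOp_sub_left hf hf' hg nf nf' ng),
    H.ae_lintegral_prodOp hf hg nf ng, H.ae_lintegral_prodOp hf' hg nf' ng] with ξ h1 h2 h3 t
  rw [h1, duhamelSlice_sub Y.measurable_phase (by fun_prop) (by fun_prop) h2 h3]

theorem duhamelSlice_sub_right (H : ProductBound m X₁ X₂ Y a C) (hf : Measurable f)
    (hg : Measurable g) (hg' : Measurable g') (nf : X₁.norm f ≠ ∞) (ng : X₂.norm g ≠ ∞)
    (ng' : X₂.norm g' ≠ ∞) :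
    ∀ᵐ ξ, ∀ t, duhamelSlice Y.phase (prodOp m f (fun z ↦ g z - g' z)) t ξ =
      duhamelSlice Y.phase (prodOp m f g) t ξ - duhamelSlice Y.phase (prodOp m f g') t ξ := by
  have hm := H.measurable
  filter_upwards [duhamelSlice_congr (p := Y.phase) (H.prodOp_sub_right hf hg hg' nf ng ng'),
    H.ae_lintegral_prodOp hf hg nf ng, H.ae_lintegral_prodOp hf hg' nf ng'] with ξ h1 h2 h3 t
  rw [h1, duhamelSlice_sub Y.measurable_phase (by fun_prop) (by fun_prop) h2 h3]

theorem slice_duhamelOp (H : ProductBound m X₁ X₂ Y a C) (hf : Measurable f)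
    (hg : Measurable g) (hf' : X₁.norm f ≠ ∞) (hg' : X₂.norm g ≠ ∞) {δ : ℝ} (hδ : 0 < δ)
    (hδ1 : δ ≤ 1) :
    ∀ᵐ ξ, ∀ t, slice (duhamelOp δ Y.phase (prodOp m f g)) t ξ =
      cutoff (t / δ) * duhamelSlice Y.phase (prodOp m f g) t ξ := by
  have hm := H.measurable
  filter_upwards [H.ae_lintegral_prodOp hf hg hf' hg'] with ξ hξ t
  exact SBO.slice_duhamelOp hδ hδ1 (by fun_prop) hξ t

/-- The Duhamel integral up to time `t` of a product vanishes if one factor vanishes on the time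
interval between `0` and `t`. After Fubini's theorem the other factor enters only through a fixed
frequency `z₁`, and what remains is a time integral of the slices of the first factor. -/
theorem duhamelSlice_eq_zero (H : ProductBound m X₁ X₂ Y a C) (hf : Measurable f)
    (hg : Measurable g) (nf : X₁.norm f ≠ ∞) (ng : X₂.norm g ≠ ∞) {t : ℝ}
    (h0 : ∀ r ∈ uIcc 0 t, ∀ᵐ ξ, slice f r ξ = 0) :
    ∀ᵐ ξ, duhamelSlice Y.phase (prodOp m f g) t ξ = 0 := by
  have hY := Y.measurable_phase
  -- for almost every frequency, the slices of `f` vanish for almost every time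
  have hsl : ∀ᵐ ξ, ∀ᵐ r ∂(volume.restrict (uIcc 0 t)), slice f r ξ = 0 := by
    have hmeas : Measurable fun w : ℝ × ℝ ↦ slice f w.1 w.2 := by
      have : Measurable fun w : (ℝ × ℝ) × ℝ ↦
          Complex.exp (2 * Real.pi * Complex.I * w.1.1 * w.2) * f (w.2, w.1.2) := by fun_prop
      exact this.stronglyMeasurable.integral_prod_right'.measurable
    have hset : MeasurableSet {w : ℝ × ℝ | slice f w.1 w.2 = 0} :=
      hmeas (measurableSet_singleton 0)
    refine (Measure.ae_ae_comm (μ := volume.restrict (uIcc 0 t)) hset).1 ?_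
    exact (ae_restrict_iff' measurableSet_uIcc).2 (Eventually.of_forall h0)
  have hint := ae_integrable_slice X₁.measurable_phase X₁.half_lt hf nf
  filter_upwards [H.ae_lintegral_lconv hf hg nf ng] with ξ hξ
  have hK := measurable_duhamelKernel hY t
  have hKξ : Measurable fun τ ↦ duhamelKernel (phaseGroup Y.phase) t τ ξ :=
    hK.comp (f := fun τ ↦ (τ, ξ)) (by fun_prop)
  have hm2 : Measurable fun w : ℝ × (ℝ × ℝ) ↦ duhamelKernel (phaseGroup Y.phase) t w.1 ξ *
      (f ((w.1, ξ) - w.2) * g w.2) := by fun_prop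
  have hfub : Integrable (fun w : ℝ × (ℝ × ℝ) ↦ duhamelKernel (phaseGroup Y.phase) t w.1 ξ *
      (f ((w.1, ξ) - w.2) * g w.2)) (volume.prod volume) := by
    refine ⟨hm2.aestronglyMeasurable, ?_⟩
    rw [hasFiniteIntegral_iff_enorm, lintegral_prod _ (by fun_prop)]
    simp only [enorm_mul]
    calc _ ≤ ∫⁻ τ, ENNReal.ofReal (|t| + 1) * (bw (-1) (τ + Y.phase ξ) *
          lconv (fun z ↦ ‖f z‖ₑ) (fun z ↦ ‖g z‖ₑ) (τ, ξ)) := by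
          refine lintegral_mono fun τ ↦ ?_
          rw [lintegral_const_mul _ (by fun_prop), ← mul_assoc]
          exact mul_le_mul_left (enorm_duhamelKernel_le _ _ _ _) _
      _ = ENNReal.ofReal (|t| + 1) * _ := lintegral_const_mul' _ _ (by finiteness)
      _ < ∞ := by finiteness
  have e1 : duhamelSlice Y.phase (prodOp m f g) t ξ = m ξ * ∫ τ, ∫ z₁,
      duhamelKernel (phaseGroup Y.phase) t τ ξ * (f ((τ, ξ) - z₁) * g z₁) := by
    simp only [duhamelSlice, prodOp, productFourier, mul_left_comm _ (m ξ), integral_const_mul]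
  rw [e1, integral_integral_swap hfub]
  have hP : ∀ᵐ z₁ : ℝ × ℝ, (Integrable fun τ ↦ f (τ, ξ - z₁.2)) ∧
      ∀ᵐ r ∂(volume.restrict (uIcc 0 t)), slice f r (ξ - z₁.2) = 0 := by
    refine ae_of_ae_snd (P := fun ξ₁ ↦ (Integrable fun τ ↦ f (τ, ξ - ξ₁)) ∧
      ∀ᵐ r ∂(volume.restrict (uIcc 0 t)), slice f r (ξ - ξ₁) = 0) ?_
    exact (Measure.measurePreserving_sub_left volume ξ).quasiMeasurePreserving.ae (hint.and hsl)
  have hz : ∀ᵐ z₁ : ℝ × ℝ, ∫ τ, duhamelKernel (phaseGroup Y.phase) t τ ξ *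
      (f ((τ, ξ) - z₁) * g z₁) = 0 := by
    filter_upwards [hP] with z₁ hz₁
    have e2 := duhamel_formula (phaseGroup Y.phase) (fun ξ ↦ by unfold phaseGroup; fun_prop) t ξ
      (fun z ↦ f (z.1 - z₁.1, ξ - z₁.2)) (hz₁.1.comp_sub_right z₁.1)
    have e3 : ∀ r : ℝ, ∫ τ : ℝ, Complex.exp (2 * Real.pi * Complex.I * r * τ) *
        f (τ - z₁.1, ξ - z₁.2) =
        Complex.exp (2 * Real.pi * Complex.I * r * z₁.1) * slice f r (ξ - z₁.2) := by
      intro r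
      rw [slice, ← integral_sub_right_eq_self (fun τ : ℝ ↦ Complex.exp (2 * Real.pi * Complex.I *
        r * τ) * f (τ, ξ - z₁.2)) z₁.1, ← integral_const_mul]
      congr 1; ext τ
      rw [← mul_assoc, ← Complex.exp_add]
      congr 2; push_cast; ring
    simp only [e3] at e2
    simp only [← mul_assoc]
    rw [integral_mul_const]
    have e4 : ∫ τ, duhamelKernel (phaseGroup Y.phase) t τ ξ * f ((τ, ξ) - z₁) = 0 := by
      refine e2.trans ?_
      refine intervalIntegral.integral_zero_ae ?_
      have := (ae_restrict_iff' measurableSet_uIcc).1 hz₁.2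
      filter_upwards [this] with r hr hrt
      rw [hr (uIoc_subset_uIcc hrt), mul_zero, mul_zero]
    rw [e4, zero_mul]
  rw [integral_eq_zero_of_ae hz, mul_zero]

theorem symm (H : ProductBound m X₁ X₂ Y a C) : ProductBound m X₂ X₁ Y a C where
  measurable := H.measurable
  ne_zero := H.ne_zero
  lt_half := H.lt_half
  bound := fun f g hf hg ↦ by
    rw [lconv_comm, mul_comm (l2 _)]
    exact H.bound g f hg hf

end ProductBound

end

/-! ### Bourgain spaces as Banach spaces -/

section

namespace BourgainSpace

/-- The weight that defines the norm, as a complex number. -/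
def cweight (X : BourgainSpace) (z : ℝ × ℝ) : ℂ :=
  ((bracket z.2 ^ X.s * bracket (z.1 + X.phase z.2) ^ X.b : ℝ) : ℂ)

theorem cweight_ne_zero (X : BourgainSpace) (z : ℝ × ℝ) : X.cweight z ≠ 0 := by
  have h1 := bracket_rpow_pos X.s z.2
  have h2 := bracket_rpow_pos X.b (z.1 + X.phase z.2)
  exact Complex.ofReal_ne_zero.2 (by positivity)

theorem enorm_cweight_mul (X : BourgainSpace) (z : ℝ × ℝ) (c : ℂ) :
    ‖X.cweight z * c‖ₑ = X.weight z * ‖c‖ₑ := by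
  rw [cweight, Complex.ofReal_mul, mul_assoc, enorm_bracket_rpow_mul, enorm_bracket_rpow_mul,
    weight, bourgainWeight, modWeight, mul_assoc]

@[fun_prop]
theorem measurable_cweight (X : BourgainSpace) : Measurable X.cweight := by
  have h1 := (continuous_bracket_rpow X.s).measurable
  have h2 := (continuous_bracket_rpow X.b).measurable
  have h3 := X.measurable_phase
  have h4 : Measurable fun z : ℝ × ℝ ↦ bracket (z.1 + X.phase z.2) ^ X.b :=
    h2.comp (f := fun z : ℝ × ℝ ↦ z.1 + X.phase z.2) (by fun_prop)
  exact Complex.measurable_ofReal.comp ((h1.comp measurable_snd).mul h4)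

theorem eLpNorm_cweight_mul (X : BourgainSpace) (g : ℝ × ℝ → ℂ) :
    eLpNorm (fun z ↦ X.cweight z * g z) 2 = X.norm g := by
  rw [← l2_enorm_eq_eLpNorm]
  simp only [enorm_cweight_mul]
  rfl

/-- The function with the weighted representative `x`. -/
def ofLp (X : BourgainSpace) (x : Lp ℂ 2 (volume : Measure (ℝ × ℝ))) (z : ℝ × ℝ) : ℂ :=
  (X.cweight z)⁻¹ * x z

@[fun_prop]
theorem measurable_ofLp (X : BourgainSpace) (x : Lp ℂ 2 (volume : Measure (ℝ × ℝ))) :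
    Measurable (X.ofLp x) :=
  X.measurable_cweight.inv.mul (Lp.stronglyMeasurable x).measurable

theorem cweight_mul_ofLp (X : BourgainSpace) (x : Lp ℂ 2 (volume : Measure (ℝ × ℝ)))
    (z : ℝ × ℝ) : X.cweight z * X.ofLp x z = x z :=
  mul_inv_cancel_left₀ (X.cweight_ne_zero z) _

theorem norm_ofLp (X : BourgainSpace) (x : Lp ℂ 2 (volume : Measure (ℝ × ℝ))) :
    X.norm (X.ofLp x) = ‖x‖ₑ := by
  rw [← eLpNorm_cweight_mul, Lp.enorm_def]
  simp only [cweight_mul_ofLp]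

theorem norm_ofLp_sub (X : BourgainSpace) (x y : Lp ℂ 2 (volume : Measure (ℝ × ℝ))) :
    X.norm (fun z ↦ X.ofLp x z - X.ofLp y z) = edist x y := by
  rw [← eLpNorm_cweight_mul, edist_eq_enorm_sub, Lp.enorm_def]
  refine eLpNorm_congr_ae ((Lp.coeFn_sub x y).mono fun z hz ↦ ?_)
  simp only [mul_sub, cweight_mul_ofLp, hz, Pi.sub_apply]

theorem exists_ofLp_eq (X : BourgainSpace) {g : ℝ × ℝ → ℂ} (hg : Measurable g)
    (h : X.norm g ≠ ∞) : ∃ x, X.ofLp x =ᵐ[volume] g := by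
  have hL : MemLp (fun z ↦ X.cweight z * g z) 2 :=
    ⟨(X.measurable_cweight.mul hg).aestronglyMeasurable, by
      rw [eLpNorm_cweight_mul]; exact lt_top_iff_ne_top.2 h⟩
  refine ⟨hL.toLp _, hL.coeFn_toLp.mono fun z hz ↦ ?_⟩
  rw [ofLp, hz, inv_mul_cancel_left₀ (X.cweight_ne_zero z)]

theorem norm_congr (X : BourgainSpace) {g g' : ℝ × ℝ → ℂ} (h : g =ᵐ[volume] g') :
    X.norm g = X.norm g' := bourgainNorm_congr h

theorem norm_add_le (X : BourgainSpace) {g g' : ℝ × ℝ → ℂ} (hg : Measurable g)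
    (hg' : Measurable g') : X.norm (fun z ↦ g z + g' z) ≤ X.norm g + X.norm g' :=
  bourgainNorm_add_le X.measurable_phase hg hg'

theorem norm_sub_le (X : BourgainSpace) {g g' : ℝ × ℝ → ℂ} (hg : Measurable g)
    (hg' : Measurable g') : X.norm (fun z ↦ g z - g' z) ≤ X.norm g + X.norm g' :=
  bourgainNorm_sub_le X.measurable_phase hg hg'

theorem ae_integrable_slice (X : BourgainSpace) {g : ℝ × ℝ → ℂ} (hg : Measurable g)
    (h : X.norm g ≠ ∞) : ∀ᵐ ξ, Integrable fun τ ↦ g (τ, ξ) :=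
  SBO.ae_integrable_slice X.measurable_phase X.half_lt hg h

end BourgainSpace

/-- The contraction mapping principle in a product of two Bourgain spaces. -/
theorem exists_fixedPoint_bourgain (X Y : BourgainSpace) {r : ℝ≥0}
    {Φ₁ Φ₂ : (ℝ × ℝ → ℂ) → (ℝ × ℝ → ℂ) → ℝ × ℝ → ℂ}
    (hm₁ : ∀ g h, Measurable g → Measurable h → Measurable (Φ₁ g h))
    (hm₂ : ∀ g h, Measurable g → Measurable h → Measurable (Φ₂ g h))
    (hr₁ : ∀ g h, Measurable g → Measurable h → X.norm g ≤ r → Y.norm h ≤ r →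
      X.norm (Φ₁ g h) ≤ r)
    (hr₂ : ∀ g h, Measurable g → Measurable h → X.norm g ≤ r → Y.norm h ≤ r →
      Y.norm (Φ₂ g h) ≤ r)
    (hc₁ : ∀ g h g' h', Measurable g → Measurable h → Measurable g' → Measurable h' →
      X.norm g ≤ r → Y.norm h ≤ r → X.norm g' ≤ r → Y.norm h' ≤ r →
      X.norm (fun z ↦ Φ₁ g h z - Φ₁ g' h' z) ≤
        2⁻¹ * max (X.norm fun z ↦ g z - g' z) (Y.norm fun z ↦ h z - h' z))
    (hc₂ : ∀ g h g' h', Measurable g → Measurable h → Measurable g' → Measurable h' →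
      X.norm g ≤ r → Y.norm h ≤ r → X.norm g' ≤ r → Y.norm h' ≤ r →
      Y.norm (fun z ↦ Φ₂ g h z - Φ₂ g' h' z) ≤
        2⁻¹ * max (X.norm fun z ↦ g z - g' z) (Y.norm fun z ↦ h z - h' z)) :
    ∃ g h, Measurable g ∧ Measurable h ∧ X.norm g ≤ r ∧ Y.norm h ≤ r ∧
      g =ᵐ[volume] Φ₁ g h ∧ h =ᵐ[volume] Φ₂ g h := by
  let E := Lp ℂ 2 (volume : Measure (ℝ × ℝ)) × Lp ℂ 2 (volume : Measure (ℝ × ℝ))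
  let s : Set E := Metric.closedBall 0 r
  have hs : ∀ x : E, x ∈ s ↔ X.norm (X.ofLp x.1) ≤ r ∧ Y.norm (Y.ofLp x.2) ≤ r := by
    intro x
    rw [X.norm_ofLp, Y.norm_ofLp, mem_closedBall_zero_iff, Prod.norm_def, max_le_iff]
    simp only [← ofReal_norm, ENNReal.ofReal_le_iff_le_toReal ENNReal.coe_ne_top,
      ENNReal.coe_toReal]
  have hex : ∀ x : E, ∃ y : E, x ∈ s → X.ofLp y.1 =ᵐ[volume] Φ₁ (X.ofLp x.1) (Y.ofLp x.2) ∧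
      Y.ofLp y.2 =ᵐ[volume] Φ₂ (X.ofLp x.1) (Y.ofLp x.2) := by
    intro x
    by_cases hx : x ∈ s
    · obtain ⟨h1, h2⟩ := (hs x).1 hx
      obtain ⟨y₁, hy₁⟩ := X.exists_ofLp_eq (hm₁ _ _ (X.measurable_ofLp x.1) (Y.measurable_ofLp x.2))
        (ne_top_of_le_ne_top ENNReal.coe_ne_top
          (hr₁ _ _ (X.measurable_ofLp x.1) (Y.measurable_ofLp x.2) h1 h2))
      obtain ⟨y₂, hy₂⟩ := Y.exists_ofLp_eq (hm₂ _ _ (X.measurable_ofLp x.1) (Y.measurable_ofLp x.2))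
        (ne_top_of_le_ne_top ENNReal.coe_ne_top
          (hr₂ _ _ (X.measurable_ofLp x.1) (Y.measurable_ofLp x.2) h1 h2))
      exact ⟨(y₁, y₂), fun _ ↦ ⟨hy₁, hy₂⟩⟩
    · exact ⟨0, fun h ↦ absurd h hx⟩
  choose f hf using hex
  have hmaps : MapsTo f s s := by
    intro x hx
    obtain ⟨h1, h2⟩ := (hs x).1 hx
    rw [hs, X.norm_congr (hf x hx).1, Y.norm_congr (hf x hx).2]
    exact ⟨hr₁ _ _ (X.measurable_ofLp x.1) (Y.measurable_ofLp x.2) h1 h2,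
      hr₂ _ _ (X.measurable_ofLp x.1) (Y.measurable_ofLp x.2) h1 h2⟩
  have hlip : ∀ x ∈ s, ∀ y ∈ s, edist (f x) (f y) ≤ ((2⁻¹ : ℝ≥0) : ℝ≥0∞) * edist x y := by
    intro x hx y hy
    obtain ⟨h1, h2⟩ := (hs x).1 hx
    obtain ⟨h3, h4⟩ := (hs y).1 hy
    have e1 : (fun z ↦ X.ofLp (f x).1 z - X.ofLp (f y).1 z) =ᵐ[volume] fun z ↦
        Φ₁ (X.ofLp x.1) (Y.ofLp x.2) z - Φ₁ (X.ofLp y.1) (Y.ofLp y.2) z :=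
      (hf x hx).1.sub (hf y hy).1
    have e2 : (fun z ↦ Y.ofLp (f x).2 z - Y.ofLp (f y).2 z) =ᵐ[volume] fun z ↦
        Φ₂ (X.ofLp x.1) (Y.ofLp x.2) z - Φ₂ (X.ofLp y.1) (Y.ofLp y.2) z :=
      (hf x hx).2.sub (hf y hy).2
    rw [Prod.edist_eq, Prod.edist_eq, ← X.norm_ofLp_sub, ← Y.norm_ofLp_sub, ← X.norm_ofLp_sub,
      ← Y.norm_ofLp_sub, X.norm_congr e1,
      Y.norm_congr e2, ENNReal.coe_inv two_ne_zero, ENNReal.coe_ofNat]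
    exact max_le
      (hc₁ _ _ _ _ (X.measurable_ofLp x.1) (Y.measurable_ofLp x.2) (X.measurable_ofLp y.1)
        (Y.measurable_ofLp y.2) h1 h2 h3 h4)
      (hc₂ _ _ _ _ (X.measurable_ofLp x.1) (Y.measurable_ofLp x.2) (X.measurable_ofLp y.1)
        (Y.measurable_ofLp y.2) h1 h2 h3 h4)
  have hcw : ContractingWith (2⁻¹ : ℝ≥0) (hmaps.restrict f s s) :=
    ⟨by rw [inv_lt_one₀] <;> norm_num, fun x y ↦ hlip x x.2 y y.2⟩
  have h0 : (0 : E) ∈ s := Metric.mem_closedBall_self r.2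
  obtain ⟨x, hx, hfix, -⟩ := hcw.exists_fixedPoint' Metric.isClosed_closedBall.isComplete hmaps h0
    (edist_ne_top _ _)
  obtain ⟨h1, h2⟩ := (hs x).1 hx
  have h3 := hf x hx
  rw [hfix.eq] at h3
  exact ⟨_, _, X.measurable_ofLp x.1, Y.measurable_ofLp x.2, h1, h2, h3.1, h3.2⟩

/-! ### Duhamel integrals of products -/

namespace ProductBound

variable {m : ℝ → ℂ} {X₁ X₂ Y : BourgainSpace} {a : ℝ} {C : ℝ≥0} {f f' g g' : ℝ × ℝ → ℂ}

theorem exists_norm_duhamelOp_le (H : ProductBound m X₁ X₂ Y a C) (ha : 0 ≤ a) (hab : a + Y.b < 1) :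
    ∃ K : ℝ≥0, ∀ δ : ℝ, 0 < δ → δ ≤ 1 → ∀ f g, Measurable f → Measurable g →
      Y.norm (duhamelOp δ Y.phase (prodOp m f g)) ≤
        K * ENNReal.ofReal (δ ^ (1 - a - Y.b)) * (X₁.norm f * X₂.norm g) := by
  have hb := Y.half_lt
  obtain ⟨K, hK⟩ := exists_bourgainNorm_duhamelOp_le ha H.lt_half (by linarith)
    (by linarith) hab.le
  refine ⟨K * C, fun δ hδ hδ1 f g hf hg ↦ ?_⟩
  have hm := H.measurable
  refine (hK δ hδ hδ1 Y.phase Y.measurable_phase Y.s _ (by fun_prop)).trans ?_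
  calc _ ≤ K * ENNReal.ofReal (δ ^ (1 - a - Y.b)) * (C * (X₁.norm f * X₂.norm g)) :=
        mul_le_mul_right (H.bourgainNorm_le hf hg) _
    _ = _ := by push_cast; ring

theorem duhamelOp_sub_left (H : ProductBound m X₁ X₂ Y a C) {δ : ℝ} (hδ : 0 < δ) (hδ1 : δ ≤ 1)
    (hf : Measurable f) (hf' : Measurable f') (hg : Measurable g) (nf : X₁.norm f ≠ ∞)
    (nf' : X₁.norm f' ≠ ∞) (ng : X₂.norm g ≠ ∞) :
    duhamelOp δ Y.phase (prodOp m (fun z ↦ f z - f' z) g) =ᵐ[volume] fun z ↦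
      duhamelOp δ Y.phase (prodOp m f g) z - duhamelOp δ Y.phase (prodOp m f' g) z := by
  have hm := H.measurable
  filter_upwards [duhamelOp_congr (p := Y.phase) (δ := δ) (H.prodOp_sub_left hf hf' hg nf nf' ng),
    ae_of_ae_snd (H.ae_lintegral_prodOp hf hg nf ng),
    ae_of_ae_snd (H.ae_lintegral_prodOp hf' hg nf' ng)] with z h1 h2 h3
  rw [h1]
  exact duhamelOp_sub hδ hδ1 (by fun_prop) (by fun_prop) h2 h3 z.1

theorem duhamelOp_sub_right (H : ProductBound m X₁ X₂ Y a C) {δ : ℝ} (hδ : 0 < δ) (hδ1 : δ ≤ 1)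
    (hf : Measurable f) (hg : Measurable g) (hg' : Measurable g') (nf : X₁.norm f ≠ ∞)
    (ng : X₂.norm g ≠ ∞) (ng' : X₂.norm g' ≠ ∞) :
    duhamelOp δ Y.phase (prodOp m f (fun z ↦ g z - g' z)) =ᵐ[volume] fun z ↦
      duhamelOp δ Y.phase (prodOp m f g) z - duhamelOp δ Y.phase (prodOp m f g') z := by
  have := H.symm.duhamelOp_sub_left hδ hδ1 hg hg' hf ng ng' nf
  simpa only [prodOp_comm m _ f] using this

/-- Bilinear estimates yield Lipschitz estimates. -/
theorem norm_duhamelOp_sub_le (H : ProductBound m X₁ X₂ Y a C) {δ : ℝ} (hδ : 0 < δ) (hδ1 : δ ≤ 1)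
    {k : ℝ≥0∞} (hk : ∀ f g, Measurable f → Measurable g →
      Y.norm (duhamelOp δ Y.phase (prodOp m f g)) ≤ k * (X₁.norm f * X₂.norm g))
    (hf : Measurable f) (hf' : Measurable f') (hg : Measurable g) (hg' : Measurable g')
    (nf : X₁.norm f ≠ ∞) (nf' : X₁.norm f' ≠ ∞) (ng : X₂.norm g ≠ ∞) (ng' : X₂.norm g' ≠ ∞) :
    Y.norm (fun z ↦ duhamelOp δ Y.phase (prodOp m f g) z -
        duhamelOp δ Y.phase (prodOp m f' g') z) ≤
      k * (X₁.norm (fun z ↦ f z - f' z) * X₂.norm g +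
        X₁.norm f' * X₂.norm (fun z ↦ g z - g' z)) := by
  have hm := H.measurable
  have hY := Y.measurable_phase
  have e : (fun z ↦ duhamelOp δ Y.phase (prodOp m f g) z -
      duhamelOp δ Y.phase (prodOp m f' g') z) =ᵐ[volume] fun z ↦
      duhamelOp δ Y.phase (prodOp m (fun z ↦ f z - f' z) g) z +
        duhamelOp δ Y.phase (prodOp m f' (fun z ↦ g z - g' z)) z := by
    filter_upwards [H.duhamelOp_sub_left hδ hδ1 hf hf' hg nf nf' ng,
      H.duhamelOp_sub_right hδ hδ1 hf' hg hg' nf' ng ng'] with z h1 h2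
    rw [h1, h2]; ring
  rw [Y.norm_congr e, mul_add]
  exact (Y.norm_add_le (by fun_prop) (by fun_prop)).trans
    (add_le_add (hk _ _ (by fun_prop) (by fun_prop)) (hk _ _ (by fun_prop) (by fun_prop)))

/-- The Duhamel integral up to time `t` depends only on the factors between `0` and `t`. -/
theorem duhamelSlice_congr_left (H : ProductBound m X₁ X₂ Y a C)
    (hf : Measurable f) (hf' : Measurable f') (hg : Measurable g) (nf : X₁.norm f ≠ ∞)
    (nf' : X₁.norm f' ≠ ∞) (ng : X₂.norm g ≠ ∞) {t : ℝ}
    (h0 : ∀ r ∈ uIcc 0 t, ∀ᵐ ξ, slice f r ξ = slice f' r ξ) :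
    ∀ᵐ ξ, duhamelSlice Y.phase (prodOp m f g) t ξ = duhamelSlice Y.phase (prodOp m f' g) t ξ := by
  have h1 : ∀ r ∈ uIcc 0 t, ∀ᵐ ξ, slice (fun z ↦ f z - f' z) r ξ = 0 := by
    intro r hr
    filter_upwards [h0 r hr, X₁.ae_integrable_slice hf nf, X₁.ae_integrable_slice hf' nf']
      with ξ e1 e2 e3
    rw [slice_sub e2 e3, e1, sub_self]
  have hn : X₁.norm (fun z ↦ f z - f' z) ≠ ∞ :=
    ne_top_of_le_ne_top (ENNReal.add_ne_top.2 ⟨nf, nf'⟩) (X₁.norm_sub_le hf hf')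
  filter_upwards [H.duhamelSlice_eq_zero (by fun_prop) hg hn ng h1,
    H.duhamelSlice_sub_left hf hf' hg nf nf' ng] with ξ e1 e2
  rw [e2] at e1
  exact sub_eq_zero.1 e1

theorem duhamelSlice_congr_right (H : ProductBound m X₁ X₂ Y a C)
    (hf : Measurable f) (hg : Measurable g) (hg' : Measurable g') (nf : X₁.norm f ≠ ∞)
    (ng : X₂.norm g ≠ ∞) (ng' : X₂.norm g' ≠ ∞) {t : ℝ}
    (h0 : ∀ r ∈ uIcc 0 t, ∀ᵐ ξ, slice g r ξ = slice g' r ξ) :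
    ∀ᵐ ξ, duhamelSlice Y.phase (prodOp m f g) t ξ = duhamelSlice Y.phase (prodOp m f g') t ξ := by
  rw [prodOp_comm m f, prodOp_comm m f]
  exact H.symm.duhamelSlice_congr_left hg hg' hf ng ng' nf h0

end ProductBound

end

/-! ### The coupled system in Bourgain spaces -/

section

/-- A system of two dispersive equations with the nonlinear terms `m₁(D)(u v)` and
`m₂(D)(u ū)`, together with bilinear estimates in Bourgain spaces. -/
structure DispersiveSystem where
  /-- The space of the first unknown. -/
  X : BourgainSpace
  /-- The space of the second unknown. -/
  Y : BourgainSpace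
  /-- The multiplier of the first nonlinear term. -/
  m₁ : ℝ → ℂ
  /-- The multiplier of the second nonlinear term. -/
  m₂ : ℝ → ℂ
  /-- The modulation exponent of the first bilinear estimate. -/
  a₁ : ℝ
  /-- The modulation exponent of the second bilinear estimate. -/
  a₂ : ℝ
  /-- The constant of the first bilinear estimate. -/
  C₁ : ℝ≥0
  /-- The constant of the second bilinear estimate. -/
  C₂ : ℝ≥0
  bound₁ : ProductBound m₁ X Y X a₁ C₁
  bound₂ : ProductBound m₂ X X.conjugate Y a₂ C₂
  nonneg₁ : 0 ≤ a₁
  nonneg₂ : 0 ≤ a₂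
  lt_one₁ : a₁ + X.b < 1
  lt_one₂ : a₂ + Y.b < 1

namespace DispersiveSystem

variable (S : DispersiveSystem)

/-- The first Duhamel term. -/
def term₁ (δ : ℝ) (g h : ℝ × ℝ → ℂ) : ℝ × ℝ → ℂ := duhamelOp δ S.X.phase (prodOp S.m₁ g h)

/-- The second Duhamel term. -/
def term₂ (δ : ℝ) (f g : ℝ × ℝ → ℂ) : ℝ × ℝ → ℂ :=
  duhamelOp δ S.Y.phase (prodOp S.m₂ f (conjFourier g))

/-- The spatial Fourier transform at time `t` of the first Duhamel integral. -/
def duhamel₁ (g h : ℝ × ℝ → ℂ) (t ξ : ℝ) : ℂ := duhamelSlice S.X.phase (prodOp S.m₁ g h) t ξ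

/-- The spatial Fourier transform at time `t` of the second Duhamel integral. -/
def duhamel₂ (f g : ℝ × ℝ → ℂ) (t ξ : ℝ) : ℂ :=
  duhamelSlice S.Y.phase (prodOp S.m₂ f (conjFourier g)) t ξ

/-- On a time interval of length `δ`, the Duhamel terms are bounded with the constant `κ`. -/
structure Small (δ : ℝ) (κ : ℝ≥0) : Prop where
  pos : 0 < δ
  le_one : δ ≤ 1
  bound₁ : ∀ g h, Measurable g → Measurable h →
    S.X.norm (S.term₁ δ g h) ≤ κ * (S.X.norm g * S.Y.norm h)
  bound₂ : ∀ f g, Measurable f → Measurable g →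
    S.Y.norm (S.term₂ δ f g) ≤ κ * (S.X.norm f * S.X.norm g)

variable {S} {δ T : ℝ} {κ r : ℝ≥0} {f g h f' g' h' w y : ℝ × ℝ → ℂ}

@[fun_prop]
theorem measurable_term₁ (hg : Measurable g) (hh : Measurable h) : Measurable (S.term₁ δ g h) :=
  measurable_duhamelOp δ S.X.measurable_phase (measurable_prodOp S.bound₁.measurable hg hh)

@[fun_prop]
theorem measurable_term₂ (hf : Measurable f) (hg : Measurable g) : Measurable (S.term₂ δ f g) :=
  measurable_duhamelOp δ S.Y.measurable_phase
    (measurable_prodOp S.bound₂.measurable hf (measurable_conjFourier hg))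

variable (S) in
/-- The truncated Duhamel operators gain the powers `1 - a₁ - b` and `1 - a₂ - b'` of `δ`. -/
theorem exists_small (hκ : 0 < κ) : ∃ δ, S.Small δ κ := by
  obtain ⟨K₁, hK₁⟩ := S.bound₁.exists_norm_duhamelOp_le S.nonneg₁ S.lt_one₁
  obtain ⟨K₂, hK₂⟩ := S.bound₂.exists_norm_duhamelOp_le S.nonneg₂ S.lt_one₂
  have key : ∀ (K : ℝ≥0) (θ : ℝ), 0 < θ →
      ∀ᶠ δ : ℝ in 𝓝[>] 0, K * ENNReal.ofReal (δ ^ θ) ≤ (κ : ℝ≥0∞) := by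
    intro K θ hθ
    have h1 : Tendsto (fun δ : ℝ ↦ δ ^ θ) (𝓝[>] 0) (𝓝 0) := by
      have := (Real.continuousAt_rpow_const 0 θ (Or.inr hθ.le)).tendsto
      rw [Real.zero_rpow hθ.ne'] at this
      exact this.mono_left nhdsWithin_le_nhds
    have h2 := ENNReal.Tendsto.const_mul (a := (K : ℝ≥0∞)) (ENNReal.tendsto_ofReal h1)
      (Or.inr ENNReal.coe_ne_top)
    rw [ENNReal.ofReal_zero, mul_zero] at h2
    exact h2.eventually_le_const (by exact_mod_cast hκ)
  have h1 := S.lt_one₁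
  have h2 := S.lt_one₂
  have hle : ∀ᶠ δ : ℝ in 𝓝[>] 0, δ ≤ 1 :=
    (tendsto_id.mono_left nhdsWithin_le_nhds).eventually_le_const one_pos
  obtain ⟨δ, e1, e2, e3, e4⟩ := ((key K₁ _ (show 0 < 1 - S.a₁ - S.X.b by linarith)).and
    ((key K₂ _ (show 0 < 1 - S.a₂ - S.Y.b by linarith)).and
      (hle.and (eventually_mem_nhdsWithin (a := (0 : ℝ)) (s := Ioi 0))))).exists
  refine ⟨δ, e4, e3, fun g h hg hh ↦ ?_, fun f g hf hg ↦ ?_⟩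
  · exact (hK₁ δ e4 e3 g h hg hh).trans (mul_le_mul_left e1 _)
  · refine (hK₂ δ e4 e3 f _ hf (measurable_conjFourier hg)).trans ?_
    rw [S.X.norm_conjFourier]
    exact mul_le_mul_left e2 _

theorem conjFourier_sub (g g' : ℝ × ℝ → ℂ) :
    conjFourier (fun z ↦ g z - g' z) = fun z ↦ conjFourier g z - conjFourier g' z := by
  ext z; simp [conjFourier]

theorem Small.norm_term₁_sub_le (hS : S.Small δ κ) (hg : Measurable g) (hg' : Measurable g')
    (hh : Measurable h) (hh' : Measurable h') (ng : S.X.norm g ≠ ∞) (ng' : S.X.norm g' ≠ ∞)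
    (nh : S.Y.norm h ≠ ∞) (nh' : S.Y.norm h' ≠ ∞) :
    S.X.norm (fun z ↦ S.term₁ δ g h z - S.term₁ δ g' h' z) ≤
      κ * (S.X.norm (fun z ↦ g z - g' z) * S.Y.norm h +
        S.X.norm g' * S.Y.norm (fun z ↦ h z - h' z)) :=
  S.bound₁.norm_duhamelOp_sub_le hS.pos hS.le_one hS.bound₁ hg hg' hh hh' ng ng' nh nh'

theorem Small.norm_term₂_sub_le (hS : S.Small δ κ) (hf : Measurable f) (hf' : Measurable f')
    (hg : Measurable g) (hg' : Measurable g') (nf : S.X.norm f ≠ ∞) (nf' : S.X.norm f' ≠ ∞)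
    (ng : S.X.norm g ≠ ∞) (ng' : S.X.norm g' ≠ ∞) :
    S.Y.norm (fun z ↦ S.term₂ δ f g z - S.term₂ δ f' g' z) ≤
      κ * (S.X.norm (fun z ↦ f z - f' z) * S.X.norm g +
        S.X.norm f' * S.X.norm (fun z ↦ g z - g' z)) := by
  have hb : ∀ f g, Measurable f → Measurable g →
      S.Y.norm (duhamelOp δ S.Y.phase (prodOp S.m₂ f g)) ≤
        κ * (S.X.norm f * S.X.conjugate.norm g) := by
    intro f g hf hg
    have e : conjFourier (conjFourier g) = g := by ext z; simp [conjFourier]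
    have := hS.bound₂ f (conjFourier g) hf (measurable_conjFourier hg)
    have e' := S.X.norm_conjFourier (conjFourier g)
    rw [e] at e'
    rwa [term₂, e, ← e'] at this
  have := S.bound₂.norm_duhamelOp_sub_le hS.pos hS.le_one hb hf hf' (measurable_conjFourier hg)
    (measurable_conjFourier hg') nf nf' (by rwa [S.X.norm_conjFourier])
    (by rwa [S.X.norm_conjFourier])
  rwa [← conjFourier_sub, S.X.norm_conjFourier, S.X.norm_conjFourier] at this

variable (S) in
/-- A solution of the truncated integral equations, where the data have the Fourier transforms
`φ` and `ψ`. -/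
structure IsTruncatedSolution (δ : ℝ) (φ ψ : ℝ → ℂ) (r : ℝ≥0) (g h : ℝ × ℝ → ℂ) : Prop where
  measurable₁ : Measurable g
  measurable₂ : Measurable h
  norm_le₁ : S.X.norm g ≤ r
  norm_le₂ : S.Y.norm h ≤ r
  eq₁ : g =ᵐ[volume] fun z ↦ linearOp S.X.phase φ z + S.term₁ δ g h z
  eq₂ : h =ᵐ[volume] fun z ↦ linearOp S.Y.phase ψ z + S.term₂ δ g g z

/-- The truncated equations are solved by a contraction in the ball of radius `r`. -/
theorem Small.exists_truncatedSolution (hS : S.Small δ κ) (hκ : κ * r ≤ 8⁻¹) {φ ψ : ℝ → ℂ}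
    (hφ : Measurable φ) (hψ : Measurable ψ) (nφ : S.X.norm (linearOp S.X.phase φ) ≤ r / 2)
    (nψ : S.Y.norm (linearOp S.Y.phase ψ) ≤ r / 2) :
    ∃ g h, S.IsTruncatedSolution δ φ ψ r g h := by
  have hX := S.X.measurable_phase
  have hY := S.Y.measurable_phase
  have hκ' : (κ : ℝ≥0∞) * r ≤ 8⁻¹ := by
    have : ((κ * r : ℝ≥0) : ℝ≥0∞) ≤ ((8⁻¹ : ℝ≥0) : ℝ≥0∞) := by exact_mod_cast hκ
    simpa using this
  have hrr : (r : ℝ≥0∞) / 2 + κ * (r * r) ≤ r := by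
    calc (r : ℝ≥0∞) / 2 + κ * (r * r) = r / 2 + κ * r * r := by ring
      _ ≤ r / 2 + 2⁻¹ * r := by
          gcongr
          exact hκ'.trans (ENNReal.inv_le_inv.2 (by norm_num))
      _ = r := by rw [mul_comm, ← div_eq_mul_inv, ENNReal.add_halves]
  have hcon : ∀ d e D : ℝ≥0∞, d ≤ D → e ≤ D → κ * (d * r + r * e) ≤ 2⁻¹ * D := by
    intro d e D hd he
    calc κ * (d * r + r * e) = κ * r * (d + e) := by ring
      _ ≤ 8⁻¹ * (D + D) := by gcongr
      _ = 8⁻¹ * 2 * D := by ring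
      _ ≤ 2⁻¹ * D := by
          gcongr
          rw [ENNReal.le_inv_iff_mul_le, mul_assoc]
          norm_num
          rw [show (4 : ℝ≥0∞) = 8 * 2⁻¹ by
            rw [← div_eq_mul_inv, ENNReal.eq_div_iff (by norm_num) (by norm_num)]; norm_num,
            ← mul_assoc, ENNReal.inv_mul_cancel (by norm_num) (by norm_num), one_mul]
          exact ENNReal.inv_le_one.2 (by norm_num)
  have fin : ∀ {x : ℝ≥0∞}, x ≤ r → x ≠ ∞ := fun h ↦ ne_top_of_le_ne_top ENNReal.coe_ne_top h
  obtain ⟨g, h, hg, hh, ng, nh, e1, e2⟩ := exists_fixedPoint_bourgain S.X S.Y (r := r)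
    (Φ₁ := fun g h z ↦ linearOp S.X.phase φ z + S.term₁ δ g h z)
    (Φ₂ := fun g _ z ↦ linearOp S.Y.phase ψ z + S.term₂ δ g g z)
    (fun g h hg hh ↦ by fun_prop) (fun g h hg hh ↦ by fun_prop)
    (fun g h hg hh ng nh ↦ by
      refine (S.X.norm_add_le (by fun_prop) (by fun_prop)).trans (le_trans ?_ hrr)
      exact add_le_add nφ ((hS.bound₁ g h hg hh).trans (by gcongr)))
    (fun g h hg hh ng nh ↦ by
      refine (S.Y.norm_add_le (by fun_prop) (by fun_prop)).trans (le_trans ?_ hrr)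
      exact add_le_add nψ ((hS.bound₂ g g hg hg).trans (by gcongr)))
    (fun g h g' h' hg hh hg' hh' ng nh ng' nh' ↦ by
      simp only [add_sub_add_left_eq_sub]
      refine (hS.norm_term₁_sub_le hg hg' hh hh' (fin ng) (fin ng') (fin nh) (fin nh')).trans ?_
      exact le_trans (by gcongr) (hcon _ _ _ (le_max_left _ _) (le_max_right _ _)))
    (fun g h g' h' hg hh hg' hh' ng nh ng' nh' ↦ by
      simp only [add_sub_add_left_eq_sub]
      refine (hS.norm_term₂_sub_le hg hg' hg hg' (fin ng) (fin ng') (fin ng) (fin ng')).trans ?_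
      exact le_trans (by gcongr) (hcon _ _ _ (le_max_left _ _) (le_max_left _ _)))
  exact ⟨g, h, hg, hh, ng, nh, e1, e2⟩

/-- The truncated solutions depend in a Lipschitz continuous way on the data. -/
theorem Small.norm_sub_le (hS : S.Small δ κ) (hκ : κ * r ≤ 8⁻¹) {φ ψ φ' ψ' : ℝ → ℂ}
    (hφ : Measurable φ) (hψ : Measurable ψ) (hφ' : Measurable φ') (hψ' : Measurable ψ')
    (H : S.IsTruncatedSolution δ φ ψ r g h) (H' : S.IsTruncatedSolution δ φ' ψ' r g' h') :
    S.X.norm (fun z ↦ g z - g' z) + S.Y.norm (fun z ↦ h z - h' z) ≤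
      2 * (S.X.norm (linearOp S.X.phase fun ξ ↦ φ ξ - φ' ξ) +
        S.Y.norm (linearOp S.Y.phase fun ξ ↦ ψ ξ - ψ' ξ)) := by
  have hX := S.X.measurable_phase
  have hY := S.Y.measurable_phase
  have hg := H.measurable₁
  have hh := H.measurable₂
  have hg' := H'.measurable₁
  have hh' := H'.measurable₂
  have hκ' : (κ : ℝ≥0∞) * r ≤ 8⁻¹ := by
    have : ((κ * r : ℝ≥0) : ℝ≥0∞) ≤ ((8⁻¹ : ℝ≥0) : ℝ≥0∞) := by exact_mod_cast hκ
    simpa using this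
  have fin : ∀ {x : ℝ≥0∞}, x ≤ r → x ≠ ∞ := fun h ↦ ne_top_of_le_ne_top ENNReal.coe_ne_top h
  set d := S.X.norm (fun z ↦ g z - g' z) with hd
  set e := S.Y.norm (fun z ↦ h z - h' z) with he
  have dfin : d ≠ ∞ := ne_top_of_le_ne_top (ENNReal.add_ne_top.2 ⟨fin H.norm_le₁, fin H'.norm_le₁⟩)
    (S.X.norm_sub_le hg hg')
  have efin : e ≠ ∞ := ne_top_of_le_ne_top (ENNReal.add_ne_top.2 ⟨fin H.norm_le₂, fin H'.norm_le₂⟩)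
    (S.Y.norm_sub_le hh hh')
  have h1 : d ≤ S.X.norm (linearOp S.X.phase fun ξ ↦ φ ξ - φ' ξ) + 8⁻¹ * (d + e) := by
    have e1 : (fun z ↦ g z - g' z) =ᵐ[volume] fun z ↦ linearOp S.X.phase (fun ξ ↦ φ ξ - φ' ξ) z +
        (S.term₁ δ g h z - S.term₁ δ g' h' z) := by
      filter_upwards [H.eq₁, H'.eq₁] with z h1 h2
      simp only [h1, h2, linearOp]; ring
    calc d = _ := S.X.norm_congr e1
      _ ≤ _ := S.X.norm_add_le (by fun_prop) (by fun_prop)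
      _ ≤ _ + κ * (d * r + r * e) := by
          gcongr
          refine (hS.norm_term₁_sub_le hg hg' hh hh' (fin H.norm_le₁) (fin H'.norm_le₁)
            (fin H.norm_le₂) (fin H'.norm_le₂)).trans ?_
          have := H.norm_le₂
          have := H'.norm_le₁
          gcongr
      _ = _ + κ * r * (d + e) := by ring
      _ ≤ _ := by gcongr
  have h2 : e ≤ S.Y.norm (linearOp S.Y.phase fun ξ ↦ ψ ξ - ψ' ξ) + 8⁻¹ * (d + d) := by
    have e1 : (fun z ↦ h z - h' z) =ᵐ[volume] fun z ↦ linearOp S.Y.phase (fun ξ ↦ ψ ξ - ψ' ξ) z +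
        (S.term₂ δ g g z - S.term₂ δ g' g' z) := by
      filter_upwards [H.eq₂, H'.eq₂] with z h1 h2
      simp only [h1, h2, linearOp]; ring
    calc e = _ := S.Y.norm_congr e1
      _ ≤ _ := S.Y.norm_add_le (by fun_prop) (by fun_prop)
      _ ≤ _ + κ * (d * r + r * d) := by
          gcongr
          refine (hS.norm_term₂_sub_le hg hg' hg hg' (fin H.norm_le₁) (fin H'.norm_le₁)
            (fin H.norm_le₁) (fin H'.norm_le₁)).trans ?_
          have := H.norm_le₁
          have := H'.norm_le₁
          gcongr
      _ = _ + κ * r * (d + d) := by ring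
      _ ≤ _ := by gcongr
  set P := S.X.norm (linearOp S.X.phase fun ξ ↦ φ ξ - φ' ξ)
  set Q := S.Y.norm (linearOp S.Y.phase fun ξ ↦ ψ ξ - ψ' ξ)
  by_cases hP : P = ∞
  · simp [hP]
  by_cases hQ : Q = ∞
  · simp [hQ]
  clear_value d e P Q
  clear hd he
  lift d to ℝ≥0 using dfin
  lift e to ℝ≥0 using efin
  lift P to ℝ≥0 using hP
  lift Q to ℝ≥0 using hQ
  have e8 : (8⁻¹ : ℝ≥0∞) = ((8⁻¹ : ℝ≥0) : ℝ≥0∞) := by simp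
  rw [e8] at h1 h2
  norm_cast at h1 h2 ⊢
  rw [← NNReal.coe_le_coe] at h1 h2 ⊢
  push_cast at h1 h2 ⊢
  linarith [d.2, e.2, P.2, Q.2]

end DispersiveSystem

end

/-! ### From truncated solutions to solutions -/

section

namespace DispersiveSystem

variable {S : DispersiveSystem} {δ T M : ℝ} {κ r : ℝ≥0} {f g h f' g' h' w y : ℝ × ℝ → ℂ}

theorem norm_conjFourier_ne_top (hg : S.X.norm g ≠ ∞) : S.X.conjugate.norm (conjFourier g) ≠ ∞ := by
  rwa [S.X.norm_conjFourier]

theorem Small.slice_term₁ (hS : S.Small δ κ) (hg : Measurable g) (hh : Measurable h)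
    (ng : S.X.norm g ≠ ∞) (nh : S.Y.norm h ≠ ∞) :
    ∀ᵐ ξ, ∀ t, |t| ≤ δ → slice (S.term₁ δ g h) t ξ = S.duhamel₁ g h t ξ := by
  filter_upwards [S.bound₁.slice_duhamelOp hg hh ng nh hS.pos hS.le_one] with ξ hξ t ht
  rw [term₁, hξ, cutoff_eq_one, one_mul, duhamel₁]
  rw [abs_div, abs_of_pos hS.pos]
  exact div_le_one_of_le₀ ht hS.pos.le

theorem Small.slice_term₂ (hS : S.Small δ κ) (hf : Measurable f) (hg : Measurable g)
    (nf : S.X.norm f ≠ ∞) (ng : S.X.norm g ≠ ∞) :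
    ∀ᵐ ξ, ∀ t, |t| ≤ δ → slice (S.term₂ δ f g) t ξ = S.duhamel₂ f g t ξ := by
  filter_upwards [S.bound₂.slice_duhamelOp hf (measurable_conjFourier hg) nf
    (norm_conjFourier_ne_top ng) hS.pos hS.le_one] with ξ hξ t ht
  rw [term₂, hξ, cutoff_eq_one, one_mul, duhamel₂]
  rw [abs_div, abs_of_pos hS.pos]
  exact div_le_one_of_le₀ ht hS.pos.le

theorem Small.norm_term₁_ne_top (hS : S.Small δ κ) (hg : Measurable g) (hh : Measurable h)
    (ng : S.X.norm g ≠ ∞) (nh : S.Y.norm h ≠ ∞) : S.X.norm (S.term₁ δ g h) ≠ ∞ :=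
  ne_top_of_le_ne_top (ENNReal.mul_ne_top ENNReal.coe_ne_top (ENNReal.mul_ne_top ng nh))
    (hS.bound₁ g h hg hh)

theorem Small.norm_term₂_ne_top (hS : S.Small δ κ) (hf : Measurable f) (hg : Measurable g)
    (nf : S.X.norm f ≠ ∞) (ng : S.X.norm g ≠ ∞) : S.Y.norm (S.term₂ δ f g) ≠ ∞ :=
  ne_top_of_le_ne_top (ENNReal.mul_ne_top ENNReal.coe_ne_top (ENNReal.mul_ne_top nf ng))
    (hS.bound₂ f g hf hg)

/-- A truncated solution solves the integral equations on `[-δ, δ]`. -/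
theorem Small.slice_eq (hS : S.Small δ κ) {φ ψ : ℝ → ℂ} (hφ : Measurable φ) (hψ : Measurable ψ)
    (nφ : S.X.norm (linearOp S.X.phase φ) ≠ ∞) (nψ : S.Y.norm (linearOp S.Y.phase ψ) ≠ ∞)
    (H : S.IsTruncatedSolution δ φ ψ r g h) :
    ∀ᵐ ξ, ∀ t, |t| ≤ δ →
      slice g t ξ = phaseGroup S.X.phase t ξ * φ ξ + S.duhamel₁ g h t ξ ∧
      slice h t ξ = phaseGroup S.Y.phase t ξ * ψ ξ + S.duhamel₂ g g t ξ := by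
  have hX := S.X.measurable_phase
  have hY := S.Y.measurable_phase
  have hg := H.measurable₁
  have hh := H.measurable₂
  have ng := ne_top_of_le_ne_top ENNReal.coe_ne_top H.norm_le₁
  have nh := ne_top_of_le_ne_top ENNReal.coe_ne_top H.norm_le₂
  filter_upwards [hS.slice_term₁ hg hh ng nh, hS.slice_term₂ hg hg ng ng,
    S.X.ae_integrable_slice (measurable_linearOp hX hφ) nφ,
    S.X.ae_integrable_slice (measurable_term₁ hg hh) (hS.norm_term₁_ne_top hg hh ng nh),
    S.Y.ae_integrable_slice (measurable_linearOp hY hψ) nψ,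
    S.Y.ae_integrable_slice (measurable_term₂ hg hg) (hS.norm_term₂_ne_top hg hg ng ng),
    slice_congr H.eq₁, slice_congr H.eq₂] with ξ e1 e2 i1 i2 i3 i4 c1 c2 t ht
  have ht1 : |t| ≤ 1 := ht.trans hS.le_one
  constructor
  · rw [c1, slice_add i1 i2, slice_linearOp, cutoff_eq_one ht1, one_mul, e1 t ht]
  · rw [c2, slice_add i3 i4, slice_linearOp, cutoff_eq_one ht1, one_mul, e2 t ht]

/-! ### Uniqueness -/

variable (S) in
/-- The equations that the difference `(w, y)` of two solutions satisfies on the times in `J`. -/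
def LinearizedOn (g g' h w y : ℝ × ℝ → ℂ) (J : Set ℝ) : Prop :=
  ∀ r ∈ J, (∀ᵐ ξ, slice w r ξ = S.duhamel₁ w h r ξ + S.duhamel₁ g' y r ξ) ∧
    ∀ᵐ ξ, slice y r ξ = S.duhamel₂ w g r ξ + S.duhamel₂ g' w r ξ

theorem slice_conjFourier_congr {J : Set ℝ}
    (h0 : ∀ r ∈ J, ∀ᵐ ξ, slice f r ξ = slice f' r ξ) :
    ∀ r ∈ J, ∀ᵐ ξ, slice (conjFourier f) r ξ = slice (conjFourier f') r ξ := by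
  intro r hr
  have h1 := (Measure.measurePreserving_neg (volume : Measure ℝ)).quasiMeasurePreserving.ae
      (h0 r hr)
  filter_upwards [h1] with ξ hξ
  rw [slice_conjFourier, slice_conjFourier, hξ]

/-- On a short time interval the linearized equations have only the trivial solution: the
truncated Duhamel operator gives other extensions of the same time slices, with smaller and
smaller norms. -/
theorem Small.slice_eq_zero (hS : S.Small δ κ) (hκ : κ * r ≤ 8⁻¹) {J : Set ℝ}
    (hJ : ∀ t ∈ J, |t| ≤ δ) (hJ' : ∀ t ∈ J, uIcc 0 t ⊆ J)
    (hg : Measurable g) (hg' : Measurable g') (hh : Measurable h) (hw : Measurable w)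
    (hy : Measurable y) (ng : S.X.norm g ≤ r) (ng' : S.X.norm g' ≤ r) (nh : S.Y.norm h ≤ r)
    (nw : S.X.norm w ≠ ∞) (ny : S.Y.norm y ≠ ∞) (H : S.LinearizedOn g g' h w y J) :
    ∀ t ∈ J, (∀ᵐ ξ, slice w t ξ = 0) ∧ ∀ᵐ ξ, slice y t ξ = 0 := by
  have hκ' : (κ : ℝ≥0∞) * r ≤ 8⁻¹ := by
    have : ((κ * r : ℝ≥0) : ℝ≥0∞) ≤ ((8⁻¹ : ℝ≥0) : ℝ≥0∞) := by exact_mod_cast hκ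
    simpa using this
  have fin : ∀ {x : ℝ≥0∞}, x ≤ r → x ≠ ∞ := fun h ↦ ne_top_of_le_ne_top ENNReal.coe_ne_top h
  set N := S.X.norm w + S.Y.norm y with hN
  have hNfin : N ≠ ∞ := ENNReal.add_ne_top.2 ⟨nw, ny⟩
  have key : ∀ n : ℕ, ∃ W Z : ℝ × ℝ → ℂ, Measurable W ∧ Measurable Z ∧
      S.X.norm W + S.Y.norm Z ≤ 2⁻¹ ^ n * N ∧
      (∀ t ∈ J, ∀ᵐ ξ, slice W t ξ = slice w t ξ) ∧ ∀ t ∈ J, ∀ᵐ ξ, slice Z t ξ = slice y t ξ := by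
    intro n
    induction n with
    | zero =>
      exact ⟨w, y, hw, hy, by rw [pow_zero, one_mul],
        fun _ _ ↦ Eventually.of_forall fun _ ↦ rfl, fun _ _ ↦ Eventually.of_forall fun _ ↦ rfl⟩
    | succ n ih =>
      obtain ⟨W, Z, hW, hZ, hle, hWw, hZy⟩ := ih
      have hsum : S.X.norm W + S.Y.norm Z ≠ ∞ :=
        ne_top_of_le_ne_top (ENNReal.mul_ne_top (by finiteness) hNfin) hle
      obtain ⟨nW, nZ⟩ := ENNReal.add_ne_top.1 hsum
      have m1 := measurable_term₁ (S := S) (δ := δ) hW hh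
      have m2 := measurable_term₁ (S := S) (δ := δ) hg' hZ
      have m3 := measurable_term₂ (S := S) (δ := δ) hW hg
      have m4 := measurable_term₂ (S := S) (δ := δ) hg' hW
      refine ⟨fun z ↦ S.term₁ δ W h z + S.term₁ δ g' Z z,
        fun z ↦ S.term₂ δ W g z + S.term₂ δ g' W z, m1.add m2, m3.add m4, ?_, ?_, ?_⟩
      · have b1 : S.X.norm (fun z ↦ S.term₁ δ W h z + S.term₁ δ g' Z z) ≤
            8⁻¹ * (S.X.norm W + S.Y.norm Z) := by
          calc _ ≤ _ := S.X.norm_add_le m1 m2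
            _ ≤ κ * (S.X.norm W * r) + κ * (r * S.Y.norm Z) := add_le_add
                ((hS.bound₁ _ _ hW hh).trans (by gcongr)) ((hS.bound₁ _ _ hg' hZ).trans (by gcongr))
            _ = κ * r * (S.X.norm W + S.Y.norm Z) := by ring
            _ ≤ _ := by gcongr
        have b2 : S.Y.norm (fun z ↦ S.term₂ δ W g z + S.term₂ δ g' W z) ≤
            8⁻¹ * (S.X.norm W + S.X.norm W) := by
          calc _ ≤ _ := S.Y.norm_add_le m3 m4
            _ ≤ κ * (S.X.norm W * r) + κ * (r * S.X.norm W) := add_le_add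
                ((hS.bound₂ _ _ hW hg).trans (by gcongr)) ((hS.bound₂ _ _ hg' hW).trans (by gcongr))
            _ = κ * r * (S.X.norm W + S.X.norm W) := by ring
            _ ≤ _ := by gcongr
        rw [pow_succ', mul_assoc]
        refine le_trans ?_ (mul_le_mul_right hle _)
        refine (add_le_add b1 b2).trans ?_
        have e8 : (8⁻¹ : ℝ≥0∞) = ((8⁻¹ : ℝ≥0) : ℝ≥0∞) := by simp
        have e2 : (2⁻¹ : ℝ≥0∞) = ((2⁻¹ : ℝ≥0) : ℝ≥0∞) := by simp
        rw [e8, e2]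
        lift S.X.norm W to ℝ≥0 using nW with P
        lift S.Y.norm Z to ℝ≥0 using nZ with Q
        norm_cast
        rw [← NNReal.coe_le_coe]
        push_cast
        linarith [P.2, Q.2]
      · intro t ht
        filter_upwards [hS.slice_term₁ hW hh nW (fin nh), hS.slice_term₁ hg' hZ (fin ng') nZ,
          S.X.ae_integrable_slice m1 (hS.norm_term₁_ne_top hW hh nW (fin nh)),
          S.X.ae_integrable_slice m2 (hS.norm_term₁_ne_top hg' hZ (fin ng') nZ),
          S.bound₁.duhamelSlice_congr_left hW hw hh nW nw (fin nh)
            (fun r hr ↦ hWw r (hJ' t ht hr)),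
          S.bound₁.duhamelSlice_congr_right hg' hZ hy (fin ng') nZ ny
            (fun r hr ↦ hZy r (hJ' t ht hr)), (H t ht).1] with ξ e1 e2 i1 i2 d1 d2 e3
        rw [slice_add i1 i2, e1 t (hJ t ht), e2 t (hJ t ht), e3]
        simp only [duhamel₁, d1, d2]
      · intro t ht
        filter_upwards [hS.slice_term₂ hW hg nW (fin ng), hS.slice_term₂ hg' hW (fin ng') nW,
          S.Y.ae_integrable_slice m3 (hS.norm_term₂_ne_top hW hg nW (fin ng)),
          S.Y.ae_integrable_slice m4 (hS.norm_term₂_ne_top hg' hW (fin ng') nW),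
          S.bound₂.duhamelSlice_congr_left hW hw (measurable_conjFourier hg) nW nw
            (norm_conjFourier_ne_top (fin ng)) (fun r hr ↦ hWw r (hJ' t ht hr)),
          S.bound₂.duhamelSlice_congr_right hg' (measurable_conjFourier hW)
            (measurable_conjFourier hw) (fin ng') (norm_conjFourier_ne_top nW)
            (norm_conjFourier_ne_top nw)
            (fun r hr ↦ slice_conjFourier_congr hWw r (hJ' t ht hr)), (H t ht).2]
          with ξ e1 e2 i1 i2 d1 d2 e3
        rw [slice_add i1 i2, e1 t (hJ t ht), e2 t (hJ t ht), e3]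
        simp only [duhamel₂, d1, d2]
  have lim : ∀ (B : ℝ≥0) (x : ℝ≥0∞), (∀ n : ℕ, x ≤ B * (2⁻¹ ^ n * N)) → x = 0 := by
    intro B x hx
    have h1 : Tendsto (fun n : ℕ ↦ (2⁻¹ : ℝ≥0∞) ^ n) atTop (𝓝 0) :=
      ENNReal.tendsto_pow_atTop_nhds_zero_of_lt_one (by simp)
    have h2 := ENNReal.Tendsto.const_mul (a := (B : ℝ≥0∞))
      (ENNReal.Tendsto.mul_const (b := N) h1 (Or.inr hNfin)) (Or.inr ENNReal.coe_ne_top)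
    rw [zero_mul, mul_zero] at h2
    exact le_antisymm (ge_of_tendsto' h2 hx) zero_le
  have zero_of : ∀ (X : BourgainSpace) (v : ℝ → ℂ), Measurable v → weightedL2 X.s v = 0 →
      ∀ᵐ ξ, v ξ = 0 := by
    intro X v hv h0
    have h1 : ∫⁻ ξ, (bw X.s ξ * ‖v ξ‖ₑ) ^ 2 = 0 := by
      rw [← l2_sq]; exact pow_eq_zero_iff two_ne_zero |>.2 h0
    rw [lintegral_eq_zero_iff (by fun_prop)] at h1
    filter_upwards [h1] with ξ hξ
    simpa [bw_ne_zero] using hξ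
  intro t ht
  obtain ⟨B₁, hB₁⟩ := exists_weightedL2_slice_le S.X.half_lt
  obtain ⟨B₂, hB₂⟩ := exists_weightedL2_slice_le S.Y.half_lt
  have wcongr : ∀ {s : ℝ} {u v : ℝ → ℂ}, (∀ᵐ ξ, u ξ = v ξ) → weightedL2 s u = weightedL2 s v :=
    fun h ↦ l2_congr_ae (h.mono fun ξ hξ ↦ by simp only [hξ])
  constructor
  · refine zero_of S.X _ (by fun_prop) (lim B₁ _ fun n ↦ ?_)
    obtain ⟨W, Z, hW, -, hle, hWw, -⟩ := key n
    rw [← wcongr (hWw t ht)]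
    exact (hB₁ _ S.X.measurable_phase _ _ hW t).trans
      (mul_le_mul_right (le_self_add.trans hle) _)
  · refine zero_of S.Y _ (by fun_prop) (lim B₂ _ fun n ↦ ?_)
    obtain ⟨W, Z, -, hZ, hle, -, hZy⟩ := key n
    rw [← wcongr (hZy t ht)]
    exact (hB₂ _ S.Y.measurable_phase _ _ hZ t).trans
      (mul_le_mul_right (le_add_self.trans hle) _)

theorem duhamel₁_add_time (hg : Measurable g) (hh : Measurable h) (ng : S.X.norm g ≠ ∞)
    (nh : S.Y.norm h ≠ ∞) : ∀ᵐ ξ, ∀ t₀ t, S.duhamel₁ g h (t₀ + t) ξ =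
      phaseGroup S.X.phase t ξ * S.duhamel₁ g h t₀ ξ +
        S.duhamel₁ (timeShift t₀ g) (timeShift t₀ h) t ξ := by
  filter_upwards [S.bound₁.ae_lintegral_prodOp hg hh ng nh] with ξ hξ t₀ t
  rw [duhamel₁, duhamelSlice_add_time S.X.measurable_phase
    (measurable_prodOp S.bound₁.measurable hg hh) hξ, timeShift_prodOp]
  rfl

theorem duhamel₂_add_time (hf : Measurable f) (hg : Measurable g) (nf : S.X.norm f ≠ ∞)
    (ng : S.X.norm g ≠ ∞) : ∀ᵐ ξ, ∀ t₀ t, S.duhamel₂ f g (t₀ + t) ξ =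
      phaseGroup S.Y.phase t ξ * S.duhamel₂ f g t₀ ξ +
        S.duhamel₂ (timeShift t₀ f) (timeShift t₀ g) t ξ := by
  filter_upwards [S.bound₂.ae_lintegral_prodOp hf (measurable_conjFourier hg) nf
    (norm_conjFourier_ne_top ng)] with ξ hξ t₀ t
  rw [duhamel₂, duhamelSlice_add_time S.Y.measurable_phase
    (measurable_prodOp S.bound₂.measurable hf (measurable_conjFourier hg)) hξ, timeShift_prodOp,
    ← conjFourier_timeShift]
  rfl

/-- If the difference of two solutions vanishes at time `t₀`, then its translate satisfies the
linearized equations with the translated coefficients. -/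
theorem LinearizedOn.timeShift {J : Set ℝ} (H : S.LinearizedOn g g' h w y J) (hg : Measurable g)
    (hg' : Measurable g') (hh : Measurable h) (hw : Measurable w) (hy : Measurable y)
    (ng : S.X.norm g ≠ ∞) (ng' : S.X.norm g' ≠ ∞) (nh : S.Y.norm h ≠ ∞) (nw : S.X.norm w ≠ ∞)
    (ny : S.Y.norm y ≠ ∞) {t₀ : ℝ} (ht₀ : t₀ ∈ J) (hw0 : ∀ᵐ ξ, slice w t₀ ξ = 0)
    (hy0 : ∀ᵐ ξ, slice y t₀ ξ = 0) :
    S.LinearizedOn (timeShift t₀ g) (timeShift t₀ g') (timeShift t₀ h) (timeShift t₀ w)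
      (timeShift t₀ y) {t | t₀ + t ∈ J} := by
  intro t ht
  constructor
  · filter_upwards [(H _ ht).1, (H _ ht₀).1, hw0, duhamel₁_add_time hw hh nw nh,
      duhamel₁_add_time hg' hy ng' ny] with ξ e1 e2 e3 e4 e5
    rw [slice_timeShift, e1, e4, e5]
    rw [e3] at e2
    linear_combination (-phaseGroup S.X.phase t ξ) * e2
  · filter_upwards [(H _ ht).2, (H _ ht₀).2, hy0, duhamel₂_add_time hw hg nw ng,
      duhamel₂_add_time hg' hw ng' nw] with ξ e1 e2 e3 e4 e5
    rw [slice_timeShift, e1, e4, e5]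
    rw [e3] at e2
    linear_combination (-phaseGroup S.Y.phase t ξ) * e2

/-- The linearized equations have only the trivial solution on `[-T, T]`: steps of a fixed length,
which depends only on the norms of the coefficients, reach every time from time `0`. -/
theorem LinearizedOn.slice_eq_zero (H : S.LinearizedOn g g' h w y (Icc (-T) T)) (hT : 0 ≤ T)
    (hg : Measurable g) (hg' : Measurable g') (hh : Measurable h) (hw : Measurable w)
    (hy : Measurable y) (ng : S.X.norm g ≠ ∞) (ng' : S.X.norm g' ≠ ∞) (nh : S.Y.norm h ≠ ∞)
    (nw : S.X.norm w ≠ ∞) (ny : S.Y.norm y ≠ ∞) :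
    ∀ t ∈ Icc (-T) T, (∀ᵐ ξ, slice w t ξ = 0) ∧ ∀ᵐ ξ, slice y t ξ = 0 := by
  obtain ⟨r, hr⟩ : ∃ r : ℝ≥0, S.X.norm g ≤ r ∧ S.X.norm g' ≤ r ∧ S.Y.norm h ≤ r := by
    refine ⟨(S.X.norm g + S.X.norm g' + S.Y.norm h).toNNReal, ?_⟩
    rw [ENNReal.coe_toNNReal (by finiteness)]
    exact ⟨le_self_add.trans le_self_add, le_add_self.trans le_self_add, le_add_self⟩
  obtain ⟨hr1, hr2, hr3⟩ := hr
  obtain ⟨δ, hS⟩ := S.exists_small (κ := 8⁻¹ / (r + 1)) (by positivity)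
  have hκ : 8⁻¹ / (r + 1) * r ≤ 8⁻¹ := by
    rw [div_mul_eq_mul_div, div_le_iff₀ (by positivity)]
    gcongr; exact le_self_add
  have step : ∀ t₀ ∈ Icc (-T) T, (∀ᵐ ξ, slice w t₀ ξ = 0) → (∀ᵐ ξ, slice y t₀ ξ = 0) →
      ∀ t, |t| ≤ δ → t₀ + t ∈ Icc (-T) T →
      (∀ᵐ ξ, slice w (t₀ + t) ξ = 0) ∧ ∀ᵐ ξ, slice y (t₀ + t) ξ = 0 := by
    intro t₀ ht₀ hw0 hy0 t ht htT
    have h1 := H.timeShift hg hg' hh hw hy ng ng' nh nw ny ht₀ hw0 hy0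
    have n1 : ∀ (X : BourgainSpace) (u : ℝ × ℝ → ℂ), X.norm (SBO.timeShift t₀ u) = X.norm u :=
      fun X u ↦ bourgainNorm_timeShift _ _ _ _ _
    have h2 := hS.slice_eq_zero hκ (J := {t | |t| ≤ δ ∧ t₀ + t ∈ Icc (-T) T}) (fun t h ↦ h.1)
      (fun t h v hv ↦ by
        obtain ⟨h1, h2⟩ := h
        rw [mem_Icc] at h2 ht₀
        rw [mem_uIcc] at hv
        rw [abs_le] at h1
        simp only [mem_ofPred_eq, mem_Icc, abs_le]
        rcases hv with ⟨a, b⟩ | ⟨a, b⟩ <;>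
          exact ⟨⟨by linarith, by linarith⟩, by linarith, by linarith⟩)
      (measurable_timeShift hg t₀) (measurable_timeShift hg' t₀) (measurable_timeShift hh t₀)
      (measurable_timeShift hw t₀) (measurable_timeShift hy t₀) (by rwa [n1]) (by rwa [n1])
      (by rwa [n1]) (by rwa [n1]) (by rwa [n1]) (fun r hr ↦ h1 r hr.2) t ⟨ht, htT⟩
    simpa only [slice_timeShift] using h2
  have h0 : (∀ᵐ ξ, slice w 0 ξ = 0) ∧ ∀ᵐ ξ, slice y 0 ξ = 0 := by
    have h1 := H 0 ⟨by linarith, hT⟩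
    simpa only [duhamel₁, duhamel₂, duhamelSlice, duhamelKernel, intervalIntegral.integral_same,
      zero_mul, integral_zero, add_zero] using h1
  intro t ht
  obtain ⟨n, hn⟩ := exists_nat_gt (|t| / δ)
  have hn0 : (0 : ℝ) < n := lt_of_le_of_lt (div_nonneg (abs_nonneg t) hS.pos.le) hn
  have hstep : |t / n| ≤ δ := by
    rw [abs_div, abs_of_pos hn0, div_le_iff₀ hn0]
    rw [div_lt_iff₀ hS.pos] at hn
    linarith
  have hmem : ∀ k : ℕ, k ≤ n → k * (t / n) ∈ Icc (-T) T := by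
    intro k hk
    have hk' : (k : ℝ) / n ≤ 1 := div_le_one_of_le₀ (by exact_mod_cast hk) hn0.le
    have hk0 : 0 ≤ (k : ℝ) / n := by positivity
    rw [show k * (t / n) = k / n * t by ring, mem_Icc, ← abs_le, abs_mul, abs_of_nonneg hk0]
    have := abs_le.2 ht
    nlinarith [abs_nonneg t]
  have hind : ∀ k : ℕ, k ≤ n → (∀ᵐ ξ, slice w (k * (t / n)) ξ = 0) ∧
      ∀ᵐ ξ, slice y (k * (t / n)) ξ = 0 := by
    intro k
    induction k with
    | zero => intro _; simpa using h0
    | succ k ih =>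
      intro hk
      obtain ⟨h1, h2⟩ := ih (by omega)
      have e : ((k + 1 : ℕ) : ℝ) * (t / n) = k * (t / n) + t / n := by push_cast; ring
      have hm := hmem (k + 1) hk
      rw [e] at hm ⊢
      exact step _ (hmem k (by omega)) h1 h2 _ hstep hm
  have := hind n le_rfl
  rwa [mul_div_cancel₀ _ hn0.ne'] at this

/-- Two solutions of the integral equations with the same data agree. -/
theorem slice_unique (hT : 0 ≤ T) (hg : Measurable g) (hh : Measurable h) (hg' : Measurable g')
    (hh' : Measurable h') (ng : S.X.norm g ≠ ∞) (nh : S.Y.norm h ≠ ∞) (ng' : S.X.norm g' ≠ ∞)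
    (nh' : S.Y.norm h' ≠ ∞) {φ ψ : ℝ → ℂ}
    (H₁ : ∀ t ∈ Icc (-T) T, ∀ᵐ ξ,
      slice g t ξ = phaseGroup S.X.phase t ξ * φ ξ + S.duhamel₁ g h t ξ)
    (H₂ : ∀ t ∈ Icc (-T) T, ∀ᵐ ξ,
      slice h t ξ = phaseGroup S.Y.phase t ξ * ψ ξ + S.duhamel₂ g g t ξ)
    (H₁' : ∀ t ∈ Icc (-T) T, ∀ᵐ ξ,
      slice g' t ξ = phaseGroup S.X.phase t ξ * φ ξ + S.duhamel₁ g' h' t ξ)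
    (H₂' : ∀ t ∈ Icc (-T) T, ∀ᵐ ξ,
      slice h' t ξ = phaseGroup S.Y.phase t ξ * ψ ξ + S.duhamel₂ g' g' t ξ) :
    ∀ t ∈ Icc (-T) T, (∀ᵐ ξ, slice g t ξ = slice g' t ξ) ∧ ∀ᵐ ξ, slice h t ξ = slice h' t ξ := by
  have nw : S.X.norm (fun z ↦ g z - g' z) ≠ ∞ :=
    ne_top_of_le_ne_top (ENNReal.add_ne_top.2 ⟨ng, ng'⟩) (S.X.norm_sub_le hg hg')
  have ny : S.Y.norm (fun z ↦ h z - h' z) ≠ ∞ :=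
    ne_top_of_le_ne_top (ENNReal.add_ne_top.2 ⟨nh, nh'⟩) (S.Y.norm_sub_le hh hh')
  have ig := S.X.ae_integrable_slice hg ng
  have ig' := S.X.ae_integrable_slice hg' ng'
  have ih := S.Y.ae_integrable_slice hh nh
  have ih' := S.Y.ae_integrable_slice hh' nh'
  have H : S.LinearizedOn g g' h (fun z ↦ g z - g' z) (fun z ↦ h z - h' z) (Icc (-T) T) := by
    intro t ht
    constructor
    · filter_upwards [H₁ t ht, H₁' t ht, ig, ig',
      S.bound₁.duhamelSlice_sub_left hg hg' hh ng ng' nh,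
        S.bound₁.duhamelSlice_sub_right hg' hh hh' ng' nh nh'] with ξ e1 e2 i1 i2 e3 e4
      rw [slice_sub i1 i2, e1, e2]
      simp only [duhamel₁, e3, e4]
      ring
    · filter_upwards [H₂ t ht, H₂' t ht, ih, ih', S.bound₂.duhamelSlice_sub_left hg hg'
        (measurable_conjFourier hg) ng ng' (norm_conjFourier_ne_top ng),
        S.bound₂.duhamelSlice_sub_right hg' (measurable_conjFourier hg)
        (measurable_conjFourier hg') ng' (norm_conjFourier_ne_top ng)
        (norm_conjFourier_ne_top ng')] with ξ e1 e2 i1 i2 e3 e4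
      rw [slice_sub i1 i2, e1, e2]
      simp only [duhamel₂, conjFourier_sub, e3, e4]
      ring
  intro t ht
  obtain ⟨h1, h2⟩ := H.slice_eq_zero hT hg hg' hh (hg.sub hg') (hh.sub hh') ng ng' nh nw ny t ht
  constructor
  · filter_upwards [h1, ig, ig'] with ξ e i1 i2
    rw [slice_sub i1 i2] at e
    exact sub_eq_zero.1 e
  · filter_upwards [h2, ih, ih'] with ξ e i1 i2
    rw [slice_sub i1 i2] at e
    exact sub_eq_zero.1 e

end DispersiveSystem

end

/-! ### The Schrödinger-Benjamin-Ono system -/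

section

/-- The system `S` is the Schrödinger-Benjamin-Ono system in spaces with the spatial exponents `s`
and `s'`. -/
structure DispersiveSystem.IsSchrodingerBenjaminOno (S : DispersiveSystem) (α β ν s s' : ℝ) :
    Prop where
  phase₁ : S.X.phase = schrodingerPhase
  phase₂ : S.Y.phase = benjaminOnoPhase ν
  s₁ : S.X.s = s
  s₂ : S.Y.s = s'
  m₁ : S.m₁ = fun _ ↦ -(Complex.I * α)
  m₂ : S.m₂ = fun ξ ↦ β * derivSymbol ξ

theorem enorm_mul_derivSymbol (β ξ : ℝ) :
    ‖(β * derivSymbol ξ : ℂ)‖ₑ = ‖(2 * Real.pi * β : ℂ)‖ₑ * ENNReal.ofReal |ξ| := by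
  rw [← Real.norm_eq_abs, ← Complex.norm_real, ofReal_norm, ← enorm_mul, derivSymbol,
    ← ofReal_norm, ← ofReal_norm]
  congr 1
  simp only [norm_mul, Complex.norm_I]
  ring

@[fun_prop]
theorem measurable_derivSymbol : Measurable derivSymbol := by unfold derivSymbol; fun_prop

/-- For the exponents of the theorem, both bilinear estimates hold with room to spare in the
modulation exponents. They require `2a ≥ s - s'`, `2b ≥ 1 - (s - s')` and `2a' ≥ 1/2 - (s - s')`;
the strict bounds `-1/2 < s - s' < 1` leave room for `a + b < 1` and `a' + b' < 1`. -/
theorem exists_schrodingerBenjaminOno {α β ν s s' : ℝ} (hαβ : α * β ≠ 0) (hν : |ν| ≠ 1)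
    (hs₁ : -1 / 2 ≤ s') (hs₂ : s' ≤ 2 * s - 1 / 2) (hs₃ : s - 1 < s') (hs₄ : s' < s + 1 / 2) :
    ∃ S : DispersiveSystem, S.IsSchrodingerBenjaminOno α β ν s s' := by
  have hα : α ≠ 0 := left_ne_zero_of_mul hαβ
  have hβ : β ≠ 0 := right_ne_zero_of_mul hαβ
  have hs : 0 ≤ s := by linarith
  obtain ⟨a, b, ha0, hda, hb, hdb, hab⟩ : ∃ a b : ℝ, 0 ≤ a ∧ s - s' ≤ 2 * a ∧ 1 / 2 < b ∧
      1 - (s - s') ≤ 2 * b ∧ a + b < 1 := by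
    rcases le_total (s - s') 0 with h | h
    · exact ⟨0, 7 / 8 - (s - s' + 1 / 2) / 4, le_rfl, by linarith, by linarith, by linarith,
        by linarith⟩
    · exact ⟨(s - s') / 2, 1 / 2 + (1 - (s - s')) / 4, by linarith, by linarith, by linarith,
        by linarith, by linarith⟩
  obtain ⟨a', b', ha', hda', hb', hab', ha2⟩ : ∃ a' b' : ℝ, 1 / 4 < a' ∧ 1 / 2 - (s - s') ≤ 2 * a' ∧
      1 / 2 < b' ∧ a' + b' < 1 ∧ a' < 1 / 2 := by
    rcases le_total (s - s') 0 with h | h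
    · exact ⟨1 / 4 - (s - s') / 2 + (s - s' + 1 / 2) / 8, 1 / 2 + (s - s' + 1 / 2) / 8,
        by linarith, by linarith, by linarith, by linarith, by linarith⟩
    · exact ⟨3 / 8, 1 / 2 + 1 / 16, by norm_num, by linarith, by norm_num, by norm_num,
        by norm_num⟩
  obtain ⟨C₁, hC₁⟩ := exists_l2_schrodinger_product_le hν hs (by linarith) (by linarith) ha0
    (by linarith) hda hb hb'
  obtain ⟨C₂, hC₂⟩ := exists_l2_benjaminOno_product_le hν hs hs₂ hb hdb ha' (by linarith) hda'
  let X : BourgainSpace := ⟨schrodingerPhase, s, b, measurable_schrodingerPhase, hb⟩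
  let Y : BourgainSpace := ⟨benjaminOnoPhase ν, s', b', measurable_benjaminOnoPhase ν, hb'⟩
  have H₁ : ProductBound (fun _ ↦ -(Complex.I * α)) X Y X a (‖(-(Complex.I * α) : ℂ)‖₊ * C₁) := by
    refine ⟨measurable_const, Eventually.of_forall fun _ ↦ ?_, by linarith, fun f g hf hg ↦ ?_⟩
    · simpa using hα
    · simp only [mul_left_comm _ ‖(-(Complex.I * α) : ℂ)‖ₑ]
      rw [l2_const_mul (by finiteness), ENNReal.coe_mul, mul_assoc, ← enorm_eq_nnnorm]
      exact mul_le_mul_right (hC₁ f g hf.aemeasurable hg.aemeasurable) _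
  have H₂ : ProductBound (fun ξ ↦ β * derivSymbol ξ) X X.conjugate Y a'
      (‖(2 * Real.pi * β : ℂ)‖₊ * C₂) := by
    refine ⟨by fun_prop, ?_, ha2, fun f g hf hg ↦ ?_⟩
    · filter_upwards [Measure.ae_ne volume (0 : ℝ)] with ξ hξ
      simp [derivSymbol, hβ, hξ, Real.pi_ne_zero]
    · simp only [enorm_mul_derivSymbol, mul_assoc ‖(2 * Real.pi * β : ℂ)‖ₑ,
        mul_left_comm _ ‖(2 * Real.pi * β : ℂ)‖ₑ]
      rw [l2_const_mul (by finiteness), ENNReal.coe_mul, ← enorm_eq_nnnorm,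
        mul_assoc ‖(2 * Real.pi * β : ℂ)‖ₑ]
      refine mul_le_mul_right ?_ _
      have h := hC₂ f (fun z ↦ g (-z)) hf.aemeasurable (hg.comp measurable_neg).aemeasurable
      simp only [neg_neg] at h
      refine h.trans (le_of_eq ?_)
      congr 2
      have h2 := (Measure.measurePreserving_neg (volume : Measure (ℝ × ℝ))).lintegral_comp_emb
        (MeasurableEquiv.neg (ℝ × ℝ)).measurableEmbedding
        (fun z ↦ (X.conjugate.weight z * g z) ^ 2)
      rw [l2, l2, ← h2]
      simp only [X.conjugate_weight, neg_neg]
      rfl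
  exact ⟨⟨X, Y, _, _, a, a', _, _, H₁, H₂, ha0, by linarith, hab, hab'⟩, rfl, rfl, rfl, rfl, rfl,
    rfl⟩

theorem prodOp_const (c : ℂ) (g h : ℝ × ℝ → ℂ) :
    prodOp (fun _ ↦ c) g h = fun z ↦ c * productFourier g h z := rfl

theorem duhamelSlice_const_mul (p : ℝ → ℝ) (c : ℂ) (F : ℝ × ℝ → ℂ) (t ξ : ℝ) :
    duhamelSlice p (fun z ↦ c * F z) t ξ = c * duhamelSlice p F t ξ := by
  simp only [duhamelSlice, mul_left_comm _ c, integral_const_mul]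

namespace DispersiveSystem.IsSchrodingerBenjaminOno

variable {S : DispersiveSystem} {α β ν s s' : ℝ}

theorem duhamel₁_eq (H : S.IsSchrodingerBenjaminOno α β ν s s') (g h : ℝ × ℝ → ℂ) (t ξ : ℝ) :
    S.duhamel₁ g h t ξ =
      -(Complex.I * α) * duhamelSlice schrodingerPhase (productFourier g h) t ξ := by
  rw [duhamel₁, H.phase₁, H.m₁, prodOp_const, duhamelSlice_const_mul]

theorem duhamel₂_eq (H : S.IsSchrodingerBenjaminOno α β ν s s') (f g : ℝ × ℝ → ℂ) (t ξ : ℝ) :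
    S.duhamel₂ f g t ξ = β * duhamelSlice (benjaminOnoPhase ν)
      (fun z ↦ derivSymbol z.2 * productFourier f (conjFourier g) z) t ξ := by
  have e : prodOp (fun ξ ↦ β * derivSymbol ξ) f (conjFourier g) =
      fun z ↦ β * (derivSymbol z.2 * productFourier f (conjFourier g) z) :=
    funext fun z ↦ mul_assoc _ _ _
  rw [duhamel₂, H.phase₂, H.m₂, e, duhamelSlice_const_mul]

end DispersiveSystem.IsSchrodingerBenjaminOno

/-! ### Elements of Bourgain spaces and their time slices -/

theorem BourgainSpace.isBourgain (X : BourgainSpace) {g : ℝ × ℝ → ℂ} (hg : Measurable g)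
    (ng : X.norm g ≠ ∞) {u : ℝ → 𝓢'(ℝ, ℂ)} (hu : ∀ t, HasFourier (u t) (slice g t)) :
    IsBourgain X.phase X.s X.b u g := by
  refine ⟨⟨(X.measurable_cweight.mul hg).aestronglyMeasurable, ?_⟩,
    X.ae_integrable_slice hg ng, hu⟩
  exact lt_top_iff_ne_top.2 ((X.eLpNorm_cweight_mul g).trans_ne ng)

/-- An element of a Bourgain space has a measurable representative. -/
theorem BourgainSpace.exists_measurable (X : BourgainSpace) {g : ℝ × ℝ → ℂ} {u : ℝ → 𝓢'(ℝ, ℂ)}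
    (H : IsBourgain X.phase X.s X.b u g) :
    ∃ g', Measurable g' ∧ g =ᵐ[volume] g' ∧ X.norm g' ≠ ∞ ∧
      ∀ t, HasFourier (u t) (slice g' t) := by
  obtain ⟨hL, -, hu⟩ := H
  have hae : AEMeasurable g := by
    have h1 : AEMeasurable fun z ↦ (X.cweight z)⁻¹ * (X.cweight z * g z) :=
      X.measurable_cweight.inv.aemeasurable.mul hL.1.aemeasurable
    simpa only [inv_mul_cancel_left₀ (X.cweight_ne_zero _)] using h1
  have e := hae.ae_eq_mk
  refine ⟨hae.mk g, hae.measurable_mk, e, ?_, fun t ↦ (hu t).congr ?_⟩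
  · rw [← X.norm_congr e, ← X.eLpNorm_cweight_mul]
    exact hL.2.ne
  · exact (slice_congr e).mono fun ξ hξ ↦ hξ t

theorem conjFourier_congr {g g' : ℝ × ℝ → ℂ} (h : g =ᵐ[volume] g') :
    conjFourier g =ᵐ[volume] conjFourier g' := by
  have h1 := (Measure.measurePreserving_neg (volume : Measure (ℝ × ℝ))).quasiMeasurePreserving.ae h
  filter_upwards [h1] with z hz
  simp only [conjFourier, hz]

theorem productFourier_congr {f f' g g' : ℝ × ℝ → ℂ} (hf : f =ᵐ[volume] f')
    (hg : g =ᵐ[volume] g') : productFourier f g = productFourier f' g' := by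
  have := prodOp_congr (fun _ ↦ 1) hf hg
  simpa only [prodOp_const, one_mul] using this

theorem weightedL2_phaseGroup_mul (p : ℝ → ℝ) (s t : ℝ) (φ : ℝ → ℂ) :
    weightedL2 s (fun ξ ↦ phaseGroup p t ξ * φ ξ) = weightedL2 s φ := by
  simp only [weightedL2, enorm_mul, enorm_phaseGroup, one_mul]

namespace DispersiveSystem

variable {S : DispersiveSystem} {α β ν s s' T δ : ℝ} {κ r : ℝ≥0} {φ ψ : 𝓢'(ℝ, ℂ)}
  {φh ψh : ℝ → ℂ} {u v : ℝ → 𝓢'(ℝ, ℂ)} {g h : ℝ × ℝ → ℂ}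

/-- The integral equations on the Fourier side. -/
theorem IsSchrodingerBenjaminOno.exists_of_isSolution
    (H : S.IsSchrodingerBenjaminOno α β ν s s') (hφ : HasFourier φ φh) (hψ : HasFourier ψ ψh)
    (hsol : IsSolution α β ν s s' S.X.b S.Y.b T φ ψ u v) :
    ∃ g h, Measurable g ∧ Measurable h ∧ S.X.norm g ≠ ∞ ∧ S.Y.norm h ≠ ∞ ∧
      (∀ t, HasFourier (u t) (slice g t)) ∧ (∀ t, HasFourier (v t) (slice h t)) ∧
      (∀ t ∈ Icc (-T) T, ∀ᵐ ξ,
        slice g t ξ = phaseGroup S.X.phase t ξ * φh ξ + S.duhamel₁ g h t ξ) ∧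
      ∀ t ∈ Icc (-T) T, ∀ᵐ ξ,
        slice h t ξ = phaseGroup S.Y.phase t ξ * ψh ξ + S.duhamel₂ g g t ξ := by
  obtain ⟨g, h, hg, hh, ⟨-, hu⟩, -, hv⟩ := hsol
  rw [← H.phase₁, ← H.s₁] at hg
  rw [← H.phase₂, ← H.s₂] at hh
  obtain ⟨g', mg, eg, ng, hug⟩ := S.X.exists_measurable hg
  obtain ⟨h', mh, eh, nh, hvh⟩ := S.Y.exists_measurable hh
  refine ⟨g', h', mg, mh, ng, nh, hug, hvh, fun t ht ↦ ?_, fun t ht ↦ ?_⟩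
  · obtain ⟨w₀, w₁, ⟨φ', hφ', hw₀⟩, ⟨-, hw₁⟩, e⟩ := hu t ht
    rw [productFourier_congr eg eh, schrodingerGroup_eq_phaseGroup] at hw₁
    have h1 := hw₀.sub (hw₁.smul (Complex.I * α))
    rw [← e] at h1
    filter_upwards [(hug t).ae_eq h1, hφ'.ae_eq hφ] with ξ e1 e2
    rw [e1, e2, H.duhamel₁_eq, schrodingerGroup_eq_phaseGroup, H.phase₁, duhamelSlice]
    ring
  · obtain ⟨w₀, w₁, ⟨ψ', hψ', hw₀⟩, ⟨-, hw₁⟩, e⟩ := hv t ht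
    rw [productFourier_congr eg (conjFourier_congr eg), benjaminOnoGroup_eq_phaseGroup] at hw₁
    have h1 := hw₀.add (hw₁.smul β)
    rw [← e] at h1
    filter_upwards [(hvh t).ae_eq h1, hψ'.ae_eq hψ] with ξ e1 e2
    rw [e1, e2, H.duhamel₂_eq, benjaminOnoGroup_eq_phaseGroup, H.phase₂, duhamelSlice]

/-- A truncated solution yields a solution of the integral equations on `[-δ, δ]`. -/
theorem IsSchrodingerBenjaminOno.isSolution (H : S.IsSchrodingerBenjaminOno α β ν s s')
    (hα : α ≠ 0) (hβ : β ≠ 0) (hS : S.Small δ κ)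
    (hφ : HasFourier φ φh) (hψ : HasFourier ψ ψh) (mφ : Measurable φh) (mψ : Measurable ψh)
    (wφ : weightedL2 s φh ≠ ∞) (wψ : weightedL2 s' ψh ≠ ∞)
    (nφ : S.X.norm (linearOp S.X.phase φh) ≠ ∞) (nψ : S.Y.norm (linearOp S.Y.phase ψh) ≠ ∞)
    (hgh : S.IsTruncatedSolution δ φh ψh r g h) (hu : ∀ t, HasFourier (u t) (slice g t))
    (hv : ∀ t, HasFourier (v t) (slice h t)) :
    IsSolution α β ν s s' S.X.b S.Y.b δ φ ψ u v := by
  have hg := hgh.measurable₁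
  have hh := hgh.measurable₂
  have ng := ne_top_of_le_ne_top ENNReal.coe_ne_top hgh.norm_le₁
  have nh := ne_top_of_le_ne_top ENNReal.coe_ne_top hgh.norm_le₂
  have hX := S.X.measurable_phase
  have hY := S.Y.measurable_phase
  have ncg := norm_conjFourier_ne_top ng
  have mcg := measurable_conjFourier hg
  have heq := hS.slice_eq mφ mψ nφ nψ hgh
  obtain ⟨B₁, hB₁⟩ := exists_weightedL2_slice_le S.X.half_lt
  obtain ⟨B₂, hB₂⟩ := exists_weightedL2_slice_le S.Y.half_lt
  refine ⟨g, h, ?_, ?_, ⟨S.bound₁.productConverges hg hh ng nh, fun t ht ↦ ?_⟩,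
    S.bound₂.productConverges hg mcg ng ncg, fun t ht ↦ ?_⟩
  · rw [← H.phase₁, ← H.s₁]; exact S.X.isBourgain hg ng hu
  · rw [← H.phase₂, ← H.s₂]; exact S.Y.isBourgain hh nh hv
  · obtain ⟨w₀, hw₀⟩ := exists_hasFourier (s := s) (h := fun ξ ↦ phaseGroup S.X.phase t ξ * φh ξ)
      (by unfold phaseGroup; fun_prop) (by rwa [weightedL2_phaseGroup_mul])
    obtain ⟨w₁, hw₁⟩ := exists_hasFourier (s := S.X.s) (h := slice (S.term₁ δ g h) t)
      (measurable_slice (measurable_term₁ hg hh) t).aemeasurable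
      (ne_top_of_le_ne_top (ENNReal.mul_ne_top ENNReal.coe_ne_top
        (hS.norm_term₁_ne_top hg hh ng nh)) (hB₁ _ hX _ _ (measurable_term₁ hg hh) t))
    have hc : -(Complex.I * α) ≠ 0 := by simpa using hα
    have hw₂ : HasFourier ((-(Complex.I * α))⁻¹ • w₁)
        (duhamelSlice schrodingerPhase (productFourier g h) t) := by
      refine (hw₁.smul _).congr ?_
      filter_upwards [hS.slice_term₁ hg hh ng nh] with ξ e1
      rw [e1 t (abs_le.2 ht), H.duhamel₁_eq, inv_mul_cancel_left₀ hc]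
    refine ⟨w₀, (-(Complex.I * α))⁻¹ • w₁, ⟨φh, hφ, ?_⟩, ⟨?_, ?_⟩, ?_⟩
    · rw [schrodingerGroup_eq_phaseGroup, ← H.phase₁]; exact hw₀
    · rw [schrodingerGroup_eq_phaseGroup, ← H.phase₁]
      filter_upwards [S.bound₁.ae_lintegral_prodOp hg hh ng nh] with ξ hξ
      have h1 := integrable_duhamelKernel_mul hX
        (measurable_prodOp S.bound₁.measurable hg hh) hξ t
      rw [H.m₁, prodOp_const] at h1
      have h2 := h1.const_mul (-(Complex.I * α))⁻¹
      simpa only [mul_left_comm _ (-(Complex.I * α)), mul_inv_cancel_left₀ hc] using h2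
    · rw [schrodingerGroup_eq_phaseGroup]; exact hw₂
    · refine (hu t).eq ((hw₀.sub (hw₂.smul (Complex.I * α))).congr ?_)
      filter_upwards [heq] with ξ e1
      rw [(e1 t (abs_le.2 ht)).1, H.duhamel₁_eq]; ring
  · obtain ⟨w₀, hw₀⟩ := exists_hasFourier (s := s') (h := fun ξ ↦ phaseGroup S.Y.phase t ξ * ψh ξ)
      (by unfold phaseGroup; fun_prop) (by rwa [weightedL2_phaseGroup_mul])
    obtain ⟨w₁, hw₁⟩ := exists_hasFourier (s := S.Y.s) (h := slice (S.term₂ δ g g) t)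
      (measurable_slice (measurable_term₂ hg hg) t).aemeasurable
      (ne_top_of_le_ne_top (ENNReal.mul_ne_top ENNReal.coe_ne_top
        (hS.norm_term₂_ne_top hg hg ng ng)) (hB₂ _ hY _ _ (measurable_term₂ hg hg) t))
    have hc : (β : ℂ) ≠ 0 := by exact_mod_cast hβ
    have hw₂ : HasFourier ((β : ℂ)⁻¹ • w₁) (duhamelSlice (benjaminOnoPhase ν)
        (fun z ↦ derivSymbol z.2 * productFourier g (conjFourier g) z) t) := by
      refine (hw₁.smul _).congr ?_
      filter_upwards [hS.slice_term₂ hg hg ng ng] with ξ e1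
      rw [e1 t (abs_le.2 ht), H.duhamel₂_eq, inv_mul_cancel_left₀ hc]
    refine ⟨w₀, (β : ℂ)⁻¹ • w₁, ⟨ψh, hψ, ?_⟩, ⟨?_, ?_⟩, ?_⟩
    · rw [benjaminOnoGroup_eq_phaseGroup, ← H.phase₂]; exact hw₀
    · rw [benjaminOnoGroup_eq_phaseGroup, ← H.phase₂]
      filter_upwards [S.bound₂.ae_lintegral_prodOp hg mcg ng ncg] with ξ hξ
      have h1 := integrable_duhamelKernel_mul hY
        (measurable_prodOp S.bound₂.measurable hg mcg) hξ t
      rw [H.m₂] at h1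
      have h2 := h1.const_mul (β : ℂ)⁻¹
      simpa only [prodOp, mul_assoc, mul_left_comm _ (β : ℂ), mul_inv_cancel_left₀ hc] using h2
    · rw [benjaminOnoGroup_eq_phaseGroup]; exact hw₂
    · refine (hv t).eq ((hw₀.add (hw₂.smul β)).congr ?_)
      filter_upwards [heq] with ξ e1
      rw [(e1 t (abs_le.2 ht)).2, H.duhamel₂_eq]

end DispersiveSystem

/-! ### Real-valuedness -/

theorem conj_phaseGroup {p : ℝ → ℝ} (hp : ∀ ξ, p (-ξ) = -p ξ) (t ξ : ℝ) :
    conj (phaseGroup p t ξ) = phaseGroup p t (-ξ) := by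
  rw [phaseGroup, phaseGroup, ← Complex.exp_conj, hp]
  congr 1
  simp only [map_neg, map_mul, Complex.conj_I, Complex.conj_ofReal, map_ofNat]
  push_cast; ring

theorem conj_duhamelKernel {p : ℝ → ℝ} (hp : ∀ ξ, p (-ξ) = -p ξ) (t τ ξ : ℝ) :
    conj (duhamelKernel (phaseGroup p) t τ ξ) = duhamelKernel (phaseGroup p) t (-τ) (-ξ) := by
  rw [duhamelKernel, duhamelKernel, intervalIntegral, intervalIntegral, map_sub, ← integral_conj,
    ← integral_conj]
  simp only [map_mul, conj_exp_two_pi, conj_phaseGroup hp]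

/-- The Duhamel integral of a real-valued function is real-valued, for an odd dispersion. -/
theorem duhamelSlice_neg {p : ℝ → ℝ} (hp : ∀ ξ, p (-ξ) = -p ξ) {F : ℝ × ℝ → ℂ}
    (hF : ∀ z, F (-z) = conj (F z)) (t ξ : ℝ) :
    duhamelSlice p F t (-ξ) = conj (duhamelSlice p F t ξ) := by
  rw [duhamelSlice, duhamelSlice, ← integral_conj, ← integral_neg_eq_self]
  refine integral_congr_ae (Eventually.of_forall fun τ ↦ ?_)
  simp only [map_mul, conj_duhamelKernel hp, ← hF, Prod.neg_mk]

theorem productFourier_conjFourier_neg (g : ℝ × ℝ → ℂ) (z : ℝ × ℝ) :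
    productFourier g (conjFourier g) (-z) = conj (productFourier g (conjFourier g) z) := by
  conv_lhs => rw [productFourier_comm]
  rw [productFourier, productFourier, ← integral_conj, ← integral_neg_eq_self]
  refine integral_congr_ae (Eventually.of_forall fun z₁ ↦ ?_)
  simp only [conjFourier, map_mul, Complex.conj_conj]
  congr 3; abel

theorem benjaminOnoPhase_neg (ν ξ : ℝ) : benjaminOnoPhase ν (-ξ) = -benjaminOnoPhase ν ξ := by
  simp [benjaminOnoPhase]

/-- The second component of a solution is real-valued, because the Benjamin-Ono group and the
nonlinear term `∂ₓ(|u|²)` are. -/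
theorem isRealValued_of_slice_eq {S : DispersiveSystem} {α β ν s s' : ℝ}
    (H : S.IsSchrodingerBenjaminOno α β ν s s') {ψ v : 𝓢'(ℝ, ℂ)} {ψh vh : ℝ → ℂ}
    (hψ : HasFourier ψ ψh) (hv : HasFourier v vh) (hr : IsRealValued ψ) {t : ℝ}
    {g : ℝ × ℝ → ℂ}
    (heq : ∀ᵐ ξ, vh ξ = phaseGroup S.Y.phase t ξ * ψh ξ + S.duhamel₂ g g t ξ) :
    IsRealValued v := by
  rw [hψ.isRealValued_iff] at hr
  rw [hv.isRealValued_iff]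
  have hneg := (Measure.measurePreserving_neg (volume : Measure ℝ)).quasiMeasurePreserving.ae heq
  filter_upwards [hr, heq, hneg] with ξ h1 h2 h3
  rw [h3, h2, map_add, map_mul, h1, H.duhamel₂_eq, H.duhamel₂_eq, H.phase₂,
    conj_phaseGroup (benjaminOnoPhase_neg ν), map_mul, Complex.conj_ofReal,
    duhamelSlice_neg (benjaminOnoPhase_neg ν)]
  intro z
  rw [map_mul, ← productFourier_conjFourier_neg]
  congr 1
  simp only [derivSymbol, map_mul, Complex.conj_I, Complex.conj_ofReal, map_ofNat, Prod.snd_neg]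
  push_cast; ring

end

/-! ### Local well-posedness -/

section

variable {α β ν s s' R : ℝ}

/-- A solution with data in the ball, together with the truncated solution that it comes from. -/
structure IsConstructedSolution (S : DispersiveSystem) (s s' δ : ℝ) (r : ℝ≥0) (φ ψ : 𝓢'(ℝ, ℂ))
    (φh ψh : ℝ → ℂ) (g h : ℝ × ℝ → ℂ) (u v : ℝ → 𝓢'(ℝ, ℂ)) : Prop where
  measurable₁ : Measurable φh
  measurable₂ : Measurable ψh
  fourier₁ : HasFourier φ φh
  fourier₂ : HasFourier ψ ψh
  finite₁ : weightedL2 s φh ≠ ∞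
  finite₂ : weightedL2 s' ψh ≠ ∞
  linear_le₁ : S.X.norm (linearOp S.X.phase φh) ≤ r / 2
  linear_le₂ : S.Y.norm (linearOp S.Y.phase ψh) ≤ r / 2
  truncated : S.IsTruncatedSolution δ φh ψh r g h
  slices₁ : ∀ t, HasFourier (u t) (slice g t)
  slices₂ : ∀ t, HasFourier (v t) (slice h t)

theorem weightedL2_sub_ne_top {s : ℝ} {f f' : ℝ → ℂ} (hf : Measurable f) (hf' : Measurable f')
    (h : weightedL2 s f ≠ ∞) (h' : weightedL2 s f' ≠ ∞) :
    weightedL2 s (fun ξ ↦ f ξ - f' ξ) ≠ ∞ := by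
  refine ne_top_of_le_ne_top (ENNReal.add_ne_top.2 ⟨h, h'⟩)
    (le_trans (l2_mono fun ξ ↦ ?_) (l2_add_le (by fun_prop) (by fun_prop)))
  rw [← mul_add]; exact mul_le_mul_right enorm_sub_le _

/-- The constants `C₁` and `C₂` compare the norms of the free evolutions with those of the data, so
that data in the ball of radius `R` have free evolutions of size at most `r / 2`. -/
theorem exists_constructedSolution {S : DispersiveSystem} {δ : ℝ} {κ r C₁ C₂ : ℝ≥0}
    (H : S.IsSchrodingerBenjaminOno α β ν s s') (hS : S.Small δ κ) (hκ : κ * r ≤ 8⁻¹)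
    (hC₁ : ∀ f : ℝ → ℂ, Measurable f →
      S.X.norm (linearOp S.X.phase f) = C₁ * weightedL2 S.X.s f)
    (hC₂ : ∀ f : ℝ → ℂ, Measurable f →
      S.Y.norm (linearOp S.Y.phase f) = C₂ * weightedL2 S.Y.s f)
    (hr₁ : (C₁ * ENNReal.ofReal R : ℝ≥0∞) ≤ r / 2) (hr₂ : (C₂ * ENNReal.ofReal R : ℝ≥0∞) ≤ r / 2)
    {φ ψ : 𝓢'(ℝ, ℂ)} (hball : InBall s s' R φ ψ) :
    ∃ φh ψh g h u v, IsConstructedSolution S s s' δ r φ ψ φh ψh g h u v := by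
  obtain ⟨h1, h2, -, hlt⟩ := hball
  obtain ⟨φh, mφ, hφ, wφ⟩ := exists_hasFourier_of_memSobolev h1
  obtain ⟨ψh, mψ, hψ, wψ⟩ := exists_hasFourier_of_memSobolev h2
  rw [hφ.sobolevNorm_eq wφ, hψ.sobolevNorm_eq wψ] at hlt
  have n1 : S.X.norm (linearOp S.X.phase φh) ≤ r / 2 := by
    rw [hC₁ _ mφ, H.s₁]
    exact (mul_le_mul_right (le_self_add.trans hlt.le) _).trans hr₁
  have n2 : S.Y.norm (linearOp S.Y.phase ψh) ≤ r / 2 := by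
    rw [hC₂ _ mψ, H.s₂]
    exact (mul_le_mul_right (le_add_self.trans hlt.le) _).trans hr₂
  obtain ⟨g, h, hgh⟩ := hS.exists_truncatedSolution hκ mφ mψ n1 n2
  obtain ⟨u, hu⟩ := exists_evolution S.X.half_lt S.X.measurable_phase hgh.measurable₁
    (ne_top_of_le_ne_top ENNReal.coe_ne_top hgh.norm_le₁)
  obtain ⟨v, hv⟩ := exists_evolution S.Y.half_lt S.Y.measurable_phase hgh.measurable₂
    (ne_top_of_le_ne_top ENNReal.coe_ne_top hgh.norm_le₂)
  exact ⟨φh, ψh, g, h, u, v, mφ, mψ, hφ, hψ, wφ, wψ, n1, n2, hgh, hu, hv⟩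

end

end

end SBO

theorem theorem1p1 (α β ν s s' : ℝ) (hαβ : α * β ≠ 0) (hν : |ν| ≠ 1)
    (hs₁ : -1 / 2 ≤ s') (hs₂ : s' ≤ 2 * s - 1 / 2) (hs₃ : s - 1 < s') (hs₄ : s' < s + 1 / 2) :
    ∀ R : ℝ, 0 < R →
      ∃ T : ℝ, 0 < T ∧ ∃ b b' : ℝ, 1 / 2 < b ∧ 1 / 2 < b' ∧
        ∃ S : 𝓢'(ℝ, ℂ) → 𝓢'(ℝ, ℂ) → (ℝ → 𝓢'(ℝ, ℂ)) × (ℝ → 𝓢'(ℝ, ℂ)),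
          (∀ φ ψ : 𝓢'(ℝ, ℂ), InBall s s' R φ ψ →
            IsSolution α β ν s s' b b' T φ ψ (S φ ψ).1 (S φ ψ).2 ∧
            (∀ u v : ℝ → 𝓢'(ℝ, ℂ), IsSolution α β ν s s' b b' T φ ψ u v →
              ∀ t ∈ Icc (-T) T, u t = (S φ ψ).1 t ∧ v t = (S φ ψ).2 t) ∧
            ContinuousInSobolev s T (S φ ψ).1 ∧
            ContinuousInSobolev s' T (S φ ψ).2 ∧
            ∀ t ∈ Icc (-T) T, IsRealValued ((S φ ψ).2 t)) ∧
          ∃ L : ℝ≥0, ∀ φ₁ ψ₁ φ₂ ψ₂ : 𝓢'(ℝ, ℂ), InBall s s' R φ₁ ψ₁ → InBall s s' R φ₂ ψ₂ →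
            supSobolevDist s T (S φ₁ ψ₁).1 (S φ₂ ψ₂).1 +
                supSobolevDist s' T (S φ₁ ψ₁).2 (S φ₂ ψ₂).2 ≤
              L * (sobolevNorm s (φ₁ - φ₂) + sobolevNorm s' (ψ₁ - ψ₂)) := by
  intro R hR
  have hα : α ≠ 0 := left_ne_zero_of_mul hαβ
  have hβ : β ≠ 0 := right_ne_zero_of_mul hαβ
  obtain ⟨S, H⟩ := exists_schrodingerBenjaminOno hαβ hν hs₁ hs₂ hs₃ hs₄
  have hX := S.X.measurable_phase
  have hY := S.Y.measurable_phase
  have hbX : S.X.b ≤ 1 := by linarith [S.lt_one₁, S.nonneg₁]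
  have hbY : S.Y.b ≤ 1 := by linarith [S.lt_one₂, S.nonneg₂]
  obtain ⟨C₁, hC₁⟩ := exists_bourgainNorm_linearOp_eq hbX
  obtain ⟨C₂, hC₂⟩ := exists_bourgainNorm_linearOp_eq hbY
  replace hC₁ : ∀ f : ℝ → ℂ, Measurable f →
      S.X.norm (linearOp S.X.phase f) = C₁ * weightedL2 S.X.s f := fun f hf ↦ hC₁ _ hX _ f hf
  replace hC₂ : ∀ f : ℝ → ℂ, Measurable f →
      S.Y.norm (linearOp S.Y.phase f) = C₂ * weightedL2 S.Y.s f := fun f hf ↦ hC₂ _ hY _ f hf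
  -- the radius of the ball for the contraction
  set r : ℝ≥0 := 2 * (C₁ + C₂) * R.toNNReal with hr
  have hr2 : (r : ℝ≥0∞) / 2 = (C₁ + C₂) * ENNReal.ofReal R := by
    rw [hr, ENNReal.div_eq_inv_mul]
    push_cast
    rw [← mul_assoc, ← mul_assoc, ENNReal.inv_mul_cancel (by norm_num) (by norm_num), one_mul]
    rfl
  have hr₁ : (C₁ * ENNReal.ofReal R : ℝ≥0∞) ≤ r / 2 := by
    rw [hr2]; gcongr; exact le_self_add
  have hr₂ : (C₂ * ENNReal.ofReal R : ℝ≥0∞) ≤ r / 2 := by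
    rw [hr2]; gcongr; exact le_add_self
  obtain ⟨T, hS⟩ := S.exists_small (κ := 8⁻¹ / (r + 1)) (by positivity)
  have hκ : 8⁻¹ / (r + 1) * r ≤ 8⁻¹ := by
    rw [div_mul_eq_mul_div, div_le_iff₀ (by positivity)]
    gcongr; exact le_self_add
  have hex : ∀ φ ψ : 𝓢'(ℝ, ℂ), ∃ P : (ℝ → 𝓢'(ℝ, ℂ)) × (ℝ → 𝓢'(ℝ, ℂ)), InBall s s' R φ ψ →
      ∃ φh ψh g h, IsConstructedSolution S s s' T r φ ψ φh ψh g h P.1 P.2 := by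
    intro φ ψ
    by_cases hb : InBall s s' R φ ψ
    · obtain ⟨φh, ψh, g, h, u, v, hc⟩ := exists_constructedSolution H hS hκ hC₁ hC₂ hr₁ hr₂ hb
      exact ⟨(u, v), fun _ ↦ ⟨φh, ψh, g, h, hc⟩⟩
    · exact ⟨(0, 0), fun h ↦ absurd h hb⟩
  -- outside of the ball the value of the flow map is immaterial
  choose flow hflow using hex
  have hrfin : (r : ℝ≥0∞) / 2 ≠ ∞ := ENNReal.div_ne_top ENNReal.coe_ne_top two_ne_zero
  refine ⟨T, hS.pos, S.X.b, S.Y.b, S.X.half_lt, S.Y.half_lt, flow, fun φ ψ hball ↦ ?_, ?_⟩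
  · obtain ⟨φh, ψh, g, h, hc⟩ := hflow φ ψ hball
    have hgh := hc.truncated
    have n1 := ne_top_of_le_ne_top hrfin hc.linear_le₁
    have n2 := ne_top_of_le_ne_top hrfin hc.linear_le₂
    have ng := ne_top_of_le_ne_top ENNReal.coe_ne_top hgh.norm_le₁
    have nh := ne_top_of_le_ne_top ENNReal.coe_ne_top hgh.norm_le₂
    have heq := hS.slice_eq hc.measurable₁ hc.measurable₂ n1 n2 hgh
    refine ⟨H.isSolution hα hβ hS hc.fourier₁ hc.fourier₂ hc.measurable₁ hc.measurable₂ hc.finite₁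
      hc.finite₂ n1 n2 hgh hc.slices₁ hc.slices₂, fun u v huv t ht ↦ ?_, ?_, ?_, fun t ht ↦ ?_⟩
    · obtain ⟨g', h', mg', mh', ng', nh', hu, hv, e1, e2⟩ :=
        H.exists_of_isSolution hc.fourier₁ hc.fourier₂ huv
      obtain ⟨h1, h2⟩ := S.slice_unique hS.pos.le mg' mh' hgh.measurable₁ hgh.measurable₂ ng' nh'
        ng nh e1 e2 (fun t ht ↦ heq.mono fun ξ hξ ↦ (hξ t (abs_le.2 ht)).1)
        (fun t ht ↦ heq.mono fun ξ hξ ↦ (hξ t (abs_le.2 ht)).2) t ht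
      exact ⟨((hu t).congr h1).eq (hc.slices₁ t), ((hv t).congr h2).eq (hc.slices₂ t)⟩
    · rw [← H.s₁]
      exact continuousInSobolev_of_hasFourier S.X.half_lt hX hgh.measurable₁ ng hc.slices₁ T
    · rw [← H.s₂]
      exact continuousInSobolev_of_hasFourier S.Y.half_lt hY hgh.measurable₂ nh hc.slices₂ T
    · exact isRealValued_of_slice_eq H hc.fourier₂ (hc.slices₂ t) hball.2.2.1
        (heq.mono fun ξ hξ ↦ (hξ t (abs_le.2 ht)).2)
  · obtain ⟨B₁, hB₁⟩ := exists_weightedL2_slice_le S.X.half_lt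
    obtain ⟨B₂, hB₂⟩ := exists_weightedL2_slice_le S.Y.half_lt
    refine ⟨(B₁ + B₂) * (2 * (C₁ + C₂)), fun φ₁ ψ₁ φ₂ ψ₂ hb₁ hb₂ ↦ ?_⟩
    obtain ⟨φh, ψh, g, h, hc⟩ := hflow φ₁ ψ₁ hb₁
    obtain ⟨φh', ψh', g', h', hc'⟩ := hflow φ₂ ψ₂ hb₂
    have hgh := hc.truncated
    have hgh' := hc'.truncated
    have mg := hgh.measurable₁
    have mh := hgh.measurable₂
    have mg' := hgh'.measurable₁
    have mh' := hgh'.measurable₂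
    have ng := ne_top_of_le_ne_top ENNReal.coe_ne_top hgh.norm_le₁
    have nh := ne_top_of_le_ne_top ENNReal.coe_ne_top hgh.norm_le₂
    have ng' := ne_top_of_le_ne_top ENNReal.coe_ne_top hgh'.norm_le₁
    have nh' := ne_top_of_le_ne_top ENNReal.coe_ne_top hgh'.norm_le₂
    have hlip := hS.norm_sub_le hκ hc.measurable₁ hc.measurable₂ hc'.measurable₁ hc'.measurable₂
      hgh hgh'
    rw [hC₁ (fun ξ ↦ φh ξ - φh' ξ) (hc.measurable₁.sub hc'.measurable₁),
      hC₂ (fun ξ ↦ ψh ξ - ψh' ξ) (hc.measurable₂.sub hc'.measurable₂), H.s₁, H.s₂] at hlip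
    rw [(hc.fourier₁.sub hc'.fourier₁).sobolevNorm_eq
        (weightedL2_sub_ne_top hc.measurable₁ hc'.measurable₁ hc.finite₁ hc'.finite₁),
      (hc.fourier₂.sub hc'.fourier₂).sobolevNorm_eq
        (weightedL2_sub_ne_top hc.measurable₂ hc'.measurable₂ hc.finite₂ hc'.finite₂)]
    -- the time slices of a difference are bounded by its Bourgain norm
    have key : ∀ (X : BourgainSpace) (B : ℝ≥0), (∀ p : ℝ → ℝ, Measurable p → ∀ s : ℝ,
        ∀ g : ℝ × ℝ → ℂ, Measurable g → ∀ t : ℝ,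
        weightedL2 s (slice g t) ≤ B * bourgainNorm p s X.b g) → ∀ f f' : ℝ × ℝ → ℂ,
        Measurable f → Measurable f' → X.norm f ≠ ∞ → X.norm f' ≠ ∞ →
        ∀ u u' : ℝ → 𝓢'(ℝ, ℂ), (∀ t, HasFourier (u t) (slice f t)) →
        (∀ t, HasFourier (u' t) (slice f' t)) →
        supSobolevDist X.s T u u' ≤ B * X.norm fun z ↦ f z - f' z := by
      intro X B hB f f' mf mf' nf nf' u u' hu hu'
      refine iSup₂_le fun t _ ↦ ?_
      have hs := fun {k : ℝ × ℝ → ℂ} (mk : Measurable k) (nk : X.norm k ≠ ∞) ↦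
        ne_top_of_le_ne_top (ENNReal.mul_ne_top ENNReal.coe_ne_top nk)
          (hB X.phase X.measurable_phase X.s k mk t)
      rw [((hu t).sub (hu' t)).sobolevNorm_eq (weightedL2_sub_ne_top (measurable_slice mf t)
        (measurable_slice mf' t) (hs mf nf) (hs mf' nf'))]
      have e : weightedL2 X.s (fun ξ ↦ slice f t ξ - slice f' t ξ) =
          weightedL2 X.s (slice (fun z ↦ f z - f' z) t) := by
        refine l2_congr_ae ?_
        filter_upwards [X.ae_integrable_slice mf nf, X.ae_integrable_slice mf' nf'] with ξ i1 i2
        rw [slice_sub i1 i2]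
      rw [e]
      exact hB _ X.measurable_phase _ _ (mf.sub mf') t
    have k1 := key S.X B₁ hB₁ g g' mg mg' ng ng' _ _ hc.slices₁ hc'.slices₁
    have k2 := key S.Y B₂ hB₂ h h' mh mh' nh nh' _ _ hc.slices₂ hc'.slices₂
    rw [H.s₁] at k1
    rw [H.s₂] at k2
    set d := S.X.norm fun z ↦ g z - g' z
    set e := S.Y.norm fun z ↦ h z - h' z
    set P := weightedL2 s fun ξ ↦ φh ξ - φh' ξ
    set Q := weightedL2 s' fun ξ ↦ ψh ξ - ψh' ξ
    calc _ ≤ B₁ * d + B₂ * e := add_le_add k1 k2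
      _ ≤ (B₁ + B₂) * (d + e) := by
          rw [add_mul]
          exact add_le_add (mul_le_mul_right le_self_add _) (mul_le_mul_right le_add_self _)
      _ ≤ (B₁ + B₂) * (2 * (C₁ * P + C₂ * Q)) := by gcongr
      _ ≤ (B₁ + B₂) * (2 * ((C₁ + C₂) * (P + Q))) := by
          gcongr
          rw [add_mul]
          exact add_le_add (mul_le_mul_right le_self_add _) (mul_le_mul_right le_add_self _)
      _ = _ := by push_cast; ring
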